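/- **Setting.** For every security parameter $\sigma\in\mathbb N$ let $p=p_\sigma$ be a prime of polynomially many bits ($p_\sigma\le 2^{\sigma^e+e}$ for some constant $e$) and $q=q_\sigma$ a divisor of $p-1$; all computations take place in the cyclic subgroup of order $q$ of $(\mathbb Z/p)^\times$ (the whole group if $q=p-1$), and a generator is an element of order $q$. There are $n$ nodes and $m$ groups ($n,m$ fixed), and every node belongs to one group or to none. Initially every group gets a uniformly random generator as its group secret, every node gets a uniformly random generator of its own, and $h_3,h_4,h_5:\mathbb Z/p\to\{0,1\}^\sigma$ are independent uniformly random functions (random oracles). The secret $s_k$ of a node $k$ is the secret of its group, or its own random generator if it has no group. In a run of the protocol between Alice (with secret $s_a$) and Bob (with secret $s_b$), Alice picks $x$ and Bob picks $y$ uniformly from $\{0,\dots,q-1\}$; Alice sends $v=s_a^x \bmod p$, Bob sends $u=s_b^y\bmod p$, Alice sends $h_4(u^x \bmod p)$, and Bob sends $h_5(v^y\bmod p)$. A *passive adversary* is a probabilistic algorithm that is stopped after polynomially many (in $\sigma$) steps (formally: a probabilistic random access machine with polynomial-time computable instructions). For a set $C$ of corrupted nodes it is given $\sigma,p,q$ and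 the secrets of all nodes in $C$; it may adaptively query $h_3,h_4,h_5$ and adaptively request the messages of fresh, unaltered runs between any two nodes of its choice, both outside $C$. It outputs a number. Given a threshold $\tau:\mathbb N\to\mathbb R$, call $f:\mathbb N\to\mathbb R$ *$\tau$-negligible* if for every $d$ one has $\sigma^d f(\sigma)<\tau(\sigma)$ for all sufficiently large $\sigma$. (For $\tau=1$ this is negligibility in the usual sense; for $\tau(\sigma)=2^{-\sigma}$ it implies $f(\sigma)<2^{-\sigma}$ for all large $\sigma$.) The *Diffie–Hellman assumption* at level $\tau$ for $(p_\sigma,q_\sigma)$ says: every probabilistic algorithm that is stopped after polynomially many steps, given $\sigma,p,q,g,g^a,g^b$ with $g$ a uniformly random generator and $a,b$ uniform in $\{0,\dots,q-1\}$, outputs $g^{ab}$ with $\tau$-negligible probability only. **Lemma (indistinguishability to eavesdroppers).** Let $\tau$ be any threshold and suppose that the Diffie–Hellman assumption at level $\tau$ holds. Let $i$ be a node, $G$ a group, and let two membership assignments agree on all nodes except $i$, where $i\in G$ in the first and $i\notin G$ in the second ($i$ then belongs to another group or to none). Let $C$ be any set of corrupted nodes with $i\notin C$; $C$ may contain members of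 $G$. Then for every passive adversary $\mathcal A$ the difference $$\bigl|\Pr[\mathcal A\text{ outputs }1\mid i\in G]-\Pr[\mathcal A\text{ outputs }1\mid i\notin G]\bigr|$$ is $\tau$-negligible. In particular, a passive adversary that eavesdrops on runs between $i$ and an honest node $j$ cannot determine with non-negligible probability whether $i\in G$, even if it is itself a member of $G$. -/

import Mathlib

/-!
# Eavesdropping on the single-group private handshake protocol

First a machine model (probabilistic random access machines with oracle calls and a step count), then
the Diffie-Hellman problem in a subgroup of the units modulo a prime, the protocol, and the
eavesdropping experiment in the random oracle model.
-/

namespace Handshake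

/-! ### Machines

The memory consists of arrays of natural numbers; array names occur literally in the program, indices
are computed.  Every instruction is computable in time polynomial in the bit lengths of its operands,
and its result is at most one bit longer than its longest operand.  (There is no unrestricted product;
products and powers are reduced modulo a third operand.)  Hence counting instructions is
polynomially equivalent to counting the steps of a Turing machine, and a program that is stopped after
polynomially many steps is a probabilistic polynomial-time machine. -/

/-- Binary instructions; comparisons return `1` for true and `0` for false. -/
inductive BinOp where
  | add | sub | div | mod | eq | lt

def BinOp.eval : BinOp → ℕ → ℕ → ℕ
  | .add, x, y => x + y
  | .sub, x, y => x - y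
  | .div, x, y => x / y
  | .mod, x, y => x % y
  | .eq, x, y => if x = y then 1 else 0
  | .lt, x, y => if x < y then 1 else 0

/-- Expressions: constants, the cell of the array `a` at a computed index, binary instructions, modular
products and modular powers. -/
inductive Expr where
  | const (c : ℕ)
  | load (a : ℕ) (i : Expr)
  | bin (o : BinOp) (e f : Expr)
  | mulMod (e f r : Expr)
  | powMod (e f r : Expr)

/-- `M a i` is the content of the cell with index `i` of the array `a`. -/
abbrev Memory := ℕ → ℕ → ℕ

/-- The value of an expression.  A modular product or power with modulus `0` is `0`. -/
def Expr.eval (M : Memory) : Expr → ℕ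
  | .const c => c
  | .load a i => M a (i.eval M)
  | .bin o e f => o.eval (e.eval M) (f.eval M)
  | .mulMod e f r => if r.eval M = 0 then 0 else e.eval M * f.eval M % r.eval M
  | .powMod e f r => if r.eval M = 0 then 0 else e.eval M ^ f.eval M % r.eval M

/-- Programs. `store a i e` writes the value of `e` into the cell `i` of the array `a`;
`rand a i e` writes a uniformly random number below the value of `e` there;
`call a q` sends the list of the values of `q` to the oracle and replaces the content of the array `a`
by the answer (followed by zeros); `cond e c d` runs `c` if `e` is nonzero and `d` otherwise;
`loop e c` repeats `c` as long as `e` is nonzero. -/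
inductive Cmd where
  | skip
  | store (a : ℕ) (i e : Expr)
  | rand (a : ℕ) (i e : Expr)
  | call (a : ℕ) (q : List Expr)
  | seq (c d : Cmd)
  | cond (e : Expr) (c d : Cmd)
  | loop (e : Expr) (c : Cmd)

/-- A configuration: the commands still to be executed (none: the machine has halted), and the
memory. -/
structure Config where
  todo : List Cmd
  mem : Memory

/-- An oracle answers a list of numbers by a (random) list of numbers. -/
abbrev Oracle := List ℕ → PMF (List ℕ)

/-- Writing one cell. -/
def Memory.write (M : Memory) (a i v : ℕ) : Memory :=
  Function.update M a (Function.update (M a) i v)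

/-- The uniform distribution on the numbers below `b` (the number `0` if `b = 0`). -/
noncomputable def uniformBelow (b : ℕ) : PMF ℕ :=
  PMF.uniformOfFinset (Finset.range (max b 1))
    (Finset.nonempty_range_iff.mpr (by omega))

/-- One step of the machine with oracle `O`. -/
noncomputable def step (O : Oracle) : Config → PMF Config
  | ⟨[], M⟩ => PMF.pure ⟨[], M⟩
  | ⟨.skip :: K, M⟩ => PMF.pure ⟨K, M⟩
  | ⟨.store a i e :: K, M⟩ => PMF.pure ⟨K, M.write a (i.eval M) (e.eval M)⟩
  | ⟨.rand a i e :: K, M⟩ =>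
      (uniformBelow (e.eval M)).bind fun v => PMF.pure ⟨K, M.write a (i.eval M) v⟩
  | ⟨.call a q :: K, M⟩ =>
      (O (q.map (Expr.eval M))).bind fun ans =>
        PMF.pure ⟨K, Function.update M a fun i => ans.getD i 0⟩
  | ⟨.seq c d :: K, M⟩ => PMF.pure ⟨c :: d :: K, M⟩
  | ⟨.cond e c d :: K, M⟩ => PMF.pure ⟨if e.eval M = 0 then d :: K else c :: K, M⟩
  | ⟨.loop e c :: K, M⟩ => PMF.pure ⟨if e.eval M = 0 then K else c :: .loop e c :: K, M⟩

/-- `t` steps of the machine with oracle `O`. -/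
noncomputable def steps (O : Oracle) : ℕ → Config → PMF Config
  | 0, s => PMF.pure s
  | t + 1, s => (step O s).bind (steps O t)

/-- The output of the program `c` with oracle `O`, stopped after `t` steps. The input is in array `0`
(all other cells are `0`), the output is the cell `0` of array `1`. -/
noncomputable def output (O : Oracle) (c : Cmd) (t : ℕ) (input : List ℕ) : PMF ℕ :=
  (steps O t ⟨[c], fun a i => if a = 0 then input.getD i 0 else 0⟩).map fun s => s.mem 1 0

/-- The trivial oracle: machines that run on their own. -/
noncomputable def noOracle : Oracle := fun _ => PMF.pure []

/-! ### Negligible functions -/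

/-- `f` is negligible with respect to the threshold `τ` if, multiplied by any polynomial in the security
parameter, it is eventually below `τ`. For `τ = 1` these are the negligible functions
in the usual sense; for `τ σ = 1 / 2 ^ σ` they are eventually smaller than `1 / 2 ^ σ`. -/
def Negligible (τ f : ℕ → ℝ) : Prop :=
  ∀ d : ℕ, ∀ᶠ σ : ℕ in Filter.atTop, (σ : ℝ) ^ d * f σ < τ σ

/-! ### The group and the Diffie-Hellman problem -/

/-- Public parameters: a prime `p` and a divisor `q` of `p - 1`. The computations take place in the
cyclic group of order `q` inside the units modulo `p` (for `q = p - 1`: all units). -/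
structure Params where
  p : ℕ
  q : ℕ
  prime : p.Prime
  dvd : q ∣ p - 1

instance (P : Params) : Fact P.p.Prime := ⟨P.prime⟩

theorem Params.q_pos (P : Params) : 0 < P.q :=
  Nat.pos_of_dvd_of_pos P.dvd (by have := P.prime.two_le; omega)

instance (P : Params) : NeZero P.q := ⟨P.q_pos.ne'⟩

/-- The generators of the group of order `q`. -/
def Params.Gen (P : Params) : Type := {s : (ZMod P.p)ˣ // orderOf s = P.q}

instance (P : Params) : Finite P.Gen := by unfold Params.Gen; infer_instance

noncomputable instance (P : Params) : Fintype P.Gen := Fintype.ofFinite _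

instance (P : Params) : Nonempty P.Gen := by
  obtain ⟨g, hg⟩ := IsCyclic.exists_ofOrder_eq_natCard (α := (ZMod P.p)ˣ)
  have hc : orderOf g = P.p - 1 := by
    rw [hg, Nat.card_eq_fintype_card, ZMod.card_units]
  obtain ⟨r, hr⟩ := P.dvd
  have h1 : 0 < P.p - 1 := by have := P.prime.two_le; omega
  have hr0 : r ≠ 0 := by
    rintro rfl
    omega
  refine ⟨⟨g ^ r, ?_⟩⟩
  rw [orderOf_pow_of_dvd hr0 (by rw [hc, hr]; exact Dvd.intro_left _ rfl), hc, hr]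
  exact Nat.mul_div_cancel _ (Nat.pos_of_ne_zero hr0)

/-- The representative of a residue class in `{1, …, p - 1}`. -/
def Params.code (P : Params) (z : (ZMod P.p)ˣ) : ℕ := (z : ZMod P.p).val

/-- The Diffie-Hellman experiment: choose a random generator `g` and random exponents `a`, `b`,
hand out `g`, `g ^ a`, `g ^ b`, and check whether the program `c`, stopped after `t` steps,
has found `g ^ (a * b)`. -/
noncomputable def dhExperiment (P : Params) (σ : ℕ) (c : Cmd) (t : ℕ) : PMF Bool :=
  (PMF.uniformOfFintype P.Gen).bind fun g =>
  (PMF.uniformOfFintype (Fin P.q)).bind fun a =>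
  (PMF.uniformOfFintype (Fin P.q)).bind fun b =>
  (output noOracle c t
    [σ, P.p, P.q, P.code g.1, P.code (g.1 ^ (a : ℕ)), P.code (g.1 ^ (b : ℕ))]).map fun z =>
      decide (z = P.code (g.1 ^ ((a : ℕ) * (b : ℕ))))

/-- The (computational) Diffie-Hellman assumption for a sequence of parameters: every program that is
stopped after polynomially many steps succeeds with negligible probability only. -/
def DiffieHellman (τ : ℕ → ℝ) (par : ℕ → Params) : Prop :=
  ∀ (c : Cmd) (k : ℕ),
    Negligible τ fun σ => (dhExperiment (par σ) σ c (σ ^ k + k) true).toReal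

/-! ### The protocol -/

/-- The random choices made before any run: for every group its group secret, for every node a random
secret that the node uses if it belongs to no group, and the hash functions (random oracles) with
values of `σ` bits. -/
structure Setup (P : Params) (σ n m : ℕ) where
  groupSecret : Fin m → P.Gen
  ownSecret : Fin n → P.Gen
  h3 : ZMod P.p → Fin (2 ^ σ)
  h4 : ZMod P.p → Fin (2 ^ σ)
  h5 : ZMod P.p → Fin (2 ^ σ)

/-- All choices of the setup are uniform and independent. -/
noncomputable def setup (P : Params) (σ n m : ℕ) : PMF (Setup P σ n m) :=
  (PMF.uniformOfFintype (Fin m → P.Gen)).bind fun s =>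
  (PMF.uniformOfFintype (Fin n → P.Gen)).bind fun r =>
  (PMF.uniformOfFintype (ZMod P.p → Fin (2 ^ σ))).bind fun h3 =>
  (PMF.uniformOfFintype (ZMod P.p → Fin (2 ^ σ))).bind fun h4 =>
  (PMF.uniformOfFintype (ZMod P.p → Fin (2 ^ σ))).bind fun h5 =>
  PMF.pure ⟨s, r, h3, h4, h5⟩

/-- The membership of the nodes: every one of the `n` nodes belongs to one of the `m` groups or to
none. -/
abbrev Membership (n m : ℕ) := Fin n → Option (Fin m)

/-- The secret generator with which node `k` runs the protocol. -/
def Setup.secret {P : Params} {σ n m : ℕ} (S : Setup P σ n m) (γ : Membership n m) (k : Fin n) :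
    (ZMod P.p)ˣ :=
  match γ k with
  | some g => (S.groupSecret g).1
  | none => (S.ownSecret k).1

/-- The messages of an unaltered run between Alice (node `k`) and Bob (node `l`), who pick random
exponents `x` and `y`: Alice sends `v`, Bob sends `u`, Alice sends `h4 (u ^ x)`, Bob sends
`h5 (v ^ y)`. -/
noncomputable def transcript {P : Params} {σ n m : ℕ} (S : Setup P σ n m) (γ : Membership n m)
    (k l : Fin n) : PMF (List ℕ) :=
  (PMF.uniformOfFintype (Fin P.q)).bind fun x =>
  (PMF.uniformOfFintype (Fin P.q)).bind fun y =>
  let v := S.secret γ k ^ (x : ℕ)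
  let u := S.secret γ l ^ (y : ℕ)
  PMF.pure [P.code v, P.code u,
    (S.h4 (u ^ (x : ℕ) : (ZMod P.p)ˣ) : ℕ), (S.h5 (v ^ (y : ℕ) : (ZMod P.p)ˣ) : ℕ)]

/-- What a passive adversary that has corrupted the nodes in `C` can ask for: `[0, k, l]` is a request
for the messages of a fresh run between the nodes `k` and `l`, which must both be uncorrupted;
`[3, z]`, `[4, z]`, `[5, z]` ask for the value of the respective hash function at the
residue class of `z`. Other queries are answered by the empty list. -/
noncomputable def eavesdropping {P : Params} {σ n m : ℕ} (S : Setup P σ n m) (γ : Membership n m)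
    (C : Finset (Fin n)) : Oracle
  | [0, k, l] =>
      if hk : k < n then
        if hl : l < n then
          if (⟨k, hk⟩ : Fin n) ∉ C ∧ (⟨l, hl⟩ : Fin n) ∉ C then
            transcript S γ ⟨k, hk⟩ ⟨l, hl⟩
          else PMF.pure []
        else PMF.pure []
      else PMF.pure []
  | [3, z] => PMF.pure [(S.h3 (z : ZMod P.p) : ℕ)]
  | [4, z] => PMF.pure [(S.h4 (z : ZMod P.p) : ℕ)]
  | [5, z] => PMF.pure [(S.h5 (z : ZMod P.p) : ℕ)]
  | _ => PMF.pure []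

/-- The eavesdropping experiment with membership `γ` and corrupted nodes `C`: the adversary `c` gets
the public parameters and the secrets of the corrupted nodes (`0` stands for the secret of an
uncorrupted node), may eavesdrop, and is stopped after `t` steps. The result is its output. -/
noncomputable def eavesdropExperiment (P : Params) (σ : ℕ) {n m : ℕ} (γ : Membership n m)
    (C : Finset (Fin n)) (c : Cmd) (t : ℕ) : PMF ℕ :=
  (setup P σ n m).bind fun S =>
    output (eavesdropping S γ C) c t
      (σ :: P.p :: P.q :: List.ofFn fun k => if k ∈ C then P.code (S.secret γ k) else 0)

/-- How much better than a constant guess the adversary tells the memberships `γ₁` and `γ₀` apart: the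
difference of the probabilities of output `1` in the two experiments. -/
noncomputable def advantage (P : Params) (σ : ℕ) {n m : ℕ} (γ₁ γ₀ : Membership n m)
    (C : Finset (Fin n)) (c : Cmd) (t : ℕ) : ℝ :=
  |(eavesdropExperiment P σ γ₁ C c t 1).toReal - (eavesdropExperiment P σ γ₀ C c t 1).toReal|

end Handshake

/-! If `s` is a generator and `x` is a uniform exponent, then `s ^ x` is uniform in the group of
order `q`, whatever `s` is. So the first two messages of a run say nothing about the secrets. Only
the two hash values could, and for random oracles these look like fresh random strings as long as
the hashed elements do not occur a second time.

The real experiment is therefore compared with an ideal one, in which a run sends fresh random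
values instead of hashes and the adversary's hash queries are answered from a lazily sampled table.
Both agree until a `Bad` event: a hash argument of a run occurs in another run or in a query
(`mean_idealSteps_le`). Apart from the adversary's input, the ideal experiment does not depend on
the secrets (`mean_idealSteps_congr`), and corrupted nodes have the same secrets under both
memberships. Hence the advantage is at most the sum of the two probabilities of a bad event
(`advantage_le`).

A bad event solves the Diffie-Hellman problem. The reduction guesses the call `i` of the run, the
call `j` in which its hash argument recurs, the hash function, and the node that sends the hash
value. It chooses the secrets as known powers `g ^ ρ` of the challenge basis, simulates the ideal
experiment, and uses `g ^ a` and `g ^ b` as the messages `v` and `u` of call `i`. The hash values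
there are fresh, so the unknown hash arguments are never needed. If Alice has the secret `s = g ^ ρ`
and `s ^ x = g ^ a`, her hash argument `u ^ x` satisfies `(u ^ x) ^ ρ = g ^ (a * b)`; Bob's case is
symmetric. No exponent has to be inverted modulo `q`. In call `j` the hash arguments are known to
the reduction, which outputs the guessed one raised to the power `ρ` (`Simulates.output_eq`,
`mean_collision_le_value`).

The guesses cost a factor `3 * n * N ^ 2`, where `N` bounds the number of calls. A random exponent
belongs to a generator with probability `φ(q) / q ≥ 1 / (log₂ q + 1)` only, and this is lost once
for each of the `m + n` secrets. All losses are polynomial factors and there is no additive error,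
which is why any threshold `τ` is admissible. -/

open scoped ENNReal

namespace Handshake

/-! ### Expectations -/

/-- The expectation of `F` under `μ`. -/
noncomputable def mean {α : Type*} (μ : PMF α) (F : α → ℝ≥0∞) : ℝ≥0∞ := ∑' x, μ x * F x

section mean
variable {α β : Type*}

@[simp] theorem mean_pure (a : α) (F : α → ℝ≥0∞) : mean (PMF.pure a) F = F a := by
  unfold mean
  rw [tsum_eq_single a]
  · simp
  · intro b hb
    simp [hb]

@[simp] theorem mean_bind (μ : PMF α) (f : α → PMF β) (F : β → ℝ≥0∞) :
    mean (μ.bind f) F = mean μ fun x => mean (f x) F := by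
  unfold mean
  simp only [PMF.bind_apply, ← ENNReal.tsum_mul_right, ← ENNReal.tsum_mul_left, mul_assoc]
  exact ENNReal.tsum_comm

@[simp] theorem mean_map (μ : PMF α) (f : α → β) (F : β → ℝ≥0∞) :
    mean (μ.map f) F = mean μ fun x => F (f x) := by
  rw [← PMF.bind_pure_comp, mean_bind]
  simp

theorem mean_mono (μ : PMF α) {F G : α → ℝ≥0∞} (h : ∀ x, F x ≤ G x) : mean μ F ≤ mean μ G :=
  ENNReal.tsum_le_tsum fun x => by gcongr; exact h x

@[simp] theorem mean_const (μ : PMF α) (c : ℝ≥0∞) : mean μ (fun _ => c) = c := by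
  unfold mean
  rw [ENNReal.tsum_mul_right, PMF.tsum_coe, one_mul]

theorem mean_mul_left (μ : PMF α) (c : ℝ≥0∞) (F : α → ℝ≥0∞) :
    mean μ (fun x => c * F x) = c * mean μ F := by
  unfold mean
  rw [← ENNReal.tsum_mul_left]
  exact tsum_congr fun x => by ring

theorem mean_add (μ : PMF α) (F G : α → ℝ≥0∞) :
    mean μ (fun x => F x + G x) = mean μ F + mean μ G := by
  unfold mean
  rw [← ENNReal.tsum_add]
  exact tsum_congr fun x => by ring

theorem mean_sum {ι : Type*} (s : Finset ι) (μ : PMF α) (F : ι → α → ℝ≥0∞) :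
    mean μ (fun x => ∑ i ∈ s, F i x) = ∑ i ∈ s, mean μ (F i) := by
  classical
  induction s using Finset.induction_on with
  | empty => simp
  | insert i s hi ih => simp only [Finset.sum_insert hi, mean_add, ih]

theorem mean_comm (μ : PMF α) (ν : PMF β) (F : α → β → ℝ≥0∞) :
    (mean μ fun x => mean ν fun y => F x y) = mean ν fun y => mean μ fun x => F x y := by
  unfold mean
  simp only [← ENNReal.tsum_mul_left]
  rw [ENNReal.tsum_comm]
  exact tsum_congr fun y => tsum_congr fun x => by ring

theorem mean_uniform [Fintype α] [Nonempty α] (F : α → ℝ≥0∞) :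
    mean (PMF.uniformOfFintype α) F = (Fintype.card α : ℝ≥0∞)⁻¹ * ∑ x, F x := by
  unfold mean
  rw [tsum_fintype, Finset.mul_sum]
  simp

theorem mean_uniform_equiv [Fintype α] [Nonempty α] [Fintype β] [Nonempty β] (e : α ≃ β)
    (F : β → ℝ≥0∞) :
    (mean (PMF.uniformOfFintype α) fun x => F (e x)) = mean (PMF.uniformOfFintype β) F := by
  rw [mean_uniform, mean_uniform, Fintype.card_congr e, Equiv.sum_comp e F]

theorem mean_uniform_prod [Fintype α] [Nonempty α] [Fintype β] [Nonempty β]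
    (F : α × β → ℝ≥0∞) :
    mean (PMF.uniformOfFintype (α × β)) F =
      mean (PMF.uniformOfFintype α) fun x => mean (PMF.uniformOfFintype β) fun y => F (x, y) := by
  simp only [mean_uniform]
  rw [Fintype.sum_prod_type, Fintype.card_prod, Nat.cast_mul,
    ENNReal.mul_inv (by simp) (by simp), ← Finset.mul_sum, mul_assoc]

/-- Restricting a uniform choice to the image of an injection. -/
theorem mean_uniform_injective [Fintype α] [Nonempty α] [Fintype β] [Nonempty β] {f : α → β}
    (hf : Function.Injective f) (F : β → ℝ≥0∞) :
    (Fintype.card α : ℝ≥0∞) / Fintype.card β *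
      mean (PMF.uniformOfFintype α) (fun x => F (f x)) ≤ mean (PMF.uniformOfFintype β) F := by
  classical
  have h : ∀ a b s : ℝ≥0∞, a / b * (a⁻¹ * s) = a * a⁻¹ * (b⁻¹ * s) := fun a b s => by
    rw [div_eq_mul_inv]; ring
  rw [mean_uniform, mean_uniform, h, ENNReal.mul_inv_cancel (by simp) (by simp), one_mul]
  gcongr
  calc ∑ x, F (f x) = ∑ y ∈ Finset.univ.image f, F y :=
        (Finset.sum_image fun a _ b _ h => hf h).symm
    _ ≤ ∑ y, F y := Finset.sum_le_sum_of_subset (Finset.subset_univ _)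

theorem mean_uniformBelow (b : ℕ) [NeZero b] (F : ℕ → ℝ≥0∞) :
    mean (uniformBelow b) F = mean (PMF.uniformOfFintype (Fin b)) fun x => F x := by
  have hb : max b 1 = b := max_eq_left (Nat.one_le_iff_ne_zero.mpr (NeZero.ne b))
  rw [mean_uniform]
  unfold mean uniformBelow
  rw [Finset.mul_sum, Fin.sum_univ_eq_sum_range fun i => (Fintype.card (Fin b) : ℝ≥0∞)⁻¹ * F i,
    tsum_eq_sum (s := Finset.range b)]
  · refine Finset.sum_congr rfl fun x hx => ?_
    rw [PMF.uniformOfFinset_apply_of_mem _ (by rwa [hb])]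
    simp [hb]
  · intro x hx
    rw [PMF.uniformOfFinset_apply_of_notMem _ (by rwa [hb]), zero_mul]

theorem apply_eq_mean [DecidableEq α] (μ : PMF α) (a : α) :
    μ a = mean μ fun x => if x = a then 1 else 0 := by
  unfold mean
  simp

/-- A uniform function can be sampled by choosing its value at one point separately. -/
theorem mean_uniform_update [Fintype α] [DecidableEq α] [Fintype β] [Nonempty β] (a : α)
    (F : (α → β) → ℝ≥0∞) :
    mean (PMF.uniformOfFintype (α → β)) F =
      mean (PMF.uniformOfFintype β) fun v =>
        mean (PMF.uniformOfFintype (α → β)) fun h => F (Function.update h a v) := by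
  have key : ∀ f : β × (α → β) → ℝ≥0∞,
      (mean (PMF.uniformOfFintype β) fun v =>
        mean (PMF.uniformOfFintype (α → β)) fun h => f (v, h)) =
      mean (PMF.uniformOfFintype β) fun v =>
        mean (PMF.uniformOfFintype (α → β)) fun h => f (h a, Function.update h a v) := by
    intro f
    rw [← mean_uniform_prod, ← mean_uniform_prod
      (F := fun x : β × (α → β) => f (x.2 a, Function.update x.2 a x.1))]
    -- Exchanging the separate value with the value of the function at `a` is an involution, so it
    -- preserves the uniform distribution.
    let e : β × (α → β) ≃ β × (α → β) :=
      { toFun := fun x => (x.2 a, Function.update x.2 a x.1)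
        invFun := fun x => (x.2 a, Function.update x.2 a x.1)
        left_inv := fun x => by simp
        right_inv := fun x => by simp }
    exact (mean_uniform_equiv e f).symm
  have := key fun x => F x.2
  simpa using this

end mean

/-! ### Machines without oracle -/

@[simp] theorem Memory.write_apply (M : Memory) (a i v b j : ℕ) :
    M.write a i v b j = if b = a ∧ j = i then v else M b j := by
  unfold Memory.write
  by_cases hb : b = a
  · subst hb
    by_cases hj : j = i
    · subst hj
      simp
    · simp [hj]
  · simp [hb]

theorem steps_add_one (O : Oracle) (t : ℕ) (s : Config) :
    steps O (t + 1) s = (step O s).bind (steps O t) := rfl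

theorem output_apply (O : Oracle) (c : Cmd) (t : ℕ) (input : List ℕ) (z : ℕ) :
    output O c t input z =
      mean (steps O t ⟨[c], fun a i => if a = 0 then input.getD i 0 else 0⟩)
        fun s => if s.mem 1 0 = z then 1 else 0 := by
  rw [apply_eq_mean, output, mean_map]

/-- The least expected value of `f` when the machine without oracle, started with the commands `K` and
the memory `M`, is stopped after `N` or more steps. -/
noncomputable def value (f : Config → ℝ≥0∞) (N : ℕ) (K : List Cmd) (M : Memory) : ℝ≥0∞ :=
  ⨅ T : ℕ, ⨅ _ : N ≤ T, mean (steps noOracle T ⟨K, M⟩) f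

theorem value_le_mean (f : Config → ℝ≥0∞) {N T : ℕ} (h : N ≤ T) (K : List Cmd) (M : Memory) :
    value f N K M ≤ mean (steps noOracle T ⟨K, M⟩) f :=
  iInf₂_le T h

theorem value_mono (f : Config → ℝ≥0∞) {N N' : ℕ} (h : N ≤ N') (K : List Cmd) (M : Memory) :
    value f N K M ≤ value f N' K M :=
  le_iInf₂ fun _ hT => value_le_mean f (h.trans hT) K M

/-- First-step analysis; it is an inequality because the infimum over the running times is pulled
out of the expectation. Since `value` admits every longer running time, upper bounds for the
durations of commands suffice when commands are composed. -/
theorem mean_step_value_le (f : Config → ℝ≥0∞) (N : ℕ) (K : List Cmd) (M : Memory) :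
    mean (step noOracle ⟨K, M⟩) (fun s => value f N s.todo s.mem) ≤ value f (N + 1) K M := by
  refine le_iInf₂ fun T hT => ?_
  obtain ⟨T, rfl⟩ : ∃ t, T = t + 1 := ⟨T - 1, by omega⟩
  rw [steps_add_one, mean_bind]
  exact mean_mono _ fun s => value_le_mean f (by omega) _ _

/-- The distribution of the memory after the execution of a program without loops. -/
noncomputable def Cmd.exec : Cmd → Memory → PMF Memory
  | .skip, M => PMF.pure M
  | .store a i e, M => PMF.pure (M.write a (i.eval M) (e.eval M))
  | .rand a i e, M => (uniformBelow (e.eval M)).map fun v => M.write a (i.eval M) v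
  -- The trivial oracle answers with the empty list, so a call just clears the array.
  | .call a _, M => PMF.pure (Function.update M a fun _ => 0)
  | .seq c d, M => (c.exec M).bind d.exec
  | .cond e c d, M => if e.eval M = 0 then d.exec M else c.exec M
  -- A dummy value: loops are excluded wherever `exec` is compared with the machine.
  | .loop _ _, M => PMF.pure M

/-- Programs without loops. -/
def Cmd.LoopFree : Cmd → Prop
  | .seq c d => c.LoopFree ∧ d.LoopFree
  | .cond _ c d => c.LoopFree ∧ d.LoopFree
  | .loop _ _ => False
  | _ => True

/-- A bound for the number of steps of a program without loops. -/
def Cmd.time : Cmd → ℕ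
  | .seq c d => c.time + d.time + 1
  | .cond _ c d => max c.time d.time + 1
  | _ => 1

/-- This allows blocks of the reduction to be analysed by `exec`, without following single machine
steps: along every branch a loop-free program is finished after at most `c.time` steps. -/
theorem mean_exec_value_le (f : Config → ℝ≥0∞) {c : Cmd} (hc : c.LoopFree) :
    ∀ (N : ℕ) (K : List Cmd) (M : Memory),
      mean (c.exec M) (value f N K) ≤ value f (N + c.time) (c :: K) M := by
  induction c with
  | skip =>
    intro N K M
    refine le_trans ?_ (mean_step_value_le f N _ M)
    simp [step, Cmd.exec]
  | store a i e =>
    intro N K M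
    refine le_trans ?_ (mean_step_value_le f N _ M)
    simp [step, Cmd.exec]
  | rand a i e =>
    intro N K M
    refine le_trans ?_ (mean_step_value_le f N _ M)
    simp [step, Cmd.exec]
  | call a q =>
    intro N K M
    refine le_trans ?_ (mean_step_value_le f N _ M)
    simp [step, Cmd.exec, noOracle]
  | seq c d ihc ihd =>
    intro N K M
    refine le_trans ?_ ((mean_step_value_le f (N + c.time + d.time) _ M).trans
      (value_mono f (by simp only [Cmd.time]; omega) _ _))
    simp only [step, Cmd.exec, mean_pure, mean_bind]
    calc mean (c.exec M) (fun x => mean (d.exec x) (value f N K))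
        ≤ mean (c.exec M) (value f (N + d.time) (d :: K)) := mean_mono _ fun x => ihd hc.2 N K x
      _ ≤ value f (N + d.time + c.time) (c :: d :: K) M := ihc hc.1 _ _ _
      _ = _ := by rw [Nat.add_right_comm]
  | cond e c d ihc ihd =>
    intro N K M
    refine le_trans ?_ ((mean_step_value_le f (N + max c.time d.time) _ M).trans
      (value_mono f (by simp only [Cmd.time]; omega) _ _))
    simp only [step, Cmd.exec, mean_pure]
    split_ifs with h
    · exact (ihd hc.2 N K M).trans (value_mono f (by omega) _ _)
    · exact (ihc hc.1 N K M).trans (value_mono f (by omega) _ _)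
  | loop e c _ => exact hc.elim

/-! ### The ideal experiment

The hash values in the runs are fresh random values, and the hash functions are sampled lazily.
The experiment keeps a record of all calls. -/

/-- The arguments of the three hash functions `h3`, `h4`, `h5`, numbered `0`, `1`, `2`. -/
abbrev Key (P : Params) := Fin 3 × ZMod P.p

/-- What happened in a call: a hash query, a run of the protocol, or nothing. -/
inductive Event (P : Params) (σ n : ℕ) where
  | other
  | query (a : Key P) (w : Fin (2 ^ σ))
  | run (k l : Fin n) (x y : Fin P.q) (w₁ w₂ : Fin (2 ^ σ))

/-- The chronicle of an experiment, latest event first. -/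
abbrev History (P : Params) (σ n : ℕ) := List (Event P σ n)

/-- How the exponents of a run are chosen; this may depend on the number of previous calls and on the
two nodes. -/
abbrev Sampler (P : Params) (n : ℕ) := ℕ → Fin n → Fin n → PMF (Fin P.q × Fin P.q)

/-- Uniform exponents. -/
noncomputable def uniformSampler (P : Params) (n : ℕ) : Sampler P n :=
  fun _ _ _ => PMF.uniformOfFintype (Fin P.q × Fin P.q)

variable {P : Params} {σ n m : ℕ}

/-- The argument of `h4` in a run. -/
def aliceKey (s : Fin n → P.Gen) (l : Fin n) (x y : Fin P.q) : Key P :=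
  (1, (((s l).1 ^ (y : ℕ)) ^ (x : ℕ) : (ZMod P.p)ˣ))

/-- The argument of `h5` in a run. -/
def bobKey (s : Fin n → P.Gen) (k : Fin n) (x y : Fin P.q) : Key P :=
  (2, (((s k).1 ^ (x : ℕ)) ^ (y : ℕ) : (ZMod P.p)ˣ))

/-- The hash arguments in a run. -/
def Event.runKeys (s : Fin n → P.Gen) : Event P σ n → List (Key P)
  | .run k l x y _ _ => [aliceKey s l x y, bobKey s k x y]
  | _ => []

/-- All hash arguments in an event. -/
def Event.keys (s : Fin n → P.Gen) : Event P σ n → List (Key P)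
  | .query a _ => [a]
  | .run k l x y _ _ => [aliceKey s l x y, bobKey s k x y]
  | .other => []

/-- The hash value of `a` that was given to the adversary on request. -/
def Event.asked (a : Key P) : Event P σ n → Option (Fin (2 ^ σ))
  | .query b w => if a = b then some w else none
  | _ => none

/-- The hash value of `a` that was used. -/
def Event.used (s : Fin n → P.Gen) (a : Key P) : Event P σ n → Option (Fin (2 ^ σ))
  | .query b w => if a = b then some w else none
  | .run k l x y w₁ w₂ =>
      if a = aliceKey s l x y then some w₁ else if a = bobKey s k x y then some w₂ else none
  | .other => none

/-- The hash table of the adversary's requests. -/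
def asked (hist : History P σ n) (a : Key P) : Option (Fin (2 ^ σ)) :=
  hist.findSome? (Event.asked a)

/-- The hash table of all values used. -/
def used (s : Fin n → P.Gen) (hist : History P σ n) (a : Key P) : Option (Fin (2 ^ σ)) :=
  hist.findSome? (Event.used s a)

/-- A hash argument of a run occurs in another event, too. -/
def Bad (s : Fin n → P.Gen) : History P σ n → Prop
  | [] => False
  | e :: hist => Bad s hist ∨ ∃ e' ∈ hist,
      (∃ a ∈ e.runKeys s, a ∈ e'.keys s) ∨ ∃ a ∈ e.keys s, a ∈ e'.runKeys s

/-- The answer to a hash query. -/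
noncomputable def idealHash (hist : History P σ n) (a : Key P) : PMF (List ℕ × Event P σ n) :=
  match asked hist a with
  | some w => PMF.pure ([(w : ℕ)], .query a w)
  | none => (PMF.uniformOfFintype (Fin (2 ^ σ))).map fun w : Fin (2 ^ σ) => ([(w : ℕ)], .query a w)

/-- The messages of a run. -/
noncomputable def idealRun (s : Fin n → P.Gen) (smp : PMF (Fin P.q × Fin P.q)) (k l : Fin n) :
    PMF (List ℕ × Event P σ n) :=
  smp.bind fun z =>
  (PMF.uniformOfFintype (Fin (2 ^ σ))).bind fun w₁ : Fin (2 ^ σ) =>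
  (PMF.uniformOfFintype (Fin (2 ^ σ))).map fun w₂ : Fin (2 ^ σ) =>
    ([P.code ((s k).1 ^ (z.1 : ℕ)), P.code ((s l).1 ^ (z.2 : ℕ)), (w₁ : ℕ), (w₂ : ℕ)],
      .run k l z.1 z.2 w₁ w₂)

/-- The oracle of the ideal experiment. -/
noncomputable def idealOracle (s : Fin n → P.Gen) (C : Finset (Fin n)) (smp : Sampler P n)
    (hist : History P σ n) : List ℕ → PMF (List ℕ × Event P σ n)
  | [0, k, l] =>
      if h : ∃ (hk : k < n) (hl : l < n), (⟨k, hk⟩ : Fin n) ∉ C ∧ (⟨l, hl⟩ : Fin n) ∉ C then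
        idealRun s (smp hist.length ⟨k, h.1⟩ ⟨l, h.2.1⟩) ⟨k, h.1⟩ ⟨l, h.2.1⟩
      else PMF.pure ([], .other)
  | [3, z] => idealHash hist (0, z)
  | [4, z] => idealHash hist (1, z)
  | [5, z] => idealHash hist (2, z)
  | _ => PMF.pure ([], .other)

/-- One step of the ideal experiment. -/
noncomputable def idealStep (s : Fin n → P.Gen) (C : Finset (Fin n)) (smp : Sampler P n) :
    Config × History P σ n → PMF (Config × History P σ n)
  | (⟨.call a q :: K, M⟩, hist) =>
      (idealOracle s C smp hist (q.map (Expr.eval M))).map fun r =>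
        (⟨K, Function.update M a fun i => r.1.getD i 0⟩, r.2 :: hist)
  | (cfg, hist) => (step noOracle cfg).map fun cfg' => (cfg', hist)

/-- `t` steps of the ideal experiment. -/
noncomputable def idealSteps (s : Fin n → P.Gen) (C : Finset (Fin n)) (smp : Sampler P n) :
    ℕ → Config × History P σ n → PMF (Config × History P σ n)
  | 0, st => PMF.pure st
  | t + 1, st => (idealStep s C smp st).bind (idealSteps s C smp t)

/-- A configuration whose next command is not a call. -/
def Config.Silent (cfg : Config) : Prop := ∀ a q K, cfg.todo ≠ .call a q :: K

theorem Config.silent_or (cfg : Config) :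
    cfg.Silent ∨ ∃ a q K M, cfg = ⟨.call a q :: K, M⟩ := by
  by_cases h : cfg.Silent
  · exact .inl h
  · unfold Config.Silent at h
    push Not at h
    obtain ⟨a, q, K, h⟩ := h
    exact .inr ⟨a, q, K, cfg.mem, by rw [← h]⟩

theorem Config.Silent.step_eq {cfg : Config} (h : cfg.Silent) (O : Oracle) :
    step O cfg = step noOracle cfg := by
  rcases cfg with ⟨_ | ⟨c, K⟩, M⟩
  · simp [step]
  · cases c
    case call a q => exact absurd rfl (h a q K)
    all_goals simp [step]

theorem Config.Silent.idealStep_eq {cfg : Config} (h : cfg.Silent) (s : Fin n → P.Gen)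
    (C : Finset (Fin n)) (smp : Sampler P n) (hist : History P σ n) :
    idealStep s C smp (cfg, hist) = (step noOracle cfg).map fun cfg' => (cfg', hist) := by
  rcases cfg with ⟨_ | ⟨c, K⟩, M⟩
  · simp [idealStep]
  · cases c
    case call a q => exact absurd rfl (h a q K)
    all_goals simp [idealStep]

theorem idealSteps_add_one (s : Fin n → P.Gen) (C : Finset (Fin n)) (smp : Sampler P n) (t : ℕ)
    (st : Config × History P σ n) :
    idealSteps s C smp (t + 1) st = (idealStep s C smp st).bind (idealSteps s C smp t) := rfl

theorem mean_idealSteps_silent {cfg : Config} (h : cfg.Silent) (s : Fin n → P.Gen)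
    (C : Finset (Fin n)) (smp : Sampler P n) (t : ℕ) (hist : History P σ n)
    (f : Config × History P σ n → ℝ≥0∞) :
    mean (idealSteps s C smp (t + 1) (cfg, hist)) f =
      mean (step noOracle cfg) fun cfg' => mean (idealSteps s C smp t (cfg', hist)) f := by
  rw [idealSteps_add_one, mean_bind, h.idealStep_eq, mean_map]

theorem mean_idealSteps_call (s : Fin n → P.Gen)
    (C : Finset (Fin n)) (smp : Sampler P n) (t : ℕ) (a : ℕ) (q : List Expr) (K : List Cmd)
    (M : Memory) (hist : History P σ n) (f : Config × History P σ n → ℝ≥0∞) :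
    mean (idealSteps s C smp (t + 1) (⟨.call a q :: K, M⟩, hist)) f =
      mean (idealOracle s C smp hist (q.map (Expr.eval M))) fun r =>
        mean (idealSteps s C smp t
          (⟨K, Function.update M a fun i => r.1.getD i 0⟩, r.2 :: hist)) f := by
  rw [idealSteps_add_one, mean_bind]
  simp only [idealStep, mean_map]

/-! ### Comparison with the real experiment -/

/-- The function that agrees with the hash table of all values used and with `H` elsewhere. -/
def complete (s : Fin n → P.Gen) (hist : History P σ n) (H : Key P → Fin (2 ^ σ)) :
    Key P → Fin (2 ^ σ) :=
  fun a => (used s hist a).getD (H a)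

/-- The setup with the given secrets and hash functions. -/
def Setup.ofHash (g : Fin m → P.Gen) (r : Fin n → P.Gen) (H : Key P → Fin (2 ^ σ)) :
    Setup P σ n m :=
  ⟨g, r, fun z => H (0, z), fun z => H (1, z), fun z => H (2, z)⟩

/-- The secret generators of the nodes. -/
def secrets (γ : Membership n m) (g : Fin m → P.Gen) (r : Fin n → P.Gen) (k : Fin n) : P.Gen :=
  match γ k with
  | some j => g j
  | none => r k

theorem Setup.secret_ofHash (γ : Membership n m) (g : Fin m → P.Gen) (r : Fin n → P.Gen)
    (H : Key P → Fin (2 ^ σ)) (k : Fin n) :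
    (Setup.ofHash g r H).secret γ k = (secrets γ g r k).1 := by
  unfold Setup.secret secrets Setup.ofHash
  cases γ k <;> rfl

theorem used_cons (s : Fin n → P.Gen) (e : Event P σ n) (hist : History P σ n) (a : Key P) :
    used s (e :: hist) a = (e.used s a).or (used s hist a) := by
  unfold used
  rw [List.findSome?_cons]
  cases Event.used s a e <;> rfl

theorem asked_cons (e : Event P σ n) (hist : History P σ n) (a : Key P) :
    asked (e :: hist) a = (e.asked a).or (asked hist a) := by
  unfold asked
  rw [List.findSome?_cons]
  cases Event.asked a e <;> rfl

theorem used_eq_none {s : Fin n → P.Gen} {hist : History P σ n} {a : Key P}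
    (h : ∀ e ∈ hist, a ∉ e.keys s) : used s hist a = none := by
  refine List.findSome?_eq_none_iff.mpr fun e he => ?_
  have := h e he
  cases e with
  | other => rfl
  | query b w => simpa [Event.keys, Event.used] using this
  | run k l x y w₁ w₂ =>
    simp only [Event.keys, List.mem_cons, List.not_mem_nil, or_false, not_or] at this
    simp [Event.used, this]

theorem used_eq_asked {s : Fin n → P.Gen} {hist : History P σ n} {a : Key P}
    (h : ∀ e ∈ hist, a ∉ e.runKeys s) : used s hist a = asked hist a := by
  induction hist with
  | nil => rfl
  | cons e hist ih =>
    rw [used_cons, asked_cons, ih fun e' he' => h e' (List.mem_cons_of_mem _ he')]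
    have := h e List.mem_cons_self
    cases e with
    | other => rfl
    | query b w => rfl
    | run k l x y w₁ w₂ =>
      simp only [Event.runKeys, List.mem_cons, List.not_mem_nil, or_false, not_or] at this
      simp [Event.used, Event.asked, this]

theorem aliceKey_ne_bobKey (s : Fin n → P.Gen) (k l : Fin n) (x y : Fin P.q) :
    aliceKey s l x y ≠ bobKey s k x y := by
  simp [aliceKey, bobKey]

theorem Bad.cons {s : Fin n → P.Gen} {hist : History P σ n} (h : Bad s hist) (e : Event P σ n) :
    Bad s (e :: hist) := Or.inl h

/-- Histories only grow, and badness is inherited by longer histories. -/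
theorem mean_idealSteps_bad (s : Fin n → P.Gen) (C : Finset (Fin n)) (smp : Sampler P n)
    (f : Config × History P σ n → ℝ≥0∞) (hf : ∀ st, Bad s st.2 → f st = 0) (t : ℕ) :
    ∀ (cfg : Config) (hist : History P σ n), Bad s hist →
      mean (idealSteps s C smp t (cfg, hist)) f = 0 := by
  induction t with
  | zero => exact fun cfg hist h => by rw [idealSteps, mean_pure, hf _ h]
  | succ t ih =>
    intro cfg hist h
    rcases cfg.silent_or with hc | ⟨a, q, K, M, rfl⟩
    · rw [mean_idealSteps_silent hc]
      simp [ih _ _ h]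
    · rw [mean_idealSteps_call]
      simp [ih _ _ (h.cons _)]

-- If `a` is no hash argument of an earlier run, the tables `used` and `asked` agree at `a`: either
-- both contain the answer, or `H a` is still untouched and can be resampled. Otherwise every answer
-- makes the history bad and the left side vanishes.
open Classical in
theorem mean_idealHash_le (s : Fin n → P.Gen) (hist : History P σ n) (a : Key P)
    (Ψ : (Key P → Fin (2 ^ σ)) → List ℕ → ℝ≥0∞) :
    (mean (idealHash hist a) fun r => if Bad s (r.2 :: hist) then 0 else
      mean (PMF.uniformOfFintype (Key P → Fin (2 ^ σ))) fun H =>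
        Ψ (complete s (r.2 :: hist) H) r.1) ≤
    mean (PMF.uniformOfFintype (Key P → Fin (2 ^ σ))) fun H =>
      Ψ (complete s hist H) [(complete s hist H a : ℕ)] := by
  by_cases hb : ∀ e ∈ hist, a ∉ e.runKeys s
  · have hu := used_eq_asked hb
    unfold idealHash
    cases ha : asked hist a with
    | some w =>
      rw [ha] at hu
      have hc : ∀ H, complete s (.query a w :: hist) H = complete s hist H := by
        intro H
        funext b
        unfold complete
        rw [used_cons]
        by_cases hab : b = a
        · simp [hab, hu, Event.used]
        · simp [hab, Event.used]
      simp only [mean_pure, hc]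
      split_ifs
      · exact zero_le
      · refine mean_mono _ fun H => le_of_eq ?_
        simp [complete, hu]
    | none =>
      rw [ha] at hu
      simp only [mean_map]
      rw [mean_uniform_update a]
      refine mean_mono _ fun w => ?_
      have hc : ∀ H, complete s (.query a w :: hist) H =
          complete s hist (Function.update H a w) := by
        intro H
        funext b
        unfold complete
        rw [used_cons]
        by_cases hab : b = a
        · simp [hab, hu, Event.used]
        · simp [hab, Event.used]
      have hv : ∀ H, complete s hist (Function.update H a w) a = w := by
        intro H
        simp [complete, hu]
      simp only [hc, hv]
      split_ifs
      · exact zero_le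
      · exact le_rfl
  · push Not at hb
    obtain ⟨e, he, hae⟩ := hb
    have : ∀ w, Bad s (.query a w :: hist) := fun w =>
      Or.inr ⟨e, he, Or.inr ⟨a, by simp [Event.keys], hae⟩⟩
    have h0 : ∀ r ∈ (idealHash hist a).support, Bad s (r.2 :: hist) := by
      intro r hr
      unfold idealHash at hr
      cases ha : asked hist a with
      | some w =>
        simp only [ha, PMF.support_pure, Set.mem_singleton_iff] at hr
        subst hr
        exact this w
      | none =>
        simp only [ha, PMF.support_map] at hr
        obtain ⟨w, -, rfl⟩ := hr
        exact this w
    refine le_of_eq_of_le ?_ zero_le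
    unfold mean
    refine ENNReal.tsum_eq_zero.mpr fun r => ?_
    by_cases hr : r ∈ (idealHash hist a).support
    · simp [h0 r hr]
    · simp [(PMF.apply_eq_zero_iff _ _).mpr hr]

-- If neither hash argument of the run has been used, the values of `H` at these two points are
-- free; resampling them gives the fresh values `w₁` and `w₂`. If one has been used, the run is bad
-- and contributes `0` on the left.
open Classical in
theorem mean_idealRun_le (γ : Membership n m) (g : Fin m → P.Gen) (r : Fin n → P.Gen)
    (hist : History P σ n) (k l : Fin n) (Ψ : (Key P → Fin (2 ^ σ)) → List ℕ → ℝ≥0∞) :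
    (mean (idealRun (secrets γ g r) (PMF.uniformOfFintype _) k l) fun z =>
      if Bad (secrets γ g r) (z.2 :: hist) then 0 else
        mean (PMF.uniformOfFintype (Key P → Fin (2 ^ σ))) fun H =>
          Ψ (complete (secrets γ g r) (z.2 :: hist) H) z.1) ≤
    mean (PMF.uniformOfFintype (Key P → Fin (2 ^ σ))) fun H =>
      mean (transcript (Setup.ofHash g r (complete (secrets γ g r) hist H)) γ k l)
        (Ψ (complete (secrets γ g r) hist H)) := by
  set s := secrets γ g r with hs
  simp only [idealRun, transcript, mean_bind, mean_map, mean_pure, Setup.secret_ofHash, ← hs,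
    mean_uniform_prod]
  conv_rhs => rw [mean_comm]
  refine mean_mono _ fun x => ?_
  conv_rhs => rw [mean_comm]
  refine mean_mono _ fun y => ?_
  by_cases hb : ∀ e ∈ hist, aliceKey s l x y ∉ e.keys s ∧ bobKey s k x y ∉ e.keys s
  · have h1 := used_eq_none fun e he => (hb e he).1
    have h2 := used_eq_none fun e he => (hb e he).2
    rw [mean_uniform_update (bobKey s k x y), mean_comm]
    refine mean_mono _ fun w₂ => ?_
    rw [mean_uniform_update (aliceKey s l x y)]
    refine mean_mono _ fun w₁ => ?_
    -- The two arguments never coincide, even if the group elements do, since they belong to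
    -- different hash functions.
    have hne := aliceKey_ne_bobKey s k l x y
    have hc : ∀ H, complete s (.run k l x y w₁ w₂ :: hist) H = complete s hist
        (Function.update (Function.update H (aliceKey s l x y) w₁) (bobKey s k x y) w₂) := by
      intro H
      funext b
      unfold complete
      rw [used_cons]
      by_cases hab : b = aliceKey s l x y
      · simp [hab, h1, Event.used, hne]
      · by_cases hab' : b = bobKey s k x y
        · simp [hab', h2, Event.used, hne.symm]
        · simp [hab, hab', Event.used]
    have hv1 : ∀ H, (Setup.ofHash g r (complete s hist (Function.update
        (Function.update H (aliceKey s l x y) w₁) (bobKey s k x y) w₂))).h4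
        (((s l).1 ^ (y : ℕ)) ^ (x : ℕ) : (ZMod P.p)ˣ) = w₁ := by
      intro H
      change complete s hist _ (aliceKey s l x y) = w₁
      simp [complete, h1, hne]
    have hv2 : ∀ H, (Setup.ofHash g r (complete s hist (Function.update
        (Function.update H (aliceKey s l x y) w₁) (bobKey s k x y) w₂))).h5
        (((s k).1 ^ (x : ℕ)) ^ (y : ℕ) : (ZMod P.p)ˣ) = w₂ := by
      intro H
      change complete s hist _ (bobKey s k x y) = w₂
      simp [complete, h2]
    simp only [hc, hv1, hv2]
    split_ifs
    · exact zero_le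
    · exact le_rfl
  · have hbad : ∀ w₁ w₂, Bad s (.run k l x y w₁ w₂ :: hist) := by
      intro w₁ w₂
      by_contra hn
      refine hb fun e he => ⟨fun h => hn ?_, fun h => hn ?_⟩
      · exact Or.inr ⟨e, he, Or.inl ⟨_, by simp [Event.runKeys], h⟩⟩
      · exact Or.inr ⟨e, he, Or.inl ⟨_, by simp [Event.runKeys], h⟩⟩
    simp [hbad]

open Classical in
theorem mean_idealOracle_le (γ : Membership n m) (g : Fin m → P.Gen) (r : Fin n → P.Gen)
    (C : Finset (Fin n)) (hist : History P σ n) (q : List ℕ)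
    (Ψ : (Key P → Fin (2 ^ σ)) → List ℕ → ℝ≥0∞) :
    (mean (idealOracle (secrets γ g r) C (uniformSampler P n) hist q) fun z =>
      if Bad (secrets γ g r) (z.2 :: hist) then 0 else
        mean (PMF.uniformOfFintype (Key P → Fin (2 ^ σ))) fun H =>
          Ψ (complete (secrets γ g r) (z.2 :: hist) H) z.1) ≤
    mean (PMF.uniformOfFintype (Key P → Fin (2 ^ σ))) fun H =>
      mean (eavesdropping (Setup.ofHash g r (complete (secrets γ g r) hist H)) γ C q)
        (Ψ (complete (secrets γ g r) hist H)) := by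
  have hother : (mean (PMF.pure (([], .other) : List ℕ × Event P σ n)) fun z =>
      if Bad (secrets γ g r) (z.2 :: hist) then 0 else
        mean (PMF.uniformOfFintype (Key P → Fin (2 ^ σ))) fun H =>
          Ψ (complete (secrets γ g r) (z.2 :: hist) H) z.1) ≤
      mean (PMF.uniformOfFintype (Key P → Fin (2 ^ σ))) fun H =>
        mean (PMF.pure []) (Ψ (complete (secrets γ g r) hist H)) := by
    simp only [mean_pure]
    split_ifs
    · exact zero_le
    · refine mean_mono _ fun H => le_of_eq ?_
      have : complete (secrets γ g r) (.other :: hist) H = complete (secrets γ g r) hist H := by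
        funext a
        simp [complete, used_cons, Event.used]
      rw [this]
  unfold idealOracle
  split
  · next k l =>
    split_ifs with h
    · obtain ⟨hk, hl, hC⟩ := h
      simpa only [eavesdropping, hk, hl, hC, dif_pos, if_pos, uniformSampler, not_false_eq_true,
        and_self] using mean_idealRun_le γ g r hist ⟨k, hk⟩ ⟨l, hl⟩ Ψ
    · have : ∀ S : Setup P σ n m, eavesdropping S γ C [0, k, l] = PMF.pure [] := by
        intro S
        simp only [eavesdropping]
        split_ifs with hk hl hC
        · exact absurd ⟨hk, hl, hC⟩ h
        all_goals rfl
      simpa only [this] using hother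
  · simpa only [eavesdropping, mean_pure, Setup.ofHash] using mean_idealHash_le _ hist (0, _) Ψ
  · simpa only [eavesdropping, mean_pure, Setup.ofHash] using mean_idealHash_le _ hist (1, _) Ψ
  · simpa only [eavesdropping, mean_pure, Setup.ofHash] using mean_idealHash_le _ hist (2, _) Ψ
  · next h0 h3 h4 h5 =>
    have : ∀ S : Setup P σ n m, eavesdropping S γ C q = PMF.pure [] := by
      intro S
      unfold eavesdropping
      split
      · exact absurd rfl (h0 _ _)
      · exact absurd rfl (h3 _)
      · exact absurd rfl (h4 _)
      · exact absurd rfl (h5 _)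
      · rfl
    simpa only [this] using hother

open Classical in
/-- Unless a bad event happens, the ideal experiment is the real one. -/
theorem mean_idealSteps_le (γ : Membership n m) (g : Fin m → P.Gen) (r : Fin n → P.Gen)
    (C : Finset (Fin n)) (f : Config → ℝ≥0∞) (t : ℕ) :
    ∀ (cfg : Config) (hist : History P σ n), ¬ Bad (secrets γ g r) hist →
      (mean (idealSteps (secrets γ g r) C (uniformSampler P n) t (cfg, hist)) fun st =>
        if Bad (secrets γ g r) st.2 then 0 else f st.1) ≤
      mean (PMF.uniformOfFintype (Key P → Fin (2 ^ σ))) fun H =>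
        mean (steps (eavesdropping (Setup.ofHash g r (complete (secrets γ g r) hist H)) γ C) t cfg)
          f := by
  induction t with
  | zero =>
    intro cfg hist h
    simp [idealSteps, steps, h]
  | succ t ih =>
    intro cfg hist h
    rcases cfg.silent_or with hc | ⟨a, q, K, M, rfl⟩
    · simp only [mean_idealSteps_silent hc, steps_add_one, mean_bind, hc.step_eq (eavesdropping _ _ _)]
      rw [mean_comm]
      exact mean_mono _ fun cfg' => ih cfg' hist h
    · rw [mean_idealSteps_call]
      simp only [steps_add_one, mean_bind, step, mean_pure]
      -- `Ψ` is the value of the remaining real execution, as a function of the completed hash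
      -- functions and of the answer to this call.
      refine le_trans (mean_mono _ fun z => ?_) (mean_idealOracle_le γ g r C hist _
        fun H ans => mean (steps (eavesdropping (Setup.ofHash g r H) γ C) t
          ⟨K, Function.update M a fun i => ans.getD i 0⟩) f)
      split_ifs with hb
      · refine le_of_eq (mean_idealSteps_bad _ _ _ _ ?_ t _ _ hb)
        intro st hst
        simp [hst]
      · exact ih _ _ hb

/-! ### The ideal experiment does not depend on the secrets -/

theorem card_filter_pow_eq_one (P : Params) :
    (Finset.univ.filter fun z : (ZMod P.p)ˣ => z ^ P.q = 1).card ≤ P.q :=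
  IsCyclic.card_pow_eq_one_le P.q_pos

theorem Params.Gen.pow_injective (s : P.Gen) :
    Function.Injective fun x : Fin P.q => s.1 ^ (x : ℕ) := by
  intro x y h
  have hx : (x : ℕ) < orderOf s.1 := x.2.trans_eq s.2.symm
  have hy : (y : ℕ) < orderOf s.1 := y.2.trans_eq s.2.symm
  exact Fin.ext (pow_injOn_Iio_orderOf hx hy h)

theorem Params.Gen.pow_pow_eq_one (s : P.Gen) (x : ℕ) : (s.1 ^ x) ^ P.q = 1 := by
  rw [← pow_mul, mul_comm, pow_mul, orderOf_dvd_iff_pow_eq_one.mp (dvd_of_eq s.2), one_pow]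

/-- By counting: the powers of `s` are `q` distinct solutions of `z ^ q = 1`, and a cyclic group has
at most `q` solutions. -/
theorem Params.Gen.exists_pow_eq (s : P.Gen) {z : (ZMod P.p)ˣ} (hz : z ^ P.q = 1) :
    ∃ x : Fin P.q, s.1 ^ (x : ℕ) = z := by
  classical
  have hsub : (Finset.univ.image fun x : Fin P.q => s.1 ^ (x : ℕ)) ⊆
      Finset.univ.filter fun z : (ZMod P.p)ˣ => z ^ P.q = 1 := by
    intro w hw
    obtain ⟨x, -, rfl⟩ := Finset.mem_image.mp hw
    simp only [Finset.mem_filter, Finset.mem_univ, true_and]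
    exact s.pow_pow_eq_one x
  have heq := Finset.eq_of_subset_of_card_le hsub (by
    rw [Finset.card_image_of_injective _ s.pow_injective, Finset.card_univ, Fintype.card_fin]
    exact card_filter_pow_eq_one P)
  have : z ∈ Finset.univ.image fun x : Fin P.q => s.1 ^ (x : ℕ) := by
    rw [heq]
    simpa using hz
  obtain ⟨x, -, hx⟩ := Finset.mem_image.mp this
  exact ⟨x, hx⟩

theorem Params.Gen.exists_perm (s g : P.Gen) :
    ∃ e : Equiv.Perm (Fin P.q), ∀ x : Fin P.q, s.1 ^ (e x : ℕ) = g.1 ^ (x : ℕ) := by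
  choose e he using fun x : Fin P.q => s.exists_pow_eq (g.pow_pow_eq_one x)
  have hinj : Function.Injective e := by
    intro x y h
    exact g.pow_injective (by
      change g.1 ^ (x : ℕ) = g.1 ^ (y : ℕ)
      rw [← he x, ← he y, h])
  exact ⟨Equiv.ofBijective e (Finite.injective_iff_bijective.mp hinj), he⟩

/-- Exponents to the basis `s` in terms of exponents to the basis `g`. -/
noncomputable def Params.Gen.rebase (s g : P.Gen) : Equiv.Perm (Fin P.q) :=
  (s.exists_perm g).choose

theorem Params.Gen.pow_rebase (s g : P.Gen) (x : Fin P.q) :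
    s.1 ^ (s.rebase g x : ℕ) = g.1 ^ (x : ℕ) :=
  (s.exists_perm g).choose_spec x

/-- This is what hides the secrets: passing from one generator to another permutes the exponents, so
uniform exponents stay uniform. -/
theorem mean_uniform_rebase (s g s' g' : P.Gen) (F : Fin P.q × Fin P.q → ℝ≥0∞) :
    mean (PMF.uniformOfFintype (Fin P.q × Fin P.q)) F =
      mean (PMF.uniformOfFintype (Fin P.q × Fin P.q)) fun z =>
        F (s.rebase g z.1, s'.rebase g' z.2) :=
  (mean_uniform_equiv ((s.rebase g).prodCongr (s'.rebase g')) F).symm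

theorem asked_cons_congr {hist hist' : History P σ n}
    (h : ∀ a, asked hist a = asked hist' a) {e e' : Event P σ n}
    (he : ∀ a, e.asked a = e'.asked a) (a : Key P) :
    asked (e :: hist) a = asked (e' :: hist') a := by
  rw [asked_cons, asked_cons, h, he]

/-- After rebasing, both experiments send the same group elements and differ only in the exponents
recorded in the history. The oracle with uniform exponents uses the history only through `asked`,
which does not see these exponents. -/
theorem mean_idealOracle_congr (s s' : Fin n → P.Gen) (C : Finset (Fin n))
    {hist hist' : History P σ n} (h : ∀ a, asked hist a = asked hist' a) (q : List ℕ)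
    (F F' : List ℕ → History P σ n → ℝ≥0∞)
    (hF : ∀ ans h h', (∀ a, asked h a = asked h' a) → F ans h = F' ans h') :
    (mean (idealOracle s C (uniformSampler P n) hist q) fun z => F z.1 (z.2 :: hist)) =
      mean (idealOracle s' C (uniformSampler P n) hist' q) fun z => F' z.1 (z.2 :: hist') := by
  have hother : ∀ ans, F ans (.other :: hist) = F' ans (.other :: hist') := fun ans =>
    hF _ _ _ (asked_cons_congr h fun _ => rfl)
  have hhash : ∀ a, (mean (idealHash hist a) fun z => F z.1 (z.2 :: hist)) =
      mean (idealHash hist' a) fun z => F' z.1 (z.2 :: hist') := by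
    intro a
    have hq : ∀ ans w, F ans (.query a w :: hist) = F' ans (.query a w :: hist') := fun ans w =>
      hF _ _ _ (asked_cons_congr h fun _ => rfl)
    unfold idealHash
    rw [← h]
    cases asked hist a <;> simp [hq]
  unfold idealOracle
  split
  · next k l =>
    split_ifs with hkl
    · obtain ⟨hk, hl, hC⟩ := hkl
      simp only [idealRun, uniformSampler, mean_bind, mean_map]
      rw [mean_uniform_rebase (s ⟨k, hk⟩) (s' ⟨k, hk⟩) (s ⟨l, hl⟩) (s' ⟨l, hl⟩)]
      congr 1
      funext z
      congr 1
      funext w₁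
      congr 1
      funext w₂
      simp only [Params.Gen.pow_rebase]
      exact hF _ _ _ (asked_cons_congr h fun _ => rfl)
    · simp [hother]
  · exact hhash _
  · exact hhash _
  · exact hhash _
  · simp [hother]

theorem mean_idealSteps_congr (s s' : Fin n → P.Gen) (C : Finset (Fin n)) (f : Config → ℝ≥0∞)
    (t : ℕ) : ∀ (cfg : Config) (hist hist' : History P σ n),
      (∀ a, asked hist a = asked hist' a) →
      (mean (idealSteps s C (uniformSampler P n) t (cfg, hist)) fun st => f st.1) =
        mean (idealSteps s' C (uniformSampler P n) t (cfg, hist')) fun st => f st.1 := by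
  induction t with
  | zero => intro cfg hist hist' _; simp [idealSteps]
  | succ t ih =>
    intro cfg hist hist' h
    rcases cfg.silent_or with hc | ⟨a, q, K, M, rfl⟩
    · rw [mean_idealSteps_silent hc, mean_idealSteps_silent hc]
      congr 1
      funext cfg'
      exact ih _ _ _ h
    · rw [mean_idealSteps_call, mean_idealSteps_call]
      exact mean_idealOracle_congr s s' C h _
        (fun ans hi => mean (idealSteps s C (uniformSampler P n) t
          (⟨K, Function.update M a fun i => ans.getD i 0⟩, hi)) fun st => f st.1)
        (fun ans hi => mean (idealSteps s' C (uniformSampler P n) t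
          (⟨K, Function.update M a fun i => ans.getD i 0⟩, hi)) fun st => f st.1)
        fun ans h₁ h₂ h₁₂ => ih _ _ _ h₁₂

/-! ### Choosing the exponents of one run in advance -/

/-- The sampler that uses the exponents `z` to the basis `g` in the call with number `i`. -/
noncomputable def plantedSampler (s : Fin n → P.Gen) (g : P.Gen) (i : ℕ)
    (z : Fin P.q × Fin P.q) : Sampler P n :=
  fun j k l => if j = i then PMF.pure ((s k).rebase g z.1, (s l).rebase g z.2)
    else PMF.uniformOfFintype (Fin P.q × Fin P.q)

theorem idealOracle_congr_sampler (s : Fin n → P.Gen) (C : Finset (Fin n)) {smp smp' : Sampler P n}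
    {hist : History P σ n} (h : smp hist.length = smp' hist.length) (q : List ℕ) :
    idealOracle s C smp hist q = idealOracle s C smp' hist q := by
  unfold idealOracle
  rw [h]

theorem mean_idealOracle_planted (s : Fin n → P.Gen) (g : P.Gen) (C : Finset (Fin n)) (i : ℕ)
    {hist : History P σ n} (h : hist.length = i) (q : List ℕ)
    (F : List ℕ × Event P σ n → ℝ≥0∞) :
    mean (idealOracle s C (uniformSampler P n) hist q) F =
      mean (PMF.uniformOfFintype (Fin P.q × Fin P.q)) fun z =>
        mean (idealOracle s C (plantedSampler s g i z) hist q) F := by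
  unfold idealOracle
  split
  · next k l =>
    split_ifs with hkl
    · obtain ⟨hk, hl, hC⟩ := hkl
      simp only [idealRun, uniformSampler, plantedSampler, h, if_true, mean_bind, mean_pure]
      rw [mean_uniform_rebase (s ⟨k, hk⟩) g (s ⟨l, hl⟩) g]
    · simp
  all_goals simp

theorem mean_idealSteps_planted_of_lt (s : Fin n → P.Gen) (g : P.Gen) (C : Finset (Fin n)) (i : ℕ)
    (z : Fin P.q × Fin P.q) (f : Config × History P σ n → ℝ≥0∞) (t : ℕ) :
    ∀ (cfg : Config) (hist : History P σ n), i < hist.length →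
      mean (idealSteps s C (uniformSampler P n) t (cfg, hist)) f =
        mean (idealSteps s C (plantedSampler s g i z) t (cfg, hist)) f := by
  induction t with
  | zero => intro cfg hist _; rfl
  | succ t ih =>
    intro cfg hist h
    rcases cfg.silent_or with hc | ⟨a, q, K, M, rfl⟩
    · simp only [mean_idealSteps_silent hc, ih _ _ h]
    · rw [mean_idealSteps_call, mean_idealSteps_call, idealOracle_congr_sampler s C
        (smp := plantedSampler s g i z) (smp' := uniformSampler P n)]
      · congr 1
        funext r
        exact ih _ _ (by simp only [List.length_cons]; omega)
      · funext k l
        simp [plantedSampler, uniformSampler, h.ne']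

/-- Nothing before call `i` depends on its exponents, so they can be drawn at the start, and as
exponents to the basis `g` instead of the nodes' secrets. In this form they can be supplied by a
Diffie-Hellman challenge. -/
theorem mean_idealSteps_planted (s : Fin n → P.Gen) (g : P.Gen) (C : Finset (Fin n)) (i : ℕ)
    (f : Config × History P σ n → ℝ≥0∞) (t : ℕ) :
    ∀ (cfg : Config) (hist : History P σ n), hist.length ≤ i →
      mean (idealSteps s C (uniformSampler P n) t (cfg, hist)) f =
        mean (PMF.uniformOfFintype (Fin P.q × Fin P.q)) fun z =>
          mean (idealSteps s C (plantedSampler s g i z) t (cfg, hist)) f := by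
  induction t with
  | zero => intro cfg hist _; simp [idealSteps]
  | succ t ih =>
    intro cfg hist h
    rcases cfg.silent_or with hc | ⟨a, q, K, M, rfl⟩
    · simp only [mean_idealSteps_silent hc]
      rw [mean_comm]
      congr 1
      funext cfg'
      exact ih _ _ h
    · simp only [mean_idealSteps_call]
      rcases h.lt_or_eq with h | h
      · have : ∀ z, idealOracle s C (plantedSampler s g i z) hist =
            idealOracle s C (uniformSampler P n) hist := by
          intro z
          funext q
          refine idealOracle_congr_sampler s C ?_ q
          funext k l
          simp [plantedSampler, uniformSampler, h.ne]
        simp only [this]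
        rw [mean_comm]
        congr 1
        funext r
        exact ih _ _ (by simpa using h)
      · rw [mean_idealOracle_planted s g C i h]
        congr 1
        funext z
        congr 1
        funext r
        exact mean_idealSteps_planted_of_lt s g C i z f t _ _ (by simp [h])

/-! ### Bad events as collisions between two given calls -/

/-- The event of the call with number `i`. -/
def eventAt : History P σ n → ℕ → Option (Event P σ n)
  | [], _ => none
  -- The number of a call is the number of calls before it, hence it does not change when the
  -- history grows.
  | e :: hist, i => if i = hist.length then some e else eventAt hist i

theorem eventAt_cons_of_ne {e : Event P σ n} {hist : History P σ n} {i : ℕ}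
    (h : i ≠ hist.length) : eventAt (e :: hist) i = eventAt hist i := if_neg h

theorem eventAt_cons_length (e : Event P σ n) (hist : History P σ n) :
    eventAt (e :: hist) hist.length = some e := if_pos rfl

theorem lt_length_of_eventAt {hist : History P σ n} {i : ℕ} {e : Event P σ n}
    (h : eventAt hist i = some e) : i < hist.length := by
  induction hist with
  | nil => cases h
  | cons e' hist ih =>
    rw [List.length_cons]
    by_cases hi : i = hist.length
    · omega
    · rw [eventAt_cons_of_ne hi] at h
      exact (ih h).trans (Nat.lt_succ_self _)

theorem exists_eventAt_of_mem {hist : History P σ n} {e : Event P σ n} (h : e ∈ hist) :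
    ∃ i, eventAt hist i = some e := by
  induction hist with
  | nil => cases h
  | cons e' hist ih =>
    rcases List.mem_cons.mp h with rfl | h
    · exact ⟨_, eventAt_cons_length _ _⟩
    · obtain ⟨i, hi⟩ := ih h
      exact ⟨i, by rw [eventAt_cons_of_ne (lt_length_of_eventAt hi).ne, hi]⟩

/-- The argument of the hash function `h` in the `i`-th call, a run, occurs in the `j`-th call, too;
`k₀` is the node that sends the value of this hash function. -/
def Collision (s : Fin n → P.Gen) (hist : History P σ n) (i j : ℕ) (h : Fin 3) (k₀ : Fin n) : Prop :=
  i ≠ j ∧ ∃ k l x y w₁ w₂ e, eventAt hist i = some (.run k l x y w₁ w₂) ∧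
    eventAt hist j = some e ∧
    -- The node `k₀` is recorded because the hash argument must be raised to the logarithm of its
    -- secret.
    (h = 1 ∧ k₀ = k ∧ aliceKey s l x y ∈ e.keys s ∨ h = 2 ∧ k₀ = l ∧ bobKey s k x y ∈ e.keys s)

theorem Collision.cons {s : Fin n → P.Gen} {hist : History P σ n} {i j : ℕ} {h : Fin 3}
    {k₀ : Fin n} (hc : Collision s hist i j h k₀) (e : Event P σ n) :
    Collision s (e :: hist) i j h k₀ := by
  obtain ⟨hij, k, l, x, y, w₁, w₂, e', hi, hj, H⟩ := hc
  refine ⟨hij, k, l, x, y, w₁, w₂, e', ?_, ?_, H⟩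
  · rw [eventAt_cons_of_ne (lt_length_of_eventAt hi).ne, hi]
  · rw [eventAt_cons_of_ne (lt_length_of_eventAt hj).ne, hj]

theorem exists_collision_of_mem_runKeys {s : Fin n → P.Gen} {hist : History P σ n} {i j : ℕ}
    {e e' : Event P σ n} (hij : i ≠ j) (hi : eventAt hist i = some e)
    (hj : eventAt hist j = some e') {a : Key P} (ha : a ∈ e.runKeys s) (ha' : a ∈ e'.keys s) :
    ∃ h k₀, Collision s hist i j h k₀ := by
  cases e with
  | other => cases ha
  | query b w => cases ha
  | run k l x y w₁ w₂ =>
    simp only [Event.runKeys, List.mem_cons, List.not_mem_nil, or_false] at ha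
    rcases ha with rfl | rfl
    · exact ⟨1, k, hij, k, l, x, y, w₁, w₂, e', hi, hj, Or.inl ⟨rfl, rfl, ha'⟩⟩
    · exact ⟨2, l, hij, k, l, x, y, w₁, w₂, e', hi, hj, Or.inr ⟨rfl, rfl, ha'⟩⟩

theorem Bad.exists_collision {s : Fin n → P.Gen} {hist : History P σ n} (hb : Bad s hist) :
    ∃ i j h k₀, Collision s hist i j h k₀ := by
  induction hist with
  | nil => exact hb.elim
  | cons e hist ih =>
    rcases hb with hb | ⟨e', he', H⟩
    · obtain ⟨i, j, h, k₀, hc⟩ := ih hb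
      exact ⟨i, j, h, k₀, hc.cons e⟩
    · obtain ⟨i, hi⟩ := exists_eventAt_of_mem he'
      have hlt := lt_length_of_eventAt hi
      have hi' : eventAt (e :: hist) i = some e' := by rw [eventAt_cons_of_ne hlt.ne, hi]
      rcases H with ⟨a, ha, ha'⟩ | ⟨a, ha, ha'⟩
      · exact ⟨_, _, exists_collision_of_mem_runKeys hlt.ne' (eventAt_cons_length _ _) hi' ha ha'⟩
      · exact ⟨_, _, exists_collision_of_mem_runKeys hlt.ne hi' (eventAt_cons_length _ _) ha' ha⟩

/-- Every step adds at most one event, so only histories up to this length are reachable. This is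
needed to bound the numbers of the calls in a collision. -/
theorem mean_idealSteps_mono (s : Fin n → P.Gen) (C : Finset (Fin n)) (smp : Sampler P n)
    (f f' : Config × History P σ n → ℝ≥0∞) (t : ℕ) :
    ∀ (cfg : Config) (hist : History P σ n),
      (∀ st, st.2.length ≤ hist.length + t → f st ≤ f' st) →
      mean (idealSteps s C smp t (cfg, hist)) f ≤ mean (idealSteps s C smp t (cfg, hist)) f' := by
  induction t with
  | zero =>
    intro cfg hist h
    simpa [idealSteps] using h (cfg, hist) le_rfl
  | succ t ih =>
    intro cfg hist h
    rcases cfg.silent_or with hc | ⟨a, q, K, M, rfl⟩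
    · simp only [mean_idealSteps_silent hc]
      exact mean_mono _ fun cfg' => ih _ _ fun st hst => h st (by omega)
    · simp only [mean_idealSteps_call]
      exact mean_mono _ fun r => ih _ _ fun st hst => h st (by simp at hst; omega)

theorem le_sum_univ {ι : Type*} [Fintype ι] (F : ι → ℝ≥0∞) (i : ι) : F i ≤ ∑ j, F j :=
  Finset.single_le_sum (fun _ _ => zero_le) (Finset.mem_univ i)

-- Union bound over everything that the reduction has to guess.
open Classical in
theorem mean_bad_le_sum_collision (s : Fin n → P.Gen) (C : Finset (Fin n)) (smp : Sampler P n)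
    (cfg : Config) {t N : ℕ} (hN : t ≤ N) :
    (mean (idealSteps s C smp t (cfg, ([] : History P σ n))) fun st =>
      if Bad s st.2 then 1 else 0) ≤
    ∑ i : Fin N, ∑ j : Fin N, ∑ h : Fin 3, ∑ k₀ : Fin n,
      mean (idealSteps s C smp t (cfg, ([] : History P σ n))) fun st =>
        if Collision s st.2 i j h k₀ then 1 else 0 := by
  simp only [← mean_sum]
  refine mean_idealSteps_mono s C smp _ _ t cfg [] fun st hst => ?_
  split_ifs with hb
  · obtain ⟨i, j, h, k₀, hc⟩ := hb.exists_collision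
    have hi : i < N := by
      obtain ⟨-, k, l, x, y, w₁, w₂, e, hi, -⟩ := hc
      have := lt_length_of_eventAt hi
      simp only [List.length_nil, zero_add] at hst
      omega
    have hj : j < N := by
      obtain ⟨-, k, l, x, y, w₁, w₂, e, -, hj, -⟩ := hc
      have := lt_length_of_eventAt hj
      simp only [List.length_nil, zero_add] at hst
      omega
    refine le_trans ?_ (le_sum_univ _ (⟨i, hi⟩ : Fin N))
    refine le_trans ?_ (le_sum_univ _ (⟨j, hj⟩ : Fin N))
    refine le_trans ?_ (le_sum_univ _ h)
    refine le_trans ?_ (le_sum_univ _ k₀)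
    exact (if_pos hc).ge
  · exact zero_le

/-! ### The reduction

A program that simulates the ideal experiment without oracle.  Its memory:
* array `0`: the input `σ, p, q, g, v, u` of the Diffie-Hellman problem;
* array `1`: the output;
* array `2`: `2 ^ σ`, the numbers `i` and `j` of two calls, the number `h` of a hash function, an
  exponent;
* array `3`: the number of calls so far;
* arrays `4`, `5`, `6`: for every node, whether it is uncorrupted, the logarithm of its secret to
  the basis `g`, and its secret;
* array `7`: auxiliary variables;
* arrays `8`, `9`: random exponents of the groups and of the nodes;
* arrays `20`, `21`, `22`: the hash tables, values increased by one;
* from array `30` on: the memory of the simulated program. -/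

/-- The cell with a fixed index. -/
abbrev Expr.cell (a i : ℕ) : Expr := .load a (.const i)

/-- The same expression over the arrays from `30` on. -/
def Expr.lift : Expr → Expr
  | .const c => .const c
  | .load a i => .load (a + 30) i.lift
  | .bin o e f => .bin o e.lift f.lift
  | .mulMod e f r => .mulMod e.lift f.lift r.lift
  | .powMod e f r => .powMod e.lift f.lift r.lift

theorem Expr.eval_lift {M M' : Memory} (h : ∀ a i, M' (a + 30) i = M a i) (e : Expr) :
    e.lift.eval M' = e.eval M := by
  induction e <;> simp_all [Expr.lift, Expr.eval]

/-- The test whether the current call is the one whose hash argument is to be reported. -/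
def reportNow : Expr := .bin .eq (.cell 3 0) (.cell 2 2)

/-- Report the value of `e` as an argument of the hash function `h`. -/
def report (h : ℕ) (e : Expr) : Cmd :=
  .cond reportNow
    (.cond (.bin .eq (.cell 2 3) (.const h))
      -- The cell `4` of array `2` contains the logarithm of the secret of the guessed node.
      (.store 1 (.const 0) (.powMod e (.cell 2 4) (.cell 0 1))) .skip)
    .skip

/-- Count a call. -/
def count : Cmd := .store 3 (.const 0) (.bin .add (.cell 3 0) (.const 1))

/-- Answer a query to the hash function `h`. -/
def hashBlock (a h : ℕ) : Cmd :=
  .seq (.cond (.load (20 + h) (.cell 7 1)) .skip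
      (.seq (.rand 7 (.const 2) (.cell 2 0))
        (.store (20 + h) (.cell 7 1) (.bin .add (.cell 7 2) (.const 1)))))
    (.seq (.store a (.const 0) (.bin .sub (.load (20 + h) (.cell 7 1)) (.const 1)))
      (report h (.cell 7 1)))

/-- The first two messages of a run, for which the Diffie-Hellman problem is used in the
call number `i`. -/
def runBlock₁ : Cmd :=
  .cond (.bin .eq (.cell 3 0) (.cell 2 1))
    -- The exponents of the planted run are unknown, so nothing can be reported here; nothing has to
    -- be, as a collision involves two different calls.
    (.seq (.store 7 (.const 3) (.cell 0 4)) (.store 7 (.const 4) (.cell 0 5)))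
    (.seq (.rand 7 (.const 5) (.cell 0 2))
      (.seq (.rand 7 (.const 6) (.cell 0 2))
        (.seq (.store 7 (.const 3) (.powMod (.load 6 (.cell 7 1)) (.cell 7 5) (.cell 0 1)))
          (.seq (.store 7 (.const 4) (.powMod (.load 6 (.cell 7 2)) (.cell 7 6) (.cell 0 1)))
            (.seq (report 1 (.powMod (.cell 7 4) (.cell 7 5) (.cell 0 1)))
              (report 2 (.powMod (.cell 7 3) (.cell 7 6) (.cell 0 1))))))))

/-- The last two messages of a run, and the answer. -/
def runBlock₂ (a : ℕ) : Cmd :=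
  .seq (.rand 7 (.const 7) (.cell 2 0))
    (.seq (.rand 7 (.const 8) (.cell 2 0))
      (.seq (.store a (.const 0) (.cell 7 3))
        (.seq (.store a (.const 1) (.cell 7 4))
          (.seq (.store a (.const 2) (.cell 7 7)) (.store a (.const 3) (.cell 7 8))))))

/-- The simulation of a call. -/
def callBlock (a : ℕ) : List Expr → Cmd
  | [e, k, l] =>
      .seq (.store 7 (.const 0) e) (.seq (.store 7 (.const 1) k) (.seq (.store 7 (.const 2) l)
        -- Clearing the answer array makes the empty answer the default. The operands have been
        -- saved before, since they may read this array.
        (.seq (.call a []) (.seq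
          (.cond (.cell 7 0) .skip
            (.cond (.load 4 (.cell 7 1))
              (.cond (.load 4 (.cell 7 2)) (.seq runBlock₁ (runBlock₂ a)) .skip) .skip))
          count))))
  | [e, z] =>
      .seq (.store 7 (.const 0) e) (.seq (.store 7 (.const 1) (.bin .mod z (.cell 0 1)))
        (.seq (.call a []) (.seq
          (.cond (.bin .eq (.cell 7 0) (.const 3)) (hashBlock a 0)
            (.cond (.bin .eq (.cell 7 0) (.const 4)) (hashBlock a 1)
              (.cond (.bin .eq (.cell 7 0) (.const 5)) (hashBlock a 2) .skip)))
          count)))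
  | _ => .seq (.call a []) count

/-- The program that simulates `c`. -/
def Cmd.simulate : Cmd → Cmd
  | .skip => .skip
  | .store a i e => .store (a + 30) i.lift e.lift
  | .rand a i e => .rand (a + 30) i.lift e.lift
  | .call a q => callBlock (a + 30) (q.map Expr.lift)
  | .seq c d => .seq c.simulate d.simulate
  | .cond e c d => .cond e.lift c.simulate d.simulate
  | .loop e c => .loop e.lift c.simulate

theorem loopFree_callBlock (a : ℕ) (q : List Expr) : (callBlock a q).LoopFree := by
  unfold callBlock
  split <;> simp [Cmd.LoopFree, hashBlock, report, count, runBlock₁, runBlock₂]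

theorem time_callBlock_le (a : ℕ) (q : List Expr) : (callBlock a q).time ≤ 100 := by
  unfold callBlock
  split <;> simp [Cmd.time, hashBlock, report, count, runBlock₁, runBlock₂]

/-- Programs that do not change the parameters and, after the report, the output. -/
def Cmd.Safe : Cmd → Prop
  | .skip => True
  | .store a i e => a ≠ 1 ∧ a ≠ 2 ∧
      (a = 3 → i = .const 0 ∧ e = .bin .add (.cell 3 0) (.const 1))
  | .rand a _ _ => a ≠ 1 ∧ a ≠ 2 ∧ a ≠ 3
  | .call a _ => a ≠ 1 ∧ a ≠ 2 ∧ a ≠ 3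
  | .seq c d => c.Safe ∧ d.Safe
  -- The branch after `reportNow` may write the output: it is not entered once the counter has
  -- passed the number of the guessed call.
  | .cond e c d => (e = reportNow ∨ c.Safe) ∧ d.Safe
  | .loop _ c => c.Safe

theorem safe_callBlock {a : ℕ} (ha : 30 ≤ a) (q : List Expr) : (callBlock a q).Safe := by
  have h1 : a ≠ 1 := by omega
  have h2 : a ≠ 2 := by omega
  have h3 : a ≠ 3 := by omega
  unfold callBlock
  split <;> simp [Cmd.Safe, hashBlock, report, count, runBlock₁, runBlock₂, h1, h2, h3]

theorem Cmd.safe_simulate (c : Cmd) : c.simulate.Safe := by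
  induction c with
  | call a q => exact safe_callBlock (by omega) _
  | cond e c d hc hd => exact ⟨.inr hc, hd⟩
  | _ => simp_all [Cmd.simulate, Cmd.Safe]

/-- After the report the output does not change any more. -/
theorem mean_steps_of_reported (z : ℕ) (t : ℕ) : ∀ (K : List Cmd) (M : Memory),
    (∀ c ∈ K, c.Safe) → M 2 2 < M 3 0 → M 1 0 = z →
      (mean (steps noOracle t ⟨K, M⟩) fun s => if s.mem 1 0 = z then 1 else 0) = 1 := by
  induction t with
  | zero => intro K M _ _ h; simp [steps, h]
  | succ t ih =>
    intro K M hK hM hz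
    rw [steps_add_one, mean_bind]
    rcases K with _ | ⟨c, K⟩
    · simp [step, ih [] M (by simp) hM hz]
    · have hc : c.Safe := hK c List.mem_cons_self
      have hK' : ∀ c ∈ K, c.Safe := fun c hc => hK c (List.mem_cons_of_mem _ hc)
      cases c with
      | skip => simp [step, ih K M hK' hM hz]
      | store a i e =>
        obtain ⟨h1, h2, h3⟩ := hc
        simp only [step, mean_pure]
        refine ih K _ hK' ?_ ?_
        · by_cases ha : a = 3
          · obtain ⟨rfl, rfl⟩ := h3 ha
            subst ha
            simp [Expr.eval, BinOp.eval]
            omega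
          · simp [Ne.symm h2, Ne.symm ha, hM]
        · simp [Ne.symm h1, hz]
      | rand a i e =>
        obtain ⟨h1, h2, h3⟩ := hc
        simp only [step, mean_bind, mean_pure]
        refine (congrArg _ (funext fun v => ih K _ hK' ?_ ?_)).trans (mean_const _ 1)
        · simp [Ne.symm h2, Ne.symm h3, hM]
        · simp [Ne.symm h1, hz]
      | call a q =>
        obtain ⟨h1, h2, h3⟩ := hc
        simp only [step, mean_bind, mean_pure]
        refine (congrArg _ (funext fun v => ih K _ hK' ?_ ?_)).trans (mean_const _ 1)
        · simp [Function.update_of_ne (Ne.symm h2), Function.update_of_ne (Ne.symm h3), hM]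
        · simp [Function.update_of_ne (Ne.symm h1), hz]
      | seq c d =>
        simp only [step, mean_pure]
        refine ih _ M ?_ hM hz
        simpa [hc.1, hc.2] using hK'
      | cond e c d =>
        simp only [step, mean_pure]
        refine ih _ M ?_ hM hz
        split_ifs with h
        · simpa [hc.2] using hK'
        · rcases hc.1 with rfl | hc'
          · simp [reportNow, Expr.eval, BinOp.eval, hM.ne'] at h
          · simpa [hc'] using hK'
      | loop e c =>
        simp only [step, mean_pure]
        refine ih _ M ?_ hM hz
        split_ifs with h
        · exact hK'
        · have hc' : c.Safe := hc
          simpa [hc', Cmd.Safe] using hK'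

/-! ### The invariant of the simulation -/

theorem val_pow_mod (P : Params) (z : ZMod P.p) (x : ℕ) : z.val ^ x % P.p = (z ^ x).val := by
  rw [← ZMod.val_natCast, Nat.cast_pow, ZMod.natCast_zmod_val]

theorem code_pow_mod (P : Params) (z : (ZMod P.p)ˣ) (x : ℕ) :
    P.code z ^ x % P.p = P.code (z ^ x) := by
  unfold Params.code
  rw [val_pow_mod, Units.val_pow_eq_pow_val]

/-- The parameters of the reduction: secrets, basis, corrupted nodes, the two calls, the hash
function, the exponent for the report and the exponents of the Diffie-Hellman problem. -/
structure Plan (P : Params) (n : ℕ) where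
  s : Fin n → P.Gen
  g : P.Gen
  C : Finset (Fin n)
  i : ℕ
  j : ℕ
  h : Fin 3
  ρ : ℕ
  z : Fin P.q × Fin P.q

/-- The memory `M'` of the reduction represents the memory `M` and the history of the ideal
experiment. -/
structure Simulates (R : Plan P n) (M : Memory) (hist : History P σ n) (M' : Memory) : Prop where
  mem : ∀ a x, M' (a + 30) x = M a x
  p : M' 0 1 = P.p
  q : M' 0 2 = P.q
  v : M' 0 4 = P.code (R.g.1 ^ (R.z.1 : ℕ))
  u : M' 0 5 = P.code (R.g.1 ^ (R.z.2 : ℕ))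
  range : M' 2 0 = 2 ^ σ
  i : M' 2 1 = R.i
  j : M' 2 2 = R.j
  h : M' 2 3 = R.h
  ρ : M' 2 4 = R.ρ
  count : M' 3 0 = hist.length
  honest : ∀ k, M' 4 k ≠ 0 ↔ ∃ hk : k < n, (⟨k, hk⟩ : Fin n) ∉ R.C
  secret : ∀ k : Fin n, M' 6 k = P.code (R.s k).1
  table : ∀ a : Key P, M' (20 + a.1) a.2.val = (asked hist a).elim 0 fun w => (w : ℕ) + 1
  -- The hash function determines the reported argument, as the two arguments of a run belong to
  -- different hash functions. The planted call is exempt.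
  out : ∀ e, eventAt hist R.j = some e → R.i ≠ R.j → ∀ a ∈ e.keys R.s, a.1 = R.h →
    M' 1 0 = (a.2 ^ R.ρ).val
  planted : ∀ k l x y w₁ w₂, eventAt hist R.i = some (.run k l x y w₁ w₂) →
    (R.s k).1 ^ (x : ℕ) = R.g.1 ^ (R.z.1 : ℕ) ∧ (R.s l).1 ^ (y : ℕ) = R.g.1 ^ (R.z.2 : ℕ)

namespace Simulates

variable {R : Plan P n} {M : Memory} {hist : History P σ n} {M' : Memory}

/-- Writing an auxiliary variable. -/
theorem aux (H : Simulates R M hist M') (x v : ℕ) : Simulates R M hist (M'.write 7 x v) where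
  mem a y := by simpa using H.mem a y
  p := by simpa using H.p
  q := by simpa using H.q
  v := by simpa using H.v
  u := by simpa using H.u
  range := by simpa using H.range
  i := by simpa using H.i
  j := by simpa using H.j
  h := by simpa using H.h
  ρ := by simpa using H.ρ
  count := by simpa using H.count
  honest k := by simpa using H.honest k
  secret k := by simpa using H.secret k
  table a := by
    rw [Memory.write_apply, if_neg (by omega)]
    exact H.table a
  out e he hij a ha hah := by simpa using H.out e he hij a ha hah
  planted := H.planted

/-- Changes of the simulated memory. -/
theorem congr (H : Simulates R M hist M') {N N' : Memory} (hN : ∀ a x, N' (a + 30) x = N a x)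
    (hM : ∀ a x, a < 30 → N' a x = M' a x) : Simulates R N hist N' where
  mem := hN
  p := by simpa [hM] using H.p
  q := by simpa [hM] using H.q
  v := by simpa [hM] using H.v
  u := by simpa [hM] using H.u
  range := by simpa [hM] using H.range
  i := by simpa [hM] using H.i
  j := by simpa [hM] using H.j
  h := by simpa [hM] using H.h
  ρ := by simpa [hM] using H.ρ
  count := by simpa [hM] using H.count
  honest k := by simpa [hM] using H.honest k
  secret k := by simpa [hM] using H.secret k
  table a := by rw [hM _ _ (by omega)]; exact H.table a
  out e he hij a ha hah := by simpa [hM] using H.out e he hij a ha hah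
  planted := H.planted

theorem store (H : Simulates R M hist M') (a x v : ℕ) :
    Simulates R (M.write a x v) hist (M'.write (a + 30) x v) :=
  H.congr (fun b y => by simp [H.mem]) fun b y hb => by
    have : b ≠ a + 30 := by omega
    simp [this]

theorem clear (H : Simulates R M hist M') (a : ℕ) :
    Simulates R (Function.update M a fun _ => 0) hist
      (Function.update M' (a + 30) fun _ => 0) :=
  H.congr (fun b y => by
    by_cases hb : b = a
    · simp [hb]
    · simp [Function.update_of_ne hb, Function.update_of_ne (show b + 30 ≠ a + 30 by omega),
        H.mem]) fun b y hb => by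
    rw [Function.update_of_ne (show b ≠ a + 30 by omega)]

theorem eval_lift (H : Simulates R M hist M') (e : Expr) : e.lift.eval M' = e.eval M :=
  Expr.eval_lift H.mem e

/-- The next event. -/
theorem cons (H : Simulates R M hist M') {N N' : Memory} (e : Event P σ n)
    (hN : ∀ a x, N' (a + 30) x = N a x)
    (h0 : ∀ x, N' 0 x = M' 0 x) (h2 : ∀ x, N' 2 x = M' 2 x) (h3 : N' 3 0 = M' 3 0 + 1)
    (h4 : ∀ x, N' 4 x = M' 4 x) (h6 : ∀ x, N' 6 x = M' 6 x)
    (htable : ∀ a : Key P, N' (20 + a.1) a.2.val =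
      ((e.asked a).or (asked hist a)).elim 0 fun w => (w : ℕ) + 1)
    (hout : hist.length = R.j → R.i ≠ R.j → ∀ a ∈ e.keys R.s, a.1 = R.h →
      N' 1 0 = (a.2 ^ R.ρ).val)
    (hout' : hist.length ≠ R.j → N' 1 0 = M' 1 0)
    (hplanted : hist.length = R.i → ∀ k l x y w₁ w₂, e = .run k l x y w₁ w₂ →
      (R.s k).1 ^ (x : ℕ) = R.g.1 ^ (R.z.1 : ℕ) ∧ (R.s l).1 ^ (y : ℕ) = R.g.1 ^ (R.z.2 : ℕ)) :
    Simulates R N (e :: hist) N' where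
  mem := hN
  p := by rw [h0]; exact H.p
  q := by rw [h0]; exact H.q
  v := by rw [h0]; exact H.v
  u := by rw [h0]; exact H.u
  range := by rw [h2]; exact H.range
  i := by rw [h2]; exact H.i
  j := by rw [h2]; exact H.j
  h := by rw [h2]; exact H.h
  ρ := by rw [h2]; exact H.ρ
  count := by rw [h3, H.count]; rfl
  honest k := by rw [h4]; exact H.honest k
  secret k := by rw [h6]; exact H.secret k
  table a := by rw [asked_cons]; exact htable a
  out e' he' hij a ha hah := by
    by_cases hj : hist.length = R.j
    · rw [← hj, eventAt_cons_length] at he'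
      cases he'
      exact hout hj hij a ha hah
    · rw [eventAt_cons_of_ne (Ne.symm hj)] at he'
      rw [hout' hj]
      exact H.out e' he' hij a ha hah
  planted k l x y w₁ w₂ he' := by
    by_cases hi : hist.length = R.i
    · rw [← hi, eventAt_cons_length] at he'
      cases he'
      exact hplanted hi _ _ _ _ _ _ rfl
    · rw [eventAt_cons_of_ne (Ne.symm hi)] at he'
      exact H.planted _ _ _ _ _ _ he'

end Simulates

theorem Params.p_ne_zero (P : Params) : P.p ≠ 0 := P.prime.ne_zero

/-- The effect of a report. -/
theorem Simulates.exec_report {R : Plan P n} {M : Memory} {hist : History P σ n} {M' : Memory}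
    (H : Simulates R M hist M') {N : Memory} (h0 : ∀ x, N 0 x = M' 0 x) (h2 : ∀ x, N 2 x = M' 2 x)
    (h3 : N 3 0 = M' 3 0) (h : Fin 3) {e : Expr} {z : ZMod P.p} (he : e.eval N = z.val) :
    (report h e).exec N = PMF.pure (if hist.length = R.j ∧ R.h = h then
      N.write 1 0 (z ^ R.ρ).val else N) := by
  have e1 : N 3 0 = hist.length := h3.trans H.count
  have e2 : N 2 2 = R.j := (h2 _).trans H.j
  have e3 : N 2 3 = R.h := (h2 _).trans H.h
  have e4 : N 2 4 = R.ρ := (h2 _).trans H.ρ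
  have e5 : N 0 1 = P.p := (h0 _).trans H.p
  by_cases c1 : hist.length = R.j <;> by_cases c2 : R.h = h <;>
    simp only [report, reportNow, Cmd.exec, Expr.eval, BinOp.eval, e1, e2, e3, e4, e5, c1, c2, he,
      Fin.val_inj, P.p_ne_zero, val_pow_mod, if_true, if_false, one_ne_zero, and_self, and_true,
      and_false]

theorem exec_count (M : Memory) : count.exec M = PMF.pure (M.write 3 0 (M 3 0 + 1)) := by
  simp [count, Cmd.exec, Expr.eval, BinOp.eval]

theorem ite_write_apply (c : Prop) [Decidable c] (M : Memory) (a x v b y : ℕ) :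
    (if c then M.write a x v else M) b y = if c ∧ b = a ∧ y = x then v else M b y := by
  split_ifs <;> simp_all

/-- Like the following simulation lemmas this is in continuation form: `Φ` is what remains of the
ideal experiment, `F` what remains of the reduction, and the bound need only hold for memories that
represent the new history. A table cell that is `0` is sampled exactly when `idealHash` samples a
new value. -/
theorem mean_hashBlock {R : Plan P n} {M : Memory} {hist : History P σ n} {M' : Memory} {a : ℕ}
    (H : Simulates R (Function.update M a fun _ => 0) hist M') (t : Fin 3) (z : ZMod P.p)
    (hz : M' 7 1 = z.val) (Φ : List ℕ × Event P σ n → ℝ≥0∞) (F : Memory → ℝ≥0∞)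
    (hF : ∀ r N', Simulates R (Function.update M a fun x => r.1.getD x 0) (r.2 :: hist) N' →
      Φ r ≤ F N') :
    mean (idealHash hist (t, z)) Φ ≤
      mean ((hashBlock (a + 30) t).exec M') fun N' => mean (count.exec N') F := by
  have ht : (t : ℕ) < 3 := t.2
  have htab := H.table (t, z)
  -- The common end of both cases: once the table contains the answer, it remains to return it, to
  -- report and to count.
  have hfin : ∀ (w : Fin (2 ^ σ)) (N : Memory),
      (∀ b x, b ≠ 20 + (t : ℕ) ∨ x ≠ z.val → b ≠ 7 ∨ x ≠ 2 → N b x = M' b x) →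
      N (20 + t) z.val = w + 1 →
      Φ ([(w : ℕ)], .query (t, z) w) ≤ mean ((report t (.cell 7 1)).exec (N.write (a + 30) 0 w))
        fun N' => mean (count.exec N') F := by
    intro w N hN hNt
    have hlow : ∀ b x, b < 20 → b ≠ 7 ∨ x ≠ 2 → N b x = M' b x := fun b x hb h =>
      hN b x (by omega) h
    rw [H.exec_report (z := z) (fun x => by simp [hlow]) (fun x => by simp [hlow])
      (by simp [hlow]) t (by simp [Expr.eval, hlow, hz]), mean_pure, exec_count, mean_pure]
    refine hF _ _ (H.cons _ ?_ ?_ ?_ ?_ ?_ ?_ ?_ ?_ ?_ ?_)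
    · intro b x
      simp only [Memory.write_apply, ite_write_apply]
      rw [if_neg (by omega), if_neg (by omega), hN _ _ (by omega) (by omega), H.mem]
      by_cases hba : b = a
      · subst hba
        rcases x with _ | x <;> simp
      · simp [hba]
    · intro x
      simp [ite_write_apply, hlow]
    · intro x
      simp [ite_write_apply, hlow]
    · simp [ite_write_apply, hlow]
    · intro x
      simp [ite_write_apply, hlow]
    · intro x
      simp [ite_write_apply, hlow]
    · intro b
      have hb3 := b.1.2
      simp only [Memory.write_apply, ite_write_apply]
      rw [if_neg (by omega), if_neg (by omega), if_neg (by omega)]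
      by_cases hbt : b = (t, z)
      · subst hbt
        simp [Event.asked, hNt]
      · rw [hN _ _ ?_ (by omega), H.table b]
        · simp [Event.asked, hbt]
        · by_contra hcon
          push Not at hcon
          exact hbt (Prod.ext (Fin.ext (show (b.1 : ℕ) = t by omega)) (ZMod.val_injective _ hcon.2))
    · intro hj hij b hb hbh
      simp only [Event.keys, List.mem_singleton] at hb
      subst hb
      simp [hj, ← hbh]
    · intro hj
      simp [hj, hlow]
    · intro _ k l x y w₁ w₂ h
      cases h
  unfold idealHash
  cases hask : asked hist (t, z) with
  | some w =>
    rw [hask] at htab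
    simp only [Option.elim_some] at htab
    simp only [mean_pure, hashBlock, Cmd.exec, Expr.eval, hz, htab, mean_bind, BinOp.eval,
      Nat.add_eq_zero_iff, one_ne_zero, and_false, if_false, Nat.add_sub_cancel]
    exact hfin w M' (fun _ _ _ _ => rfl) htab
  | none =>
    rw [hask] at htab
    simp only [Option.elim_none] at htab
    simp only [mean_map, hashBlock, Cmd.exec, Expr.eval, hz, htab, mean_bind, BinOp.eval,
      if_true, H.range, mean_uniformBelow, mean_pure]
    refine mean_mono _ fun w => ?_
    set N := (M'.write 7 2 w).write (20 + t) z.val (w + 1) with hN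
    have h71 : (M'.write 7 2 w) 7 1 = z.val := by simp [hz]
    have h72 : (M'.write 7 2 w) 7 2 = w := by simp
    have h71' : N 7 1 = z.val := by
      rw [hN, Memory.write_apply, if_neg (by omega), h71]
    have hNt : N (20 + t) z.val = w + 1 := by simp [hN]
    rw [h71, h72, ← hN, h71', hNt, Nat.add_sub_cancel]
    refine hfin w N (fun b x h1 h2 => ?_) hNt
    rw [hN, Memory.write_apply, Memory.write_apply, if_neg (by omega), if_neg (by omega)]

theorem Simulates.mem_clear {R : Plan P n} {M : Memory} {hist : History P σ n} {M' : Memory}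
    {a : ℕ} (H : Simulates R (Function.update M a fun _ => 0) hist M') (b x : ℕ) :
    M' (b + 30) x = if b = a then 0 else M b x := by
  rw [H.mem]
  by_cases hb : b = a
  · simp [hb]
  · simp [hb]

/-- The memory after the second part of a run. -/
theorem Simulates.cons_run {R : Plan P n} {M : Memory} {hist : History P σ n} {M' : Memory} {a : ℕ}
    (H : Simulates R (Function.update M a fun _ => 0) hist M') (k l : Fin n) (x y : Fin P.q)
    (w₁ w₂ : Fin (2 ^ σ)) {N : Memory} (v u : ℕ)
    (hN : ∀ b x, b ≠ 7 → b ≠ 1 → N b x = M' b x)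
    (hout : hist.length = R.j → R.i ≠ R.j →
      (R.h = 1 → N 1 0 = ((aliceKey R.s l x y).2 ^ R.ρ).val) ∧
      (R.h = 2 → N 1 0 = ((bobKey R.s k x y).2 ^ R.ρ).val))
    (hout' : hist.length ≠ R.j → N 1 0 = M' 1 0)
    (hplanted : hist.length = R.i →
      (R.s k).1 ^ (x : ℕ) = R.g.1 ^ (R.z.1 : ℕ) ∧ (R.s l).1 ^ (y : ℕ) = R.g.1 ^ (R.z.2 : ℕ))
    (Φ : List ℕ × Event P σ n → ℝ≥0∞) (F : Memory → ℝ≥0∞)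
    (hF : ∀ r N', Simulates R (Function.update M a fun x => r.1.getD x 0) (r.2 :: hist) N' →
      Φ r ≤ F N') :
    Φ ([v, u, (w₁ : ℕ), (w₂ : ℕ)], .run k l x y w₁ w₂) ≤
      F (((((((N.write 7 7 w₁).write 7 8 w₂).write (a + 30) 0 v).write (a + 30) 1 u).write
        (a + 30) 2 w₁).write (a + 30) 3 w₂).write 3 0 (N 3 0 + 1)) := by
  refine hF _ _ (H.cons _ ?_ ?_ ?_ ?_ ?_ ?_ ?_ ?_ ?_ ?_)
  · intro b i
    have := H.mem_clear b i
    by_cases hba : b = a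
    · subst hba
      rcases i with _ | _ | _ | _ | i <;> simp [hN, this]
    · simp [hba, hN, this]
  · intro i
    simp [hN]
  · intro i
    simp [hN]
  · simp [hN]
  · intro i
    simp [hN]
  · intro i
    simp [hN]
  · intro b
    have hb3 := b.1.2
    simp only [Memory.write_apply]
    rw [if_neg (by omega), if_neg (by omega), if_neg (by omega), if_neg (by omega),
      if_neg (by omega), if_neg (by omega), if_neg (by omega), hN _ _ (by omega) (by omega),
      H.table b]
    rfl
  · intro hj hij b hb hbh
    simp only [Event.keys, List.mem_cons, List.not_mem_nil, or_false] at hb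
    simp only [Memory.write_apply]
    rw [if_neg (by omega), if_neg (by omega), if_neg (by omega), if_neg (by omega),
      if_neg (by omega), if_neg (by omega), if_neg (by omega)]
    rcases hb with rfl | rfl
    · exact (hout hj hij).1 hbh.symm
    · exact (hout hj hij).2 hbh.symm
  · intro hj
    simp [hout' hj]
  · intro hi k' l' x' y' w₁' w₂' h
    cases h
    exact hplanted hi

/-- In the planted call the challenge elements are the powers of the secrets with the rebased
exponents, so the messages have the right form although the reduction does not know these exponents.
In all other calls it draws the exponents itself and can compute both hash arguments. -/
theorem mean_runBlock {R : Plan P n} {M : Memory} {hist : History P σ n} {M' : Memory} {a : ℕ}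
    (H : Simulates R (Function.update M a fun _ => 0) hist M') (k l : Fin n)
    (hk : M' 7 1 = k) (hl : M' 7 2 = l) (Φ : List ℕ × Event P σ n → ℝ≥0∞) (F : Memory → ℝ≥0∞)
    (hF : ∀ r N', Simulates R (Function.update M a fun x => r.1.getD x 0) (r.2 :: hist) N' →
      Φ r ≤ F N') :
    mean (idealRun R.s (plantedSampler R.s R.g R.i R.z hist.length k l) k l) Φ ≤
      mean (runBlock₁.exec M') fun N =>
        mean ((runBlock₂ (a + 30)).exec N) fun N' => mean (count.exec N') F := by
  -- The second half of a run is the same in both cases: it needs the first two messages, but not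
  -- the exponents.
  have h2 : ∀ (x y : Fin P.q) (N : Memory),
      N 7 3 = P.code ((R.s k).1 ^ (x : ℕ)) → N 7 4 = P.code ((R.s l).1 ^ (y : ℕ)) →
      (∀ b x, b ≠ 7 → b ≠ 1 → N b x = M' b x) →
      (hist.length = R.j → R.i ≠ R.j →
        (R.h = 1 → N 1 0 = ((aliceKey R.s l x y).2 ^ R.ρ).val) ∧
        (R.h = 2 → N 1 0 = ((bobKey R.s k x y).2 ^ R.ρ).val)) →
      (hist.length ≠ R.j → N 1 0 = M' 1 0) →
      (hist.length = R.i →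
        (R.s k).1 ^ (x : ℕ) = R.g.1 ^ (R.z.1 : ℕ) ∧ (R.s l).1 ^ (y : ℕ) = R.g.1 ^ (R.z.2 : ℕ)) →
      mean (idealRun R.s (PMF.pure (x, y)) k l) Φ ≤
        mean ((runBlock₂ (a + 30)).exec N) fun N' => mean (count.exec N') F := by
    intro x y N hv hu hN hout hout' hpl
    have hr : N 2 0 = 2 ^ σ := by rw [hN _ _ (by omega) (by omega), H.range]
    simp only [idealRun, mean_bind, mean_pure, mean_map, runBlock₂, Cmd.exec, Expr.eval,
      exec_count]
    simp [hr, hv, hu, mean_uniformBelow]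
    refine mean_mono _ fun w₁ => mean_mono _ fun w₂ => ?_
    exact H.cons_run k l x y w₁ w₂ _ _ hN hout hout' hpl Φ F hF
  by_cases hi : hist.length = R.i
  · have : runBlock₁.exec M' = PMF.pure ((M'.write 7 3 (P.code (R.g.1 ^ (R.z.1 : ℕ)))).write 7 4
        (P.code (R.g.1 ^ (R.z.2 : ℕ)))) := by
      simp [runBlock₁, Cmd.exec, Expr.eval, BinOp.eval, H.count, H.i, hi, H.v, H.u]
    rw [this, mean_pure]
    simp only [plantedSampler, hi, if_true]
    refine h2 _ _ _ ?_ ?_ ?_ ?_ ?_ ?_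
    · simp [Params.Gen.pow_rebase]
    · simp [Params.Gen.pow_rebase]
    · intro b x h7 _
      simp [h7]
    · intro h h'
      exact absurd (hi.symm.trans h) h'
    · intro _
      simp
    · intro _
      exact ⟨Params.Gen.pow_rebase _ _ _, Params.Gen.pow_rebase _ _ _⟩
  · have hs : ∀ x y : Fin P.q, ∀ N : Memory,
        N = ((((M'.write 7 5 x).write 7 6 y).write 7 3 (P.code ((R.s k).1 ^ (x : ℕ)))).write 7 4
          (P.code ((R.s l).1 ^ (y : ℕ)))) →
        mean (idealRun R.s (PMF.pure (x, y)) k l) Φ ≤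
          mean ((report 1 (.powMod (.cell 7 4) (.cell 7 5) (.cell 0 1))).exec N) fun N =>
          mean ((report 2 (.powMod (.cell 7 3) (.cell 7 6) (.cell 0 1))).exec N) fun N =>
          mean ((runBlock₂ (a + 30)).exec N) fun N' => mean (count.exec N') F := by
      intro x y N hN
      have hp : N 0 1 = P.p := by simp [hN, H.p]
      have hN' : ∀ b x, b ≠ 7 → N b x = M' b x := by
        intro b x h7
        simp [hN, h7]
      set N₁ := if hist.length = R.j ∧ R.h = 1 then
        N.write 1 0 ((aliceKey R.s l x y).2 ^ R.ρ).val else N with hN₁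
      have hN₁' : ∀ b x, b ≠ 1 → N₁ b x = N b x := by
        intro b x h1
        simp [hN₁, ite_write_apply, h1]
      have r₁ : (report 1 (.powMod (.cell 7 4) (.cell 7 5) (.cell 0 1))).exec N = PMF.pure N₁ := by
        refine H.exec_report (fun i => hN' _ _ (by omega)) (fun i => hN' _ _ (by omega))
          (hN' _ _ (by omega)) (1 : Fin 3) (z := (aliceKey R.s l x y).2) ?_
        simp only [Expr.eval, hp, P.p_ne_zero, if_false]
        simp [hN, val_pow_mod, aliceKey, Params.code]
      set N₂ := if hist.length = R.j ∧ R.h = 2 then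
        N₁.write 1 0 ((bobKey R.s k x y).2 ^ R.ρ).val else N₁ with hN₂
      have hN₂' : ∀ b x, b ≠ 1 → N₂ b x = N b x := by
        intro b x h1
        simp [hN₂, ite_write_apply, h1, hN₁']
      have r₂ : (report 2 (.powMod (.cell 7 3) (.cell 7 6) (.cell 0 1))).exec N₁ =
          PMF.pure N₂ := by
        refine H.exec_report (fun i => ?_) (fun i => ?_) ?_ (2 : Fin 3)
          (z := (bobKey R.s k x y).2) ?_
        · rw [hN₁' _ _ (by omega), hN' _ _ (by omega)]
        · rw [hN₁' _ _ (by omega), hN' _ _ (by omega)]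
        · rw [hN₁' _ _ (by omega), hN' _ _ (by omega)]
        · simp only [Expr.eval, hN₁' 7 _ (by omega), hN₁' 0 _ (by omega), hp, P.p_ne_zero, if_false]
          simp [hN, val_pow_mod, bobKey, Params.code]
      rw [r₁, mean_pure, r₂, mean_pure]
      refine h2 x y N₂ ?_ ?_ ?_ ?_ ?_ ?_
      · rw [hN₂' _ _ (by omega)]
        simp [hN]
      · rw [hN₂' _ _ (by omega)]
        simp [hN]
      · intro b i h7 h1
        rw [hN₂' _ _ h1, hN' _ _ h7]
      · intro hj _
        refine ⟨fun h => ?_, fun h => ?_⟩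
        · simp [hN₂, hN₁, hj, h]
        · simp [hN₂, hj, h]
      · intro hj
        simp [hN₂, hN₁, hj, hN' 1 0 (by omega)]
      · exact fun h => absurd h hi
    simp only [plantedSampler, hi, if_false]
    have e1 : M' 3 0 ≠ M' 2 1 := by rw [H.count, H.i]; exact hi
    have hrun : mean (idealRun R.s (PMF.uniformOfFintype (Fin P.q × Fin P.q)) k l) Φ =
        mean (PMF.uniformOfFintype (Fin P.q)) fun x => mean (PMF.uniformOfFintype (Fin P.q))
          fun y => mean (idealRun R.s (PMF.pure (x, y)) k l) Φ := by
      simp only [idealRun, mean_bind, mean_pure, mean_uniform_prod]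
    simp only [hrun, runBlock₁, Cmd.exec, Expr.eval, BinOp.eval, e1, if_false, if_true, mean_bind,
      mean_map, H.q, mean_uniformBelow, mean_pure]
    refine mean_mono _ fun x => ?_
    have hq : (M'.write 7 5 x) 0 2 = P.q := by simp [H.q]
    rw [hq, mean_uniformBelow]
    refine mean_mono _ fun y => ?_
    refine (hs x y _ rfl).trans (le_of_eq ?_)
    congr 2
    simp [H.p, P.p_ne_zero, hk, hl, H.secret, code_pow_mod]

theorem idealOracle_pair (s : Fin n → P.Gen) (C : Finset (Fin n)) (smp : Sampler P n)
    (hist : History P σ n) (v z : ℕ) :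
    idealOracle s C smp hist [v, z] = if v = 3 then idealHash hist (0, z) else
      if v = 4 then idealHash hist (1, z) else if v = 5 then idealHash hist (2, z) else
        PMF.pure ([], .other) := by
  unfold idealOracle
  split <;> simp_all

theorem idealOracle_triple (s : Fin n → P.Gen) (C : Finset (Fin n)) (smp : Sampler P n)
    (hist : History P σ n) (v k l : ℕ) :
    idealOracle s C smp hist [v, k, l] = if v = 0 then
      if h : ∃ (hk : k < n) (hl : l < n), (⟨k, hk⟩ : Fin n) ∉ C ∧ (⟨l, hl⟩ : Fin n) ∉ C then
        idealRun s (smp hist.length ⟨k, h.1⟩ ⟨l, h.2.1⟩) ⟨k, h.1⟩ ⟨l, h.2.1⟩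
      else PMF.pure ([], .other)
    else PMF.pure ([], .other) := by
  rcases v with _ | v
  · rfl
  · simp [idealOracle]

theorem idealOracle_of_length (s : Fin n → P.Gen) (C : Finset (Fin n)) (smp : Sampler P n)
    (hist : History P σ n) {q : List ℕ} (h2 : q.length ≠ 2) (h3 : q.length ≠ 3) :
    idealOracle s C smp hist q = PMF.pure ([], .other) := by
  unfold idealOracle
  split <;> simp_all

theorem Simulates.other {R : Plan P n} {M : Memory} {hist : History P σ n} {M' : Memory} {a : ℕ}
    (H : Simulates R (Function.update M a fun _ => 0) hist M')
    {Φ : List ℕ × Event P σ n → ℝ≥0∞} {F : Memory → ℝ≥0∞}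
    (hF : ∀ r N', Simulates R (Function.update M a fun x => r.1.getD x 0) (r.2 :: hist) N' →
      Φ r ≤ F N') :
    Φ ([], .other) ≤ mean (Handshake.count.exec M') F := by
  rw [exec_count, mean_pure]
  refine hF _ _ (H.cons _ ?_ ?_ ?_ ?_ ?_ ?_ ?_ ?_ ?_ ?_)
  · intro b x
    simpa using H.mem b x
  · simp
  · simp
  · simp
  · simp
  · simp
  · intro b
    rw [Memory.write_apply, if_neg (by omega), H.table b]
    rfl
  · intro _ _ b hb
    cases hb
  · simp
  · intro _ k l x y w₁ w₂ h
    cases h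

/-- One call of the ideal experiment is simulated. -/
theorem mean_callBlock {R : Plan P n} {M : Memory} {hist : History P σ n} {M' : Memory}
    (H : Simulates R M hist M') (a : ℕ) (q : List Expr) (Φ : List ℕ × Event P σ n → ℝ≥0∞)
    (F : Memory → ℝ≥0∞)
    (hF : ∀ r N', Simulates R (Function.update M a fun x => r.1.getD x 0) (r.2 :: hist) N' →
      Φ r ≤ F N') :
    mean (idealOracle R.s R.C (plantedSampler R.s R.g R.i R.z) hist (q.map (Expr.eval M))) Φ ≤
      mean ((callBlock (a + 30) (q.map Expr.lift)).exec M') F := by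
  have hlong : ∀ c : Cmd, c = .seq (.call (a + 30) []) count →
      mean (PMF.pure ([], .other)) Φ ≤ mean (c.exec M') F := by
    rintro c rfl
    simp only [Cmd.exec, mean_bind, mean_pure]
    exact (H.clear a).other hF
  rcases q with _ | ⟨e, _ | ⟨k, _ | ⟨l, _ | ⟨x, q⟩⟩⟩⟩
  · rw [idealOracle_of_length _ _ _ _ (by simp) (by simp)]
    exact hlong _ rfl
  · rw [idealOracle_of_length _ _ _ _ (by simp) (by simp)]
    exact hlong _ rfl
  · have H₁ := H.aux 0 (e.eval M)
    have H₂ := H₁.aux 1 (k.eval M % P.p)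
    have H₃ := H₂.clear a
    simp only [List.map_cons, List.map_nil, callBlock, Cmd.exec, mean_bind, mean_pure,
      idealOracle_pair]
    have e1 : (Expr.const 0).eval M' = 0 := rfl
    have e2 : (Expr.const 1).eval (M'.write 7 0 (e.eval M)) = 1 := rfl
    have e3 : (Expr.bin .mod k.lift (.cell 0 1)).eval (M'.write 7 0 (e.eval M)) =
        k.eval M % P.p := by
      simp only [Expr.eval, BinOp.eval, H₁.eval_lift, H₁.p]
    rw [H.eval_lift, e1, e2, e3]
    set N := Function.update ((M'.write 7 0 (e.eval M)).write 7 1 (k.eval M % P.p)) (a + 30)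
      (fun _ => 0) with hN
    have n0 : N 7 0 = e.eval M := by
      rw [hN, Function.update_of_ne (by omega)]
      simp
    have n1 : N 7 1 = (k.eval M : ZMod P.p).val := by
      rw [hN, Function.update_of_ne (by omega), ZMod.val_natCast]
      simp
    have c : ∀ v, (Expr.bin .eq (.cell 7 0) (.const v)).eval N = if e.eval M = v then 1 else 0 := by
      intro v
      simp [Expr.eval, BinOp.eval, n0]
    simp only [c]
    by_cases h3 : e.eval M = 3
    · simpa [h3] using mean_hashBlock H₃ 0 _ n1 Φ F hF
    by_cases h4 : e.eval M = 4
    · simpa [h4] using mean_hashBlock H₃ 1 _ n1 Φ F hF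
    by_cases h5 : e.eval M = 5
    · simpa [h5] using mean_hashBlock H₃ 2 _ n1 Φ F hF
    simpa [h3, h4, h5] using H₃.other hF
  · have H₁ := H.aux 0 (e.eval M)
    have H₂ := H₁.aux 1 (k.eval M)
    have H₃ := H₂.aux 2 (l.eval M)
    have H₄ := H₃.clear a
    simp only [List.map_cons, List.map_nil, callBlock, Cmd.exec, mean_bind, mean_pure,
      idealOracle_triple]
    have e1 : (Expr.const 0).eval M' = 0 := rfl
    have e2 : (Expr.const 1).eval (M'.write 7 0 (e.eval M)) = 1 := rfl
    have e3 : (Expr.const 2).eval ((M'.write 7 0 (e.eval M)).write 7 1 (k.eval M)) = 2 := rfl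
    rw [H.eval_lift, e1, H₁.eval_lift, e2, H₂.eval_lift, e3]
    set N := Function.update (((M'.write 7 0 (e.eval M)).write 7 1 (k.eval M)).write 7 2
      (l.eval M)) (a + 30) (fun _ => 0) with hN
    have n0 : N 7 0 = e.eval M := by
      rw [hN, Function.update_of_ne (by omega)]
      simp
    have n1 : N 7 1 = k.eval M := by
      rw [hN, Function.update_of_ne (by omega)]
      simp
    have n2 : N 7 2 = l.eval M := by
      rw [hN, Function.update_of_ne (by omega)]
      simp
    have hk := H₄.honest (k.eval M)
    have hl := H₄.honest (l.eval M)
    simp only [Expr.eval, n0, n1, n2]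
    by_cases h0 : e.eval M = 0
    · by_cases h : ∃ (hk : k.eval M < n) (hl : l.eval M < n),
          (⟨k.eval M, hk⟩ : Fin n) ∉ R.C ∧ (⟨l.eval M, hl⟩ : Fin n) ∉ R.C
      · have hk' := hk.mpr ⟨h.1, h.2.2.1⟩
        have hl' := hl.mpr ⟨h.2.1, h.2.2.2⟩
        rw [if_pos h0, dif_pos h, if_pos h0, if_neg hk', if_neg hl', mean_bind]
        exact mean_runBlock H₄ ⟨_, h.1⟩ ⟨_, h.2.1⟩ n1 n2 Φ F hF
      · have hkl : N 4 (k.eval M) = 0 ∨ N 4 (l.eval M) = 0 := by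
          by_contra hcon
          push Not at hcon
          obtain ⟨a₁, a₂⟩ := hk.mp hcon.1
          obtain ⟨b₁, b₂⟩ := hl.mp hcon.2
          exact h ⟨a₁, b₁, a₂, b₂⟩
        have := H₄.other hF
        rw [dif_neg h]
        rcases hkl with hkl | hkl
        · simpa [h0, hkl] using this
        · by_cases hkk : N 4 (k.eval M) = 0
          · simpa [h0, hkk] using this
          · simpa [h0, hkk, hkl] using this
    · simpa [h0] using H₄.other hF
  · rw [idealOracle_of_length _ _ _ _ (by simp) (by simp)]
    exact hlong _ rfl

/-- The success of the reduction. -/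
theorem Simulates.output_eq {R : Plan P n} {M : Memory} {hist : History P σ n} {M' : Memory}
    (H : Simulates R M hist M') {k₀ : Fin n} (hρ : (R.s k₀).1 = R.g.1 ^ R.ρ)
    (hc : Collision R.s hist R.i R.j R.h k₀) :
    M' 2 2 < M' 3 0 ∧ M' 1 0 = P.code (R.g.1 ^ ((R.z.1 : ℕ) * (R.z.2 : ℕ))) := by
  obtain ⟨hij, k, l, x, y, w₁, w₂, e, hi, hj, hkey⟩ := hc
  refine ⟨?_, ?_⟩
  · rw [H.j, H.count]
    exact lt_length_of_eventAt hj
  · obtain ⟨hx, hy⟩ := H.planted _ _ _ _ _ _ hi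
    rcases hkey with ⟨hh, rfl, hmem⟩ | ⟨hh, rfl, hmem⟩
    · rw [H.out e hj hij _ hmem (by rw [hh]; rfl)]
      unfold aliceKey Params.code
      -- Both sides become powers of `g`: the argument is `(g ^ b) ^ x`, and `g ^ a = (g ^ ρ) ^ x`.
      rw [← Units.val_pow_eq_pow_val, hy, pow_mul, ← hx, hρ]
      simp only [← pow_mul]
      congr 3
      ring
    · rw [H.out e hj hij _ hmem (by rw [hh]; rfl)]
      unfold bobKey Params.code
      rw [← Units.val_pow_eq_pow_val, hx, mul_comm, pow_mul, ← hy, hρ]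
      simp only [← pow_mul]
      congr 3
      ring

-- A simulated call takes at most `100` steps, any other command one step. When the simulated time
-- is over, a collision has already been reported and the output is frozen, so that it does not
-- matter how much longer the reduction runs.
open Classical in
theorem mean_collision_le_value (R : Plan P n) {k₀ : Fin n} (hρ : (R.s k₀).1 = R.g.1 ^ R.ρ)
    (t : ℕ) : ∀ (cfg : Config) (hist : History P σ n) (M' : Memory),
      Simulates R cfg.mem hist M' →
      (mean (idealSteps R.s R.C (plantedSampler R.s R.g R.i R.z) t (cfg, hist)) fun st =>
        if Collision R.s st.2 R.i R.j R.h k₀ then 1 else 0) ≤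
      value (fun s => if s.mem 1 0 = P.code (R.g.1 ^ ((R.z.1 : ℕ) * (R.z.2 : ℕ))) then 1 else 0)
        (100 * t) (cfg.todo.map Cmd.simulate) M' := by
  induction t with
  | zero =>
    intro cfg hist M' H
    simp only [idealSteps, mean_pure]
    split_ifs with hc
    · obtain ⟨h1, h2⟩ := H.output_eq hρ hc
      refine le_iInf₂ fun T _ => (mean_steps_of_reported _ T _ _ ?_ h1 h2).ge
      intro c hc
      obtain ⟨c', -, rfl⟩ := List.mem_map.mp hc
      exact c'.safe_simulate
    · exact zero_le
  | succ t ih =>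
    intro cfg hist M' H
    rcases cfg with ⟨_ | ⟨c, K⟩, M⟩
    · rw [mean_idealSteps_silent (by simp [Config.Silent])]
      simp only [step, mean_pure]
      exact (ih _ _ _ H).trans (value_mono _ (by omega) _ _)
    · by_cases hc : ∃ a q, c = .call a q
      · obtain ⟨a, q, rfl⟩ := hc
        rw [mean_idealSteps_call]
        refine le_trans ?_ ((mean_exec_value_le _ (loopFree_callBlock (a + 30) (q.map Expr.lift))
          (100 * t) (K.map Cmd.simulate) M').trans
            (value_mono _ (by have := time_callBlock_le (a + 30) (q.map Expr.lift); omega) _ _))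
        exact mean_callBlock H a q _ _ fun r N' HN => ih _ _ _ HN
      · push Not at hc
        rw [mean_idealSteps_silent (fun a q K' h => hc a q (by simp at h; exact h.1))]
        refine le_trans ?_ ((mean_step_value_le _ (100 * t) _ M').trans
          (value_mono _ (by omega) _ _))
        cases c with
        | skip =>
          simp only [step, mean_pure, List.map_cons, Cmd.simulate]
          exact ih _ _ _ H
        | store a i e =>
          simp only [step, mean_pure, List.map_cons, Cmd.simulate, H.eval_lift]
          exact ih _ _ _ (H.store _ _ _)
        | rand a i e =>
          simp only [step, mean_bind, mean_pure, List.map_cons, Cmd.simulate, H.eval_lift]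
          exact mean_mono _ fun v => ih _ _ _ (H.store _ _ _)
        | call a q => exact absurd rfl (hc a q)
        | seq c d =>
          simp only [step, mean_pure, List.map_cons, Cmd.simulate]
          exact ih ⟨c :: d :: K, M⟩ _ _ H
        | cond e c d =>
          simp only [step, mean_pure, List.map_cons, Cmd.simulate, H.eval_lift]
          split_ifs
          · exact ih ⟨d :: K, M⟩ _ _ H
          · exact ih ⟨c :: K, M⟩ _ _ H
        | loop e c =>
          simp only [step, mean_pure, List.map_cons, Cmd.simulate, H.eval_lift]
          split_ifs
          · exact ih ⟨K, M⟩ _ _ H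
          · exact ih ⟨c :: .loop e c :: K, M⟩ _ _ H

/-! ### The preparations of the reduction -/

/-- Store the values of a list of expressions in an array, from the index `i` on. -/
def fill (a : ℕ) : ℕ → List Expr → Cmd
  | _, [] => .skip
  | i, e :: es => .seq (.store a (.const i) e) (fill a (i + 1) es)

theorem loopFree_fill (a i : ℕ) (es : List Expr) : (fill a i es).LoopFree := by
  induction es generalizing i with
  | nil => trivial
  | cons e es ih => exact ⟨trivial, ih _⟩

/-- The expressions must not read the array being filled; then all of them can be evaluated in the
original memory. -/
theorem exec_fill_from (a : ℕ) (es : List Expr) : ∀ (i : ℕ) (M : Memory),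
    (∀ e ∈ es, ∀ N : Memory, (∀ b, b ≠ a → N b = M b) → e.eval N = e.eval M) →
    ∃ N : Memory, (fill a i es).exec M = PMF.pure N ∧ (∀ b, b ≠ a → N b = M b) ∧
      (∀ x, N a (i + x) = (es.map (Expr.eval M))[x]?.getD (M a (i + x))) ∧
      ∀ x, x < i → N a x = M a x := by
  induction es with
  | nil => exact fun i M _ => ⟨M, rfl, fun _ _ => rfl, fun x => by simp, fun _ _ => rfl⟩
  | cons e es ih =>
    intro i M h
    set M₁ := M.write a i (e.eval M) with hM₁
    have h₁ : ∀ b, b ≠ a → M₁ b = M b := by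
      intro b hb
      funext x
      simp [hM₁, hb]
    obtain ⟨N, hN, hb, hx, hlt⟩ := ih (i + 1) M₁ fun e' he' N hN => by
      rw [h e' (List.mem_cons_of_mem _ he') N fun b hb => (hN b hb).trans (h₁ b hb),
        h e' (List.mem_cons_of_mem _ he') M₁ h₁]
    refine ⟨N, ?_, fun b hb' => (hb b hb').trans (h₁ b hb'), ?_, ?_⟩
    · simp only [fill, Cmd.exec, Expr.eval, PMF.pure_bind, ← hM₁, hN]
    · intro x
      rcases x with _ | x
      · rw [hlt _ (by omega)]
        simp [hM₁]
      · have := hx x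
        rw [Nat.add_assoc, Nat.add_comm 1 x] at this
        have hes : es.map (Expr.eval M₁) = es.map (Expr.eval M) :=
          List.map_congr_left fun e' he' => h e' (List.mem_cons_of_mem _ he') M₁ h₁
        rw [this, hes]
        simp [hM₁]
    · intro x hxi
      rw [hlt _ (by omega)]
      simp [hM₁, hxi.ne]

theorem exec_fill {a : ℕ} {es : List Expr} {M : Memory} (hM : ∀ x, M a x = 0)
    (h : ∀ e ∈ es, ∀ N : Memory, (∀ b, b ≠ a → N b = M b) → e.eval N = e.eval M) :
    ∃ N : Memory, (fill a 0 es).exec M = PMF.pure N ∧ (∀ b, b ≠ a → N b = M b) ∧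
      ∀ x, N a x = (es.map (Expr.eval M)).getD x 0 := by
  obtain ⟨N, h1, h2, h3, -⟩ := exec_fill_from a es 0 M h
  refine ⟨N, h1, h2, fun x => ?_⟩
  have := h3 x
  rw [Nat.zero_add, hM] at this
  rw [this, List.getD_eq_getElem?_getD]

/-- Fill the first `N` cells of an array with random numbers below `q`. -/
def randomFill (a : ℕ) : ℕ → Cmd
  | 0 => .skip
  | N + 1 => .seq (randomFill a N) (.rand a (.const N) (.cell 0 2))

theorem loopFree_randomFill (a N : ℕ) : (randomFill a N).LoopFree := by
  induction N with
  | zero => trivial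
  | succ N ih => exact ⟨ih, trivial⟩

theorem mean_exec_randomFill {a : ℕ} (ha : a ≠ 0) {M : Memory} (hq : M 0 2 = P.q) (N : ℕ) :
    ∀ F : Memory → ℝ≥0∞, mean ((randomFill a N).exec M) F =
      mean (PMF.uniformOfFintype (Fin N → Fin P.q)) fun r =>
        F (Function.update M a fun x => if h : x < N then (r ⟨x, h⟩ : ℕ) else M a x) := by
  induction N with
  | zero =>
    intro F
    simp [randomFill, Cmd.exec]
  | succ N ih =>
    intro F
    simp only [randomFill, Cmd.exec, mean_bind, mean_map, ih, Expr.eval]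
    rw [← mean_uniform_equiv (Fin.snocEquiv fun _ : Fin (N + 1) => Fin P.q), mean_uniform_prod,
      mean_comm]
    congr 1
    funext r
    rw [Function.update_of_ne (Ne.symm ha), hq, mean_uniformBelow]
    congr 1
    funext v
    congr 1
    funext b x
    by_cases hb : b = a
    · subst hb
      simp only [Memory.write_apply, Function.update_self, true_and, Fin.snocEquiv_apply]
      rcases lt_trichotomy x N with h | h | h
      · have h' : x < N + 1 := by omega
        simp [h, h', h.ne, Fin.snoc]
      · subst h
        simp [Fin.snoc]
      · have h' : ¬ x < N + 1 := by omega
        have h'' : ¬ x < N := by omega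
        simp [h', h'', h.ne']
    · simp [hb]

/-- Double the cell `0` of the array `2` as often as the first input says. -/
def powerLoop : Cmd :=
  .loop (.bin .lt (.cell 7 0) (.cell 0 0))
    (.seq (.store 2 (.const 0) (.bin .add (.cell 2 0) (.cell 2 0)))
      (.store 7 (.const 0) (.bin .add (.cell 7 0) (.const 1))))

/-- The machine has no unreduced powers, so the range `2 ^ σ` of the hash values is obtained by
doubling. A round takes four steps, one for the test and three for the body; the last test takes one
more. -/
theorem value_powerLoop (f : Config → ℝ≥0∞) (N : ℕ) (K : List Cmd) {M : Memory}
    (hM : M 0 0 = σ) (d : ℕ) : ∀ t, t + d = σ →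
      value f N K ((M.write 2 0 (2 ^ σ)).write 7 0 σ) ≤
        value f (N + 4 * d + 1) (powerLoop :: K) ((M.write 2 0 (2 ^ t)).write 7 0 t) := by
  induction d with
  | zero =>
    intro t ht
    obtain rfl : t = σ := by omega
    refine le_trans ?_ (mean_step_value_le f N _ _)
    simp [powerLoop, step, Expr.eval, BinOp.eval, hM]
  | succ d ih =>
    intro t ht
    refine le_trans (ih (t + 1) (by omega)) ?_
    refine le_trans ?_ (mean_step_value_le f (N + 4 * (d + 1)) _ _)
    have htσ : t < σ := by omega
    have : (Expr.bin .lt (.cell 7 0) (.cell 0 0)).eval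
        ((M.write 2 0 (2 ^ t)).write 7 0 t) = 1 := by
      simp [Expr.eval, BinOp.eval, hM, htσ]
    simp only [powerLoop, step, mean_pure, this, one_ne_zero, if_false]
    refine le_trans (le_of_eq ?_) ((mean_exec_value_le f
      (c := .seq (.store 2 (.const 0) (.bin .add (.cell 2 0) (.cell 2 0)))
        (.store 7 (.const 0) (.bin .add (.cell 7 0) (.const 1)))) ⟨trivial, trivial⟩
      (N + 4 * d + 1) (powerLoop :: K) _).trans (value_mono f (by simp [Cmd.time]; omega) _ _))
    simp only [Cmd.exec, mean_bind, mean_pure, Expr.eval, BinOp.eval]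
    congr 1
    funext b x
    simp only [Memory.write_apply]
    by_cases h7 : b = 7
    · subst h7
      by_cases hx : x = 0 <;> simp [hx]
    · by_cases h2 : b = 2
      · subst h2
        by_cases hx : x = 0 <;> simp [hx, pow_succ, mul_two]
      · simp [h7, h2]

/-- The expression for the exponent of a node. -/
def exponentExpr (γ : Membership n m) (k : Fin n) : Expr :=
  match γ k with
  | some j => .cell 8 j
  | none => .cell 9 k

/-- The exponent of a node, given those of the groups and nodes. -/
def exponent (γ : Membership n m) (r : Fin m → Fin P.q) (r' : Fin n → Fin P.q) (k : Fin n) : ℕ :=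
  match γ k with
  | some j => r j
  | none => r' k

/-- The random choices and the preparation of the memory; `k` determines the range from which the
numbers of the two calls are chosen. -/
def prepare (γ : Membership n m) (C : Finset (Fin n)) (k : ℕ) : Cmd :=
  -- The range `σ ^ (k + 1)` is computed modulo `2 ^ σ`, which changes nothing for large `σ`.
  .seq (.rand 2 (.const 1) (.powMod (.cell 0 0) (.const (k + 1)) (.cell 2 0)))
    (.seq (.rand 2 (.const 2) (.powMod (.cell 0 0) (.const (k + 1)) (.cell 2 0)))
      (.seq (.rand 2 (.const 3) (.const 3))
        (.seq (randomFill 8 m)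
          (.seq (randomFill 9 n)
            -- The guess of the node whose exponent is used in the report.
            (.seq (.rand 7 (.const 0) (.const n))
              (.seq (fill 5 0 (List.ofFn (exponentExpr γ)))
                (.seq (.store 2 (.const 4) (.load 5 (.cell 7 0)))
                  (.seq (fill 6 0 (List.ofFn fun k : Fin n =>
                      .powMod (.cell 0 3) (.cell 5 k) (.cell 0 1)))
                    (.seq (fill 4 0 (List.ofFn fun k : Fin n => .const (if k ∈ C then 0 else 1)))
                      (fill 30 0 (.cell 0 0 :: .cell 0 1 :: .cell 0 2 ::
                        List.ofFn fun k : Fin n =>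
                          if k ∈ C then .cell 6 k else .const 0)))))))))))

theorem loopFree_prepare (γ : Membership n m) (C : Finset (Fin n)) (k : ℕ) :
    (prepare γ C k).LoopFree := by
  simp [prepare, Cmd.LoopFree, loopFree_fill, loopFree_randomFill]

theorem getD_ofFn {α : Type*} (f : Fin n → α) (k : Fin n) (d : α) :
    (List.ofFn f).getD k d = f k := by
  simp [List.getD_eq_getElem?_getD]

/-- The guesses and exponents are independent and uniform. The resulting memory is described only by
the cells that matter for `Simulates`. -/
theorem mean_prepare (γ : Membership n m) (C : Finset (Fin n)) (k : ℕ) [NeZero n]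
    {M : Memory} (h0 : M 0 0 = σ) (hp : M 0 1 = P.p) (hq : M 0 2 = P.q) (h2 : M 2 0 = 2 ^ σ)
    (hM : ∀ a x, a ≠ 0 → a ≠ 2 → a ≠ 7 → M a x = 0) {N : ℕ} [NeZero N]
    (hNσ : σ ^ (k + 1) % 2 ^ σ = N)
    (Ψ : Fin N → Fin N → Fin 3 → (Fin m → Fin P.q) → (Fin n → Fin P.q) → Fin n → ℝ≥0∞)
    (F : Memory → ℝ≥0∞)
    (hF : ∀ (i j : Fin N) (h : Fin 3) r r' k₀ (N' : Memory), (∀ x, N' 0 x = M 0 x) → N' 2 0 = 2 ^ σ → N' 2 1 = (i : ℕ) →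
      N' 2 2 = (j : ℕ) → N' 2 3 = (h : ℕ) → N' 2 4 = exponent γ r r' k₀ →
      (∀ k : Fin n, N' 6 k = M 0 3 ^ exponent γ r r' k % P.p) →
      (∀ x, N' 4 x ≠ 0 ↔ ∃ hx : x < n, (⟨x, hx⟩ : Fin n) ∉ C) →
      (∀ x, N' 30 x = (σ :: P.p :: P.q :: List.ofFn fun k : Fin n =>
        if k ∈ C then M 0 3 ^ exponent γ r r' k % P.p else 0).getD x 0) →
      (∀ a x, (a = 1 ∨ a = 3 ∨ 10 ≤ a ∧ a ≠ 30) → N' a x = 0) →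
      Ψ i j h r r' k₀ ≤ F N') :
    (mean (PMF.uniformOfFintype (Fin N)) fun i => mean (PMF.uniformOfFintype (Fin N)) fun j =>
      mean (PMF.uniformOfFintype (Fin 3)) fun h =>
      mean (PMF.uniformOfFintype (Fin m → Fin P.q)) fun r =>
      mean (PMF.uniformOfFintype (Fin n → Fin P.q)) fun r' =>
      mean (PMF.uniformOfFintype (Fin n)) fun k₀ => Ψ i j h r r' k₀) ≤
      mean ((prepare γ C k).exec M) F := by
  have hpow : ∀ M' : Memory, M' 0 0 = σ → M' 2 0 = 2 ^ σ →
      (Expr.powMod (.cell 0 0) (.const (k + 1)) (.cell 2 0)).eval M' = N := by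
    intro M' h0 h2
    simp [Expr.eval, h0, h2, hNσ]
  simp only [prepare, Cmd.exec, mean_bind, mean_map]
  rw [hpow M h0 h2, mean_uniformBelow]
  refine mean_mono _ fun i => ?_
  set M₁ := M.write 2 ((Expr.const 1).eval M) i with hM₁
  rw [hpow M₁ (by simp [hM₁, h0]) (by simp [hM₁, h2, Expr.eval]), mean_uniformBelow]
  refine mean_mono _ fun j => ?_
  set M₂ := M₁.write 2 ((Expr.const 2).eval M₁) j with hM₂
  rw [show (Expr.const 3).eval M₂ = 3 from rfl, mean_uniformBelow]
  refine mean_mono _ fun h => ?_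
  set M₃ := M₂.write 2 3 h with hM₃
  have h30 : ∀ x, M₃ 0 x = M 0 x := by
    intro x
    simp [hM₃, hM₂, hM₁]
  rw [mean_exec_randomFill (P := P) (by norm_num) (by rw [h30, hq])]
  refine mean_mono _ fun r => ?_
  set M₄ : Memory := Function.update M₃ 8 fun x => if h : x < m then (r ⟨x, h⟩ : ℕ) else M₃ 8 x with hM₄
  have h40 : ∀ x, M₄ 0 x = M 0 x := by
    intro x
    rw [hM₄, Function.update_of_ne (by norm_num), h30]
  rw [mean_exec_randomFill (P := P) (by norm_num) (by rw [h40, hq])]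
  refine mean_mono _ fun r' => ?_
  set M₅ : Memory := Function.update M₄ 9 fun x => if h : x < n then (r' ⟨x, h⟩ : ℕ) else M₄ 9 x with hM₅
  rw [show (Expr.const n).eval M₅ = n from rfl, mean_uniformBelow]
  refine mean_mono _ fun k₀ => ?_
  set M₆ := M₅.write 7 ((Expr.const 0).eval M₅) k₀ with hM₆
  have h60 : ∀ x, M₆ 0 x = M 0 x := by
    intro x
    simp [hM₆, hM₅, h40]
  have h62 : M₆ 2 0 = 2 ^ σ ∧ M₆ 2 1 = i ∧ M₆ 2 2 = j ∧ M₆ 2 3 = h := by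
    refine ⟨?_, ?_, ?_, ?_⟩ <;> simp [hM₆, hM₅, hM₄, hM₃, hM₂, hM₁, Expr.eval, h2]
  have h68 : ∀ x : Fin m, M₆ 8 x = r x := by
    intro x
    simp [hM₆, hM₅, hM₄]
  have h69 : ∀ x : Fin n, M₆ 9 x = r' x := by
    intro x
    simp [hM₆, hM₅]
  have h67 : M₆ 7 0 = k₀ := by simp [hM₆, Expr.eval]
  have h6z : ∀ a x, a ≠ 0 → a ≠ 2 → a ≠ 7 → a ≠ 8 → a ≠ 9 → M₆ a x = 0 := by
    intro a x e0 e2 e7 e8 e9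
    simp [hM₆, hM₅, hM₄, hM₃, hM₂, hM₁, e2, e7, e8, e9, hM a x e0 e2 e7]
  clear_value M₆
  obtain ⟨M₇, e7, h7, h75⟩ := exec_fill (a := 5) (es := List.ofFn (exponentExpr γ)) (M := M₆)
    (fun x => h6z _ _ (by omega) (by omega) (by omega) (by omega) (by omega)) (by
      intro e he N hN
      obtain ⟨x, rfl⟩ := (List.mem_ofFn' _ _).mp he
      unfold exponentExpr
      cases γ x <;> simp [Expr.eval, hN])
  have h75' : ∀ x : Fin n, M₇ 5 x = exponent γ r r' x := by
    intro x
    rw [h75, List.map_ofFn, getD_ofFn]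
    simp only [Function.comp_apply, exponentExpr, exponent]
    cases γ x <;> simp [Expr.eval, h68, h69]
  rw [e7, mean_pure, mean_pure]
  set M₈ := M₇.write 2 ((Expr.const 4).eval M₇) ((Expr.load 5 (.cell 7 0)).eval M₇) with hM₈
  have h8 : ∀ b x, b ≠ 5 → b ≠ 2 → M₈ b x = M₆ b x := by
    intro b x b5 b2
    rw [hM₈, Memory.write_apply, if_neg (by omega), h7 b b5]
  have h85 : ∀ x : Fin n, M₈ 5 x = exponent γ r r' x := by
    intro x
    rw [hM₈, Memory.write_apply, if_neg (by omega), h75']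
  have h82 : ∀ x, x ≠ 4 → M₈ 2 x = M₆ 2 x := by
    intro x hx
    simp [hM₈, Expr.eval, hx, h7]
  have h824 : M₈ 2 4 = exponent γ r r' k₀ := by
    simp [hM₈, Expr.eval, h7 7, h67, h75']
  clear_value M₈
  have h8z : ∀ x, M₈ 6 x = 0 := by
    intro x
    rw [h8 _ _ (by omega) (by omega),
      h6z _ _ (by omega) (by omega) (by omega) (by omega) (by omega)]
  obtain ⟨M₉, e9, h9, h96⟩ := exec_fill (a := 6) (es := List.ofFn fun k : Fin n =>
      .powMod (.cell 0 3) (.cell 5 k) (.cell 0 1)) (M := M₈)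
    h8z (by
      intro e he N hN
      obtain ⟨x, rfl⟩ := (List.mem_ofFn' _ _).mp he
      by_cases hc : M₈ 0 1 = 0 <;> simp [Expr.eval, hN, hc])
  have h96' : ∀ x : Fin n, M₉ 6 x = M 0 3 ^ exponent γ r r' x % P.p := by
    intro x
    rw [h96, List.map_ofFn, getD_ofFn]
    simp [Expr.eval, h8, h60, h85, hp, P.p_ne_zero]
  rw [e9, mean_pure]
  have h9z : ∀ x, M₉ 4 x = 0 := by
    intro x
    rw [h9 _ (by omega), h8 _ _ (by omega) (by omega),
      h6z _ _ (by omega) (by omega) (by omega) (by omega) (by omega)]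
  obtain ⟨M₁₀, e10, h10, h104⟩ := exec_fill (a := 4) (es := List.ofFn fun k : Fin n =>
      .const (if k ∈ C then 0 else 1)) (M := M₉)
    h9z (by
      intro e he N hN
      obtain ⟨x, rfl⟩ := (List.mem_ofFn' _ _).mp he
      rfl)
  rw [e10, mean_pure]
  have h10' : ∀ b x, b ≠ 2 → b ≠ 4 → b ≠ 5 → b ≠ 6 → M₁₀ b x = M₆ b x := by
    intro b x b2 b4 b5 b6
    rw [h10 _ b4, h9 _ b6, h8 _ _ b5 b2]
  have h10z : ∀ x, M₁₀ 30 x = 0 := by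
    intro x
    rw [h10' _ _ (by omega) (by omega) (by omega) (by omega),
      h6z _ _ (by omega) (by omega) (by omega) (by omega) (by omega)]
  obtain ⟨M', e', h', h30'⟩ := exec_fill (a := 30) (es := .cell 0 0 :: .cell 0 1 :: .cell 0 2 ::
      List.ofFn fun k : Fin n => if k ∈ C then .cell 6 k else .const 0) (M := M₁₀)
    h10z (by
      intro e he N hN
      simp only [List.mem_cons, List.mem_ofFn'] at he
      rcases he with rfl | rfl | rfl | ⟨x, rfl⟩
      · simp [Expr.eval, hN]
      · simp [Expr.eval, hN]
      · simp [Expr.eval, hN]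
      · dsimp only
        split_ifs <;> simp [Expr.eval, hN])
  rw [e', mean_pure]
  refine hF i j h r r' k₀ M' ?_ ?_ ?_ ?_ ?_ ?_ ?_ ?_ ?_ ?_
  · intro x
    rw [h' _ (by norm_num), h10' _ _ (by norm_num) (by norm_num) (by norm_num) (by norm_num), h60]
  · rw [h' _ (by norm_num), h10 _ (by norm_num), h9 _ (by norm_num), h82 _ (by norm_num), h62.1]
  · rw [h' _ (by norm_num), h10 _ (by norm_num), h9 _ (by norm_num), h82 _ (by norm_num), h62.2.1]
  · rw [h' _ (by norm_num), h10 _ (by norm_num), h9 _ (by norm_num), h82 _ (by norm_num),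
      h62.2.2.1]
  · rw [h' _ (by norm_num), h10 _ (by norm_num), h9 _ (by norm_num), h82 _ (by norm_num),
      h62.2.2.2]
  · rw [h' _ (by norm_num), h10 _ (by norm_num), h9 _ (by norm_num), h824]
  · intro x
    rw [h' _ (by norm_num), h10 _ (by norm_num), h96']
  · intro x
    rw [h' _ (by norm_num), h104, List.map_ofFn]
    by_cases hx : x < n
    · have := getD_ofFn (Expr.eval M₉ ∘ fun k : Fin n => .const (if k ∈ C then 0 else 1)) ⟨x, hx⟩ 0
      simp only at this
      rw [this]
      simp [Expr.eval, hx]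
    · simp [hx]
  · intro x
    rw [h30']
    congr 1
    simp only [List.map_cons, Expr.eval, List.map_ofFn]
    rw [h10' _ _ (by norm_num) (by norm_num) (by norm_num) (by norm_num), h60, h0,
      h10' _ _ (by norm_num) (by norm_num) (by norm_num) (by norm_num), h60, hp,
      h10' _ _ (by norm_num) (by norm_num) (by norm_num) (by norm_num), h60, hq]
    congr 4
    funext y
    simp only [Function.comp_apply]
    split_ifs
    · simp only [Expr.eval]
      rw [h10 _ (by norm_num), h96']
    · rfl
  · intro a x ha
    rw [h' _ (by omega), h10' _ _ (by omega) (by omega) (by omega) (by omega),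
      h6z _ _ (by omega) (by omega) (by omega) (by omega) (by omega)]

/-! ### The success probability of the reduction -/

/-- The reduction from the Diffie-Hellman problem to a bad event. -/
def reduction (γ : Membership n m) (C : Finset (Fin n)) (k : ℕ) (c : Cmd) : Cmd :=
  .seq (.store 2 (.const 0) (.const 1))
    (.seq powerLoop (.seq (prepare γ C k) c.simulate))

/-- The initial memory for a given input. -/
def initialMemory (input : List ℕ) : Memory := fun a i => if a = 0 then input.getD i 0 else 0

/-- The input of the adversary. -/
noncomputable def adversaryInput (σ : ℕ) (C : Finset (Fin n)) (s : Fin n → P.Gen) : List ℕ :=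
  σ :: P.p :: P.q :: List.ofFn fun k => if k ∈ C then P.code (s k).1 else 0

/-- The constant `5` counts the three sequencing steps, the initial store and the last test of the
loop. -/
theorem value_reduction (f : Config → ℝ≥0∞) (γ : Membership n m) (C : Finset (Fin n)) (k : ℕ)
    (c : Cmd) (N : ℕ) {M : Memory} (hM : M 0 0 = σ) (h7 : M 7 0 = 0) :
    mean ((prepare γ C k).exec ((M.write 2 0 (2 ^ σ)).write 7 0 σ)) (value f N [c.simulate]) ≤
      value f (N + (prepare γ C k).time + 4 * σ + 5) [reduction γ C k c] M := by
  refine (mean_exec_value_le f (loopFree_prepare γ C k) N [c.simulate] _).trans ?_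
  refine le_trans ?_ ((mean_step_value_le f (N + (prepare γ C k).time + 4 * σ + 4) _ _))
  simp only [reduction, step, mean_pure]
  refine le_trans ?_ ((mean_step_value_le f (N + (prepare γ C k).time + 4 * σ + 3) _ _))
  simp only [step, mean_pure, Expr.eval]
  refine le_trans ?_ ((mean_step_value_le f (N + (prepare γ C k).time + 4 * σ + 2) _ _))
  simp only [step, mean_pure]
  -- The loop invariant for `t = 0`; the loop counter is `0` from the beginning.
  have hM' : M.write 2 0 1 = (M.write 2 0 (2 ^ 0)).write 7 0 0 := by
    funext b x
    simp only [Memory.write_apply, pow_zero]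
    split_ifs with h₁ h₂
    · omega
    · rfl
    · rename_i h₃
      rw [h₃.1, h₃.2, h7]
    · rfl
  rw [hM']
  refine le_trans ?_ (value_mono f (N := N + (prepare γ C k).time + 1 + 4 * σ + 1) (by omega) _ _)
  refine le_trans ?_ (value_powerLoop f (N + (prepare γ C k).time + 1) _ hM σ 0 (by omega))
  refine le_trans ?_ (mean_step_value_le f _ _ _)
  simp only [step, mean_pure]
  exact le_rfl

theorem simulates_initial (R : Plan P n) (M' : Memory)
    (p : M' 0 1 = P.p) (q : M' 0 2 = P.q) (v : M' 0 4 = P.code (R.g.1 ^ (R.z.1 : ℕ)))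
    (u : M' 0 5 = P.code (R.g.1 ^ (R.z.2 : ℕ))) (range : M' 2 0 = 2 ^ σ) (i : M' 2 1 = R.i)
    (j : M' 2 2 = R.j) (h : M' 2 3 = R.h) (ρ : M' 2 4 = R.ρ)
    (honest : ∀ k, M' 4 k ≠ 0 ↔ ∃ hk : k < n, (⟨k, hk⟩ : Fin n) ∉ R.C)
    (secret : ∀ k : Fin n, M' 6 k = P.code (R.s k).1)
    (input : ∀ x, M' 30 x = (adversaryInput σ R.C R.s).getD x 0)
    (zero : ∀ a x, (a = 1 ∨ a = 3 ∨ 10 ≤ a ∧ a ≠ 30) → M' a x = 0) :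
    Simulates R (initialMemory (adversaryInput σ R.C R.s)) ([] : History P σ n) M' where
  mem a x := by
    unfold initialMemory
    split_ifs with ha
    · subst ha
      exact input x
    · exact zero _ _ (by omega)
  p := p
  q := q
  v := v
  u := u
  range := range
  i := i
  j := j
  h := h
  ρ := ρ
  count := zero 3 0 (by omega)
  honest := honest
  secret := secret
  table a := zero _ _ (by have := a.1.2; omega)
  out e he := by cases he
  planted k l x y w₁ w₂ he := by cases he

/-! ### Random exponents in place of random generators -/

/-- The logarithm of a generator to the basis `g`. -/
noncomputable def Params.Gen.log (g s : P.Gen) : Fin P.q :=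
  (g.exists_pow_eq (z := s.1) (by simpa using s.pow_pow_eq_one 1)).choose

theorem Params.Gen.pow_log (g s : P.Gen) : g.1 ^ (g.log s : ℕ) = s.1 :=
  (g.exists_pow_eq (z := s.1) (by simpa using s.pow_pow_eq_one 1)).choose_spec

theorem Params.Gen.log_injective (g : P.Gen) : Function.Injective g.log := by
  intro s s' h
  refine Subtype.ext ?_
  rw [← g.pow_log s, ← g.pow_log s', h]

/-- The reduction cannot draw generators directly and draws exponents. The logarithms of tuples of
generators are a part of all tuples of exponents with relative size `(φ(q) / q) ^ N`; as `F` is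
nonnegative, the other tuples may be discarded. -/
theorem mean_uniform_log (g : P.Gen) (N : ℕ) (F : (Fin N → Fin P.q) → ℝ≥0∞) :
    ((Fintype.card P.Gen : ℝ≥0∞) / P.q) ^ N *
      mean (PMF.uniformOfFintype (Fin N → P.Gen)) (fun s => F fun j => g.log (s j)) ≤
    mean (PMF.uniformOfFintype (Fin N → Fin P.q)) F := by
  have hinj : Function.Injective fun (s : Fin N → P.Gen) j => g.log (s j) :=
    fun s s' h => funext fun j => g.log_injective (congrFun h j)
  refine le_trans (le_of_eq ?_) (mean_uniform_injective hinj F)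
  congr 1
  rw [Fintype.card_fun, Fintype.card_fun, Fintype.card_fin, Fintype.card_fin, Nat.cast_pow,
    Nat.cast_pow, div_eq_mul_inv, div_eq_mul_inv, mul_pow, ENNReal.inv_pow]

theorem exponent_log (γ : Membership n m) (g : P.Gen) (s : Fin m → P.Gen) (s' : Fin n → P.Gen)
    (k : Fin n) :
    g.1 ^ exponent γ (fun j => g.log (s j)) (fun j => g.log (s' j)) k = (secrets γ s s' k).1 := by
  unfold exponent secrets
  cases γ k <;> exact g.pow_log _

/-- The probability that a bad event happens in the ideal experiment. -/
noncomputable def badProbability (P : Params) (σ : ℕ) (γ : Membership n m) (C : Finset (Fin n))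
    (c : Cmd) (t : ℕ) : ℝ≥0∞ :=
  open Classical in
  mean (PMF.uniformOfFintype (Fin m → P.Gen)) fun s =>
  mean (PMF.uniformOfFintype (Fin n → P.Gen)) fun s' =>
  mean (idealSteps (secrets γ s s') C (uniformSampler P n) t
    (⟨[c], initialMemory (adversaryInput σ C (secrets γ s s'))⟩, ([] : History P σ n))) fun st =>
    if Bad (secrets γ s s') st.2 then 1 else 0

open Classical in
/-- The probability of a collision, depending on the exponents chosen by the reduction;
exponents that do not belong to generators are ignored. -/
noncomputable def collisionValue (σ : ℕ) (γ : Membership n m) (C : Finset (Fin n)) (c : Cmd) (t : ℕ)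
    (g : P.Gen) (z : Fin P.q × Fin P.q) (i j : ℕ) (h : Fin 3) (r : Fin m → Fin P.q)
    (r' : Fin n → Fin P.q) (k₀ : Fin n) : ℝ≥0∞ :=
  -- The generators are determined by their logarithms, so the choice is no loss.
  if H : ∃ s : (Fin m → P.Gen) × (Fin n → P.Gen),
      (r = fun j => g.log (s.1 j)) ∧ r' = fun j => g.log (s.2 j) then
    mean (idealSteps (secrets γ H.choose.1 H.choose.2) C
      (plantedSampler (secrets γ H.choose.1 H.choose.2) g i z) t
      (⟨[c], initialMemory (adversaryInput σ C (secrets γ H.choose.1 H.choose.2))⟩,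
        ([] : History P σ n))) fun st =>
      if Collision (secrets γ H.choose.1 H.choose.2) st.2 i j h k₀ then 1 else 0
  else 0

open Classical in
theorem collisionValue_log (σ : ℕ) (γ : Membership n m) (C : Finset (Fin n)) (c : Cmd) (t : ℕ)
    (g : P.Gen) (z : Fin P.q × Fin P.q) (i j : ℕ) (h : Fin 3) (s : Fin m → P.Gen)
    (s' : Fin n → P.Gen) (k₀ : Fin n) :
    collisionValue σ γ C c t g z i j h (fun j => g.log (s j)) (fun j => g.log (s' j)) k₀ =
    mean (idealSteps (secrets γ s s') C (plantedSampler (secrets γ s s') g i z) t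
      (⟨[c], initialMemory (adversaryInput σ C (secrets γ s s'))⟩, ([] : History P σ n))) fun st =>
      if Collision (secrets γ s s') st.2 i j h k₀ then 1 else 0 := by
  have H : ∃ u : (Fin m → P.Gen) × (Fin n → P.Gen),
      ((fun j => g.log (s j)) = fun j => g.log (u.1 j)) ∧
      (fun j => g.log (s' j)) = fun j => g.log (u.2 j) := ⟨(s, s'), rfl, rfl⟩
  have h1 : H.choose.1 = s :=
    funext fun j => (g.log_injective (congrFun H.choose_spec.1 j)).symm
  have h2 : H.choose.2 = s' :=
    funext fun j => (g.log_injective (congrFun H.choose_spec.2 j)).symm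
  unfold collisionValue
  rw [dif_pos H, h1, h2]

theorem collisionValue_le_value (γ : Membership n m) (C : Finset (Fin n)) (c : Cmd) (t : ℕ)
    (g : P.Gen) (z : Fin P.q × Fin P.q) (i j : ℕ) (h : Fin 3) (r : Fin m → Fin P.q)
    (r' : Fin n → Fin P.q) (k₀ : Fin n) (M' : Memory)
    (h0 : ∀ x, M' 0 x = [σ, P.p, P.q, P.code g.1, P.code (g.1 ^ (z.1 : ℕ)),
      P.code (g.1 ^ (z.2 : ℕ))].getD x 0)
    (h20 : M' 2 0 = 2 ^ σ) (h21 : M' 2 1 = i) (h22 : M' 2 2 = j) (h23 : M' 2 3 = h)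
    (h24 : M' 2 4 = exponent γ r r' k₀)
    (h6 : ∀ k : Fin n, M' 6 k = P.code g.1 ^ exponent γ r r' k % P.p)
    (h4 : ∀ x, M' 4 x ≠ 0 ↔ ∃ hx : x < n, (⟨x, hx⟩ : Fin n) ∉ C)
    (h30 : ∀ x, M' 30 x = (σ :: P.p :: P.q :: List.ofFn fun k : Fin n =>
        if k ∈ C then P.code g.1 ^ exponent γ r r' k % P.p else 0).getD x 0)
    (hz : ∀ a x, (a = 1 ∨ a = 3 ∨ 10 ≤ a ∧ a ≠ 30) → M' a x = 0) :
    collisionValue σ γ C c t g z i j h r r' k₀ ≤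
      value (fun s => if s.mem 1 0 = P.code (g.1 ^ ((z.1 : ℕ) * (z.2 : ℕ))) then 1 else 0)
        (100 * t) [c.simulate] M' := by
  classical
  by_cases H : ∃ u : (Fin m → P.Gen) × (Fin n → P.Gen),
      (r = fun j => g.log (u.1 j)) ∧ r' = fun j => g.log (u.2 j)
  · obtain ⟨⟨s, s'⟩, rfl, rfl⟩ := H
    rw [collisionValue_log]
    simp only [code_pow_mod, exponent_log] at h6 h30
    refine mean_collision_le_value ⟨secrets γ s s', g, C, i, j, h,
      exponent γ (fun j => g.log (s j)) (fun j => g.log (s' j)) k₀, z⟩ (k₀ := k₀)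
      (exponent_log γ g s s' k₀).symm t
      ⟨[c], initialMemory (adversaryInput σ C (secrets γ s s'))⟩ [] M' ?_
    exact simulates_initial _ _ (h0 1) (h0 2) (h0 4) (h0 5) h20 h21 h22 h23 h24 h4 h6 h30 hz
  · unfold collisionValue
    rw [dif_neg H]
    exact zero_le

theorem sum_eq_card_mul_mean {α : Type*} [Fintype α] [Nonempty α] (F : α → ℝ≥0∞) :
    ∑ x, F x = Fintype.card α * mean (PMF.uniformOfFintype α) F := by
  rw [mean_uniform, ← mul_assoc, ENNReal.mul_inv_cancel (by simp) (by simp), one_mul]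

theorem mean_mean_comm {α β ι : Type*} (μ : PMF α) (ν : PMF β) (ρ : PMF ι) (F : α → β → ι → ℝ≥0∞) :
    (mean μ fun a => mean ν fun b => mean ρ fun i => F a b i) =
      mean ρ fun i => mean μ fun a => mean ν fun b => F a b i :=
  (congrArg (mean μ) (funext fun a => mean_comm ν ρ (F a))).trans
    (mean_comm μ ρ fun a i => mean ν fun b => F a b i)

-- The sums of the union bound turn into cardinalities times means over uniform guesses, which is
-- the form in which the reduction makes them.
open Classical in
theorem badProbability_le (γ : Membership n m) (C : Finset (Fin n)) (c : Cmd) {t N : ℕ}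
    (hN : t ≤ N) [NeZero N] [NeZero n] :
    badProbability P σ γ C c t ≤ N * (N * (3 * (n *
      mean (PMF.uniformOfFintype (Fin N)) fun i => mean (PMF.uniformOfFintype (Fin N)) fun j =>
      mean (PMF.uniformOfFintype (Fin 3)) fun h =>
      mean (PMF.uniformOfFintype (Fin m → P.Gen)) fun s =>
      mean (PMF.uniformOfFintype (Fin n → P.Gen)) fun s' =>
      mean (PMF.uniformOfFintype (Fin n)) fun k₀ =>
      mean (idealSteps (secrets γ s s') C (uniformSampler P n) t
        (⟨[c], initialMemory (adversaryInput σ C (secrets γ s s'))⟩, ([] : History P σ n))) fun st =>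
        if Collision (secrets γ s s') st.2 i j h k₀ then 1 else 0))) := by
  unfold badProbability
  refine (mean_mono _ fun s => mean_mono _ fun s' => mean_bad_le_sum_collision _ C _ _ hN).trans
    (le_of_eq ?_)
  simp only [sum_eq_card_mul_mean, Fintype.card_fin, mean_mul_left]
  have : ((3 : ℕ) : ℝ≥0∞) = 3 := by norm_num
  rw [this]
  congr 4
  refine (mean_mean_comm _ _ _ _).trans (congrArg _ (funext fun i => ?_))
  refine (mean_mean_comm _ _ _ _).trans (congrArg _ (funext fun j => ?_))
  exact mean_mean_comm _ _ _ _

-- Passing to the reduction's random choices: exponents replace generators, at the cost of the two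
-- factors, and the exponents of call `i` are planted, at no cost.
open Classical in
theorem mean_collision_le_collisionValue (γ : Membership n m) (C : Finset (Fin n)) (c : Cmd)
    (t : ℕ) (g : P.Gen) (i j : ℕ) (h : Fin 3) [NeZero n] :
    ((Fintype.card P.Gen : ℝ≥0∞) / P.q) ^ m * (((Fintype.card P.Gen : ℝ≥0∞) / P.q) ^ n *
      mean (PMF.uniformOfFintype (Fin m → P.Gen)) fun s =>
      mean (PMF.uniformOfFintype (Fin n → P.Gen)) fun s' =>
      mean (PMF.uniformOfFintype (Fin n)) fun k₀ =>
      mean (idealSteps (secrets γ s s') C (uniformSampler P n) t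
        (⟨[c], initialMemory (adversaryInput σ C (secrets γ s s'))⟩, ([] : History P σ n))) fun st =>
        if Collision (secrets γ s s') st.2 i j h k₀ then 1 else 0) ≤
      mean (PMF.uniformOfFintype (Fin P.q × Fin P.q)) fun z =>
      mean (PMF.uniformOfFintype (Fin m → Fin P.q)) fun r =>
      mean (PMF.uniformOfFintype (Fin n → Fin P.q)) fun r' =>
      mean (PMF.uniformOfFintype (Fin n)) fun k₀ =>
        collisionValue σ γ C c t g z i j h r r' k₀ := by
  refine le_of_le_of_eq ?_ (mean_comm _ _ _)
  refine le_trans ?_ (mean_uniform_log g m _)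
  gcongr
  rw [← mean_mul_left]
  refine mean_mono _ fun s => ?_
  refine le_of_le_of_eq ?_ (mean_comm _ _ _)
  refine le_trans ?_ (mean_uniform_log g n _)
  gcongr
  refine mean_mono _ fun s' => ?_
  refine le_of_le_of_eq ?_ (mean_comm _ _ _)
  refine mean_mono _ fun k₀ => ?_
  simp only [collisionValue_log]
  exact (mean_idealSteps_planted _ g C i _ t _ _ (Nat.zero_le _)).le

theorem dhExperiment_eq (P : Params) (σ : ℕ) (c : Cmd) (t : ℕ) :
    dhExperiment P σ c t true =
      mean (PMF.uniformOfFintype P.Gen) fun g =>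
      mean (PMF.uniformOfFintype (Fin P.q × Fin P.q)) fun z =>
      mean (steps noOracle t ⟨[c], initialMemory [σ, P.p, P.q, P.code g.1,
        P.code (g.1 ^ (z.1 : ℕ)), P.code (g.1 ^ (z.2 : ℕ))]⟩) fun s =>
        if s.mem 1 0 = P.code (g.1 ^ ((z.1 : ℕ) * (z.2 : ℕ))) then 1 else 0 := by
  rw [apply_eq_mean]
  simp only [dhExperiment, mean_bind, mean_map, output, decide_eq_true_eq, mean_uniform_prod]
  rfl

/-- A bad event helps to solve the Diffie-Hellman problem. -/
theorem badProbability_le_dhExperiment (γ : Membership n m) (C : Finset (Fin n)) (c : Cmd)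
    (k t T : ℕ) [NeZero n] (hσ : σ ≠ 0) (ht : t ≤ σ ^ (k + 1)) (hlt : σ ^ (k + 1) < 2 ^ σ)
    (hT : 100 * t + (prepare γ C k).time + 4 * σ + 5 ≤ T) :
    ((Fintype.card P.Gen : ℝ≥0∞) / P.q) ^ (m + n) * badProbability P σ γ C c t ≤
      3 * n * (σ ^ (k + 1)) ^ 2 * dhExperiment P σ (reduction γ C k c) T true := by
  set N := σ ^ (k + 1) with hN
  have : NeZero N := ⟨pow_ne_zero _ hσ⟩
  set Q := (Fintype.card P.Gen : ℝ≥0∞) / P.q with hQ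
  have hb := badProbability_le (P := P) (σ := σ) γ C c ht
  have hmain : ∀ g : P.Gen, Q ^ m * (Q ^ n *
      mean (PMF.uniformOfFintype (Fin N)) fun i => mean (PMF.uniformOfFintype (Fin N)) fun j =>
      mean (PMF.uniformOfFintype (Fin 3)) fun h =>
      mean (PMF.uniformOfFintype (Fin m → P.Gen)) fun s =>
      mean (PMF.uniformOfFintype (Fin n → P.Gen)) fun s' =>
      mean (PMF.uniformOfFintype (Fin n)) fun k₀ =>
      mean (idealSteps (secrets γ s s') C (uniformSampler P n) t
        (⟨[c], initialMemory (adversaryInput σ C (secrets γ s s'))⟩, ([] : History P σ n))) fun st =>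
        open Classical in if Collision (secrets γ s s') st.2 i j h k₀ then 1 else 0) ≤
      mean (PMF.uniformOfFintype (Fin P.q × Fin P.q)) fun z =>
      mean (steps noOracle T ⟨[reduction γ C k c], initialMemory [σ, P.p, P.q, P.code g.1,
        P.code (g.1 ^ (z.1 : ℕ)), P.code (g.1 ^ (z.2 : ℕ))]⟩) fun s =>
        if s.mem 1 0 = P.code (g.1 ^ ((z.1 : ℕ) * (z.2 : ℕ))) then 1 else 0 := by
    intro g
    -- For a fixed challenge, the preparation makes the guesses and the simulation yields the
    -- collision probability for them.
    have hz : ∀ z : Fin P.q × Fin P.q,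
        (mean (PMF.uniformOfFintype (Fin N)) fun i => mean (PMF.uniformOfFintype (Fin N)) fun j =>
          mean (PMF.uniformOfFintype (Fin 3)) fun h =>
          mean (PMF.uniformOfFintype (Fin m → Fin P.q)) fun r =>
          mean (PMF.uniformOfFintype (Fin n → Fin P.q)) fun r' =>
          mean (PMF.uniformOfFintype (Fin n)) fun k₀ =>
            collisionValue σ γ C c t g z i j h r r' k₀) ≤
        mean (steps noOracle T ⟨[reduction γ C k c], initialMemory [σ, P.p, P.q, P.code g.1,
          P.code (g.1 ^ (z.1 : ℕ)), P.code (g.1 ^ (z.2 : ℕ))]⟩) fun s =>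
          if s.mem 1 0 = P.code (g.1 ^ ((z.1 : ℕ) * (z.2 : ℕ))) then 1 else 0 := by
      intro z
      refine le_trans ?_ (value_le_mean _ hT _ _)
      refine le_trans ?_ (value_reduction (σ := σ) _ γ C k c (100 * t) rfl rfl)
      refine mean_prepare (P := P) (σ := σ) γ C k ?_ ?_ ?_ ?_ ?_ (Nat.mod_eq_of_lt hlt)
        (fun i j h r r' k₀ => collisionValue σ γ C c t g z i j h r r' k₀) _ ?_
      · simp [initialMemory]
      · simp [initialMemory]
      · simp [initialMemory]
      · simp
      · intro a x a0 a2 a7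
        simp [initialMemory, a0, a2, a7]
      · intro i j h r r' k₀ N' h0 h20 h21 h22 h23 h24 h6 h4 h30 hzero
        have e3 : ((initialMemory [σ, P.p, P.q, P.code g.1, P.code (g.1 ^ (z.1 : ℕ)),
            P.code (g.1 ^ (z.2 : ℕ))]).write 2 0 (2 ^ σ)).write 7 0 σ 0 3 = P.code g.1 := by
          simp [initialMemory]
        rw [e3] at h6 h30
        refine collisionValue_le_value γ C c t g z i j h r r' k₀ N' (fun x => ?_) h20 h21 h22 h23
          h24 h6 h4 h30 hzero
        rw [h0]
        simp [initialMemory]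
    refine le_trans ?_ (mean_mono _ hz)
    refine le_of_le_of_eq ?_ (mean_comm _ _ _)
    rw [← mean_mul_left, ← mean_mul_left]
    refine mean_mono _ fun i => ?_
    refine le_of_le_of_eq ?_ (mean_comm _ _ _)
    rw [← mean_mul_left, ← mean_mul_left]
    refine mean_mono _ fun j => ?_
    refine le_of_le_of_eq ?_ (mean_comm _ _ _)
    rw [← mean_mul_left, ← mean_mul_left]
    refine mean_mono _ fun h => ?_
    exact mean_collision_le_collisionValue γ C c t g i j h
  have hg := mean_mono (PMF.uniformOfFintype P.Gen) hmain
  rw [mean_const, ← dhExperiment_eq] at hg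
  clear hmain
  generalize (mean (PMF.uniformOfFintype (Fin N)) fun i =>
    mean (PMF.uniformOfFintype (Fin N)) fun j => _) = X at hb hg
  calc Q ^ (m + n) * badProbability P σ γ C c t ≤ Q ^ (m + n) * (N * (N * (3 * (n * X)))) := by
        gcongr
    _ = 3 * n * (N : ℝ≥0∞) ^ 2 * (Q ^ m * (Q ^ n * X)) := by
        rw [pow_add]
        ring
    _ ≤ _ := by
        rw [hN]
        push_cast
        gcongr

/-! ### The number of generators -/

/-- The product of the quotients `p / (p - 1)` telescopes. If `a` is larger than all elements of
`S`, then `S` lies in `[2, a)`, so `a ≥ S.card + 2` and `a / (a - 1) ≤ (S.card + 2) / (S.card + 1)`.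
-/
theorem prod_le_card_add_one_mul_prod_sub_one (S : Finset ℕ) (hS : ∀ p ∈ S, 2 ≤ p) :
    ∏ p ∈ S, p ≤ (S.card + 1) * ∏ p ∈ S, (p - 1) := by
  induction S using Finset.induction_on_max with
  | empty => simp
  | insert a S ha ih =>
    have haS : a ∉ S := fun h => lt_irrefl _ (ha a h)
    have hcard : S.card + 2 ≤ a := by
      have h1 : S ⊆ Finset.Ico 2 a := fun p hp =>
        Finset.mem_Ico.mpr ⟨hS p (Finset.mem_insert_of_mem hp), ha p hp⟩
      have h2 := Finset.card_le_card h1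
      have h3 := hS a (Finset.mem_insert_self a S)
      rw [Nat.card_Ico] at h2
      omega
    rw [Finset.prod_insert haS, Finset.prod_insert haS, Finset.card_insert_of_notMem haS]
    have h := ih fun p hp => hS p (Finset.mem_insert_of_mem hp)
    obtain ⟨b, rfl⟩ := Nat.exists_eq_add_of_le hcard
    calc _ ≤ (S.card + 2 + b) * ((S.card + 1) * ∏ p ∈ S, (p - 1)) := by gcongr
      _ = ((S.card + 2 + b) * (S.card + 1)) * ∏ p ∈ S, (p - 1) := by ring
      _ ≤ ((S.card + 1 + 1) * (S.card + 2 + b - 1)) * ∏ p ∈ S, (p - 1) := by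
          refine Nat.mul_le_mul_right _ ?_
          have : S.card + 2 + b - 1 = S.card + 1 + b := by omega
          rw [this]
          nlinarith
      _ = _ := by ring

/-- The quotient `q / φ(q)` is the product of `p / (p - 1)` over the prime divisors of `q`, and `2 ^
ω ≤ q` if there are `ω` of them. This crude bound already makes the loss polynomial. -/
theorem le_log_mul_totient {q : ℕ} (hq : q ≠ 0) : q ≤ (Nat.log 2 q + 1) * q.totient := by
  have h2 : ∀ p ∈ q.primeFactors, 2 ≤ p := fun p hp => (Nat.prime_of_mem_primeFactors hp).two_le
  have hω : q.primeFactors.card ≤ Nat.log 2 q := by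
    refine Nat.le_log_of_pow_le one_lt_two ?_
    exact (Finset.pow_card_le_prod _ _ _ h2).trans
      (Nat.le_of_dvd (Nat.pos_of_ne_zero hq) q.prod_primeFactors_dvd)
  have hpos : 0 < ∏ p ∈ q.primeFactors, (p - 1) :=
    Finset.prod_pos fun p hp => by have := h2 p hp; omega
  refine Nat.le_of_mul_le_mul_right ?_ hpos
  calc q * ∏ p ∈ q.primeFactors, (p - 1) = q.totient * ∏ p ∈ q.primeFactors, p :=
        (Nat.totient_mul_prod_primeFactors q).symm
    _ ≤ q.totient * ((q.primeFactors.card + 1) * ∏ p ∈ q.primeFactors, (p - 1)) := by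
        gcongr
        exact prod_le_card_add_one_mul_prod_sub_one _ h2
    _ ≤ q.totient * ((Nat.log 2 q + 1) * ∏ p ∈ q.primeFactors, (p - 1)) := by gcongr
    _ = _ := by ring

theorem Params.card_gen (P : Params) : Fintype.card P.Gen = P.q.totient := by
  classical
  have h := IsCyclic.card_orderOf_eq_totient (α := (ZMod P.p)ˣ) (d := P.q)
    (by rw [ZMod.card_units]; exact P.dvd)
  rw [← h, ← Fintype.card_subtype]
  exact Fintype.card_congr (Equiv.refl _)

theorem Params.q_le_mul_card_gen (P : Params) {B : ℕ} (hB : P.p ≤ 2 ^ B) :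
    P.q ≤ (B + 1) * Fintype.card P.Gen := by
  have h1 : P.q ≤ 2 ^ B := (Nat.le_of_dvd (by have := P.prime.two_le; omega) P.dvd).trans
    ((Nat.sub_le _ _).trans hB)
  have h2 : Nat.log 2 P.q ≤ B := (Nat.log_mono_right h1).trans (Nat.log_pow one_lt_two B).le
  rw [P.card_gen]
  exact (le_log_mul_totient P.q_pos.ne').trans (by gcongr)

theorem Params.one_le_mul_card_gen_div (P : Params) {B : ℕ} (hB : P.p ≤ 2 ^ B) :
    1 ≤ ((B + 1 : ℕ) : ℝ≥0∞) * ((Fintype.card P.Gen : ℝ≥0∞) / P.q) := by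
  rw [← mul_div_assoc, ENNReal.le_div_iff_mul_le (by simp [P.q_pos.ne']) (by simp), one_mul]
  exact_mod_cast P.q_le_mul_card_gen hB

/-! ### The eavesdropping experiment and the ideal experiment -/

theorem mean_setup (P : Params) (σ n m : ℕ) (F : Setup P σ n m → ℝ≥0∞) :
    mean (setup P σ n m) F =
      mean (PMF.uniformOfFintype (Fin m → P.Gen)) fun g =>
      mean (PMF.uniformOfFintype (Fin n → P.Gen)) fun r =>
      mean (PMF.uniformOfFintype (Key P → Fin (2 ^ σ))) fun H => F (Setup.ofHash g r H) := by
  let e : (ZMod P.p → Fin (2 ^ σ)) × (ZMod P.p → Fin (2 ^ σ)) × (ZMod P.p → Fin (2 ^ σ)) ≃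
      (Key P → Fin (2 ^ σ)) :=
    { toFun := fun h a => ![h.1, h.2.1, h.2.2] a.1 a.2
      invFun := fun H => (fun z => H (0, z), fun z => H (1, z), fun z => H (2, z))
      left_inv := fun h => rfl
      right_inv := fun H => by
        funext ⟨a, z⟩
        fin_cases a <;> rfl }
  simp only [setup, mean_bind, mean_pure]
  congr 1
  funext g
  congr 1
  funext r
  rw [← mean_uniform_equiv e]
  simp only [mean_uniform_prod]
  rfl

theorem eavesdropExperiment_apply (γ : Membership n m) (C : Finset (Fin n)) (c : Cmd) (t : ℕ) :
    eavesdropExperiment P σ γ C c t 1 =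
      mean (PMF.uniformOfFintype (Fin m → P.Gen)) fun g =>
      mean (PMF.uniformOfFintype (Fin n → P.Gen)) fun r =>
      mean (PMF.uniformOfFintype (Key P → Fin (2 ^ σ))) fun H =>
      mean (steps (eavesdropping (Setup.ofHash g r H) γ C) t
        ⟨[c], initialMemory (adversaryInput σ C (secrets γ g r))⟩) fun s =>
        if s.mem 1 0 = 1 then 1 else 0 := by
  rw [eavesdropExperiment, PMF.bind_apply]
  change mean _ _ = _
  rw [mean_setup]
  simp only [output_apply, Setup.secret_ofHash]
  rfl

open Classical in
/-- The probability of output `1` in the ideal experiment. -/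
noncomputable def idealProbability (P : Params) (σ : ℕ) (γ : Membership n m) (C : Finset (Fin n))
    (c : Cmd) (t : ℕ) : ℝ≥0∞ :=
  mean (PMF.uniformOfFintype (Fin m → P.Gen)) fun g =>
  mean (PMF.uniformOfFintype (Fin n → P.Gen)) fun r =>
  mean (idealSteps (secrets γ g r) C (uniformSampler P n) t
    (⟨[c], initialMemory (adversaryInput σ C (secrets γ g r))⟩, ([] : History P σ n))) fun st =>
    if st.1.mem 1 0 = 1 then 1 else 0

theorem mean_idealSteps_le_add (γ : Membership n m) (g : Fin m → P.Gen) (r : Fin n → P.Gen)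
    (C : Finset (Fin n)) (f : Config → ℝ≥0∞) (hf : ∀ s, f s ≤ 1) (t : ℕ) (cfg : Config) :
    (mean (idealSteps (secrets γ g r) C (uniformSampler P n) t (cfg, ([] : History P σ n)))
      fun st => f st.1) ≤
    (mean (PMF.uniformOfFintype (Key P → Fin (2 ^ σ))) fun H =>
      mean (steps (eavesdropping (Setup.ofHash g r H) γ C) t cfg) f) +
    mean (idealSteps (secrets γ g r) C (uniformSampler P n) t (cfg, ([] : History P σ n)))
      fun st => open Classical in if Bad (secrets γ g r) st.2 then 1 else 0 := by
  classical
  -- The empty history is not bad, and completing its empty table leaves `H` unchanged.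
  refine le_trans ?_ (add_le_add_left (mean_idealSteps_le γ g r C f t cfg [] id) _)
  rw [← mean_add]
  refine mean_mono _ fun st => ?_
  split_ifs <;> simp [hf]

/-- Both experiments agree up to the probability of a bad event. -/
theorem mean_steps_le_add (γ : Membership n m) (g : Fin m → P.Gen) (r : Fin n → P.Gen)
    (C : Finset (Fin n)) (f : Config → ℝ≥0∞) (hf : ∀ s, f s ≤ 1) (t : ℕ) (cfg : Config) :
    (mean (PMF.uniformOfFintype (Key P → Fin (2 ^ σ))) fun H =>
      mean (steps (eavesdropping (Setup.ofHash g r H) γ C) t cfg) f) ≤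
    (mean (idealSteps (secrets γ g r) C (uniformSampler P n) t (cfg, ([] : History P σ n)))
      fun st => f st.1) +
    mean (idealSteps (secrets γ g r) C (uniformSampler P n) t (cfg, ([] : History P σ n)))
      fun st => open Classical in if Bad (secrets γ g r) st.2 then 1 else 0 := by
  -- The converse inequality comes from the same bound for `1 - f`.
  have h := mean_idealSteps_le_add (σ := σ) γ g r C (fun s => 1 - f s) (fun s => tsub_le_self) t cfg
  set I := mean (idealSteps (secrets γ g r) C (uniformSampler P n) t
    (cfg, ([] : History P σ n))) fun st => f st.1
  have hI : I + mean (idealSteps (secrets γ g r) C (uniformSampler P n) t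
      (cfg, ([] : History P σ n))) (fun st => 1 - f st.1) = 1 := by
    rw [← mean_add]
    simp only [add_tsub_cancel_of_le (hf _), mean_const]
  set R' := mean (PMF.uniformOfFintype (Key P → Fin (2 ^ σ))) fun H =>
      mean (steps (eavesdropping (Setup.ofHash g r H) γ C) t cfg) fun s => 1 - f s with hR'
  have hR : (mean (PMF.uniformOfFintype (Key P → Fin (2 ^ σ))) fun H =>
      mean (steps (eavesdropping (Setup.ofHash g r H) γ C) t cfg) f) + R' = 1 := by
    rw [hR', ← mean_add]
    simp only [← mean_add, add_tsub_cancel_of_le (hf _), mean_const]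
  have hfin : R' ≠ ⊤ := fun h => by simp [h] at hR
  refine ENNReal.le_of_add_le_add_right hfin ?_
  rw [hR, add_assoc, add_comm _ R']
  exact hI.ge.trans (by gcongr)

theorem idealProbability_le (γ : Membership n m) (C : Finset (Fin n)) (c : Cmd) (t : ℕ) :
    idealProbability P σ γ C c t ≤
      eavesdropExperiment P σ γ C c t 1 + badProbability P σ γ C c t := by
  rw [eavesdropExperiment_apply, badProbability, ← mean_add]
  refine mean_mono _ fun g => ?_
  rw [← mean_add]
  refine mean_mono _ fun r => ?_
  exact mean_idealSteps_le_add γ g r C (fun s => if s.mem 1 0 = 1 then 1 else 0)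
    (fun s => by split_ifs <;> simp) t _

theorem eavesdropExperiment_le (γ : Membership n m) (C : Finset (Fin n)) (c : Cmd) (t : ℕ) :
    eavesdropExperiment P σ γ C c t 1 ≤
      idealProbability P σ γ C c t + badProbability P σ γ C c t := by
  rw [eavesdropExperiment_apply, badProbability, idealProbability, ← mean_add]
  refine mean_mono _ fun g => ?_
  rw [← mean_add]
  refine mean_mono _ fun r => ?_
  exact mean_steps_le_add γ g r C (fun s => if s.mem 1 0 = 1 then 1 else 0)
    (fun s => by split_ifs <;> simp) t _

/-- The ideal experiment does not depend on the membership of uncorrupted nodes. -/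
theorem idealProbability_congr {γ₁ γ₀ : Membership n m} {C : Finset (Fin n)}
    (h : ∀ k ∈ C, γ₁ k = γ₀ k) (c : Cmd) (t : ℕ) :
    idealProbability P σ γ₁ C c t = idealProbability P σ γ₀ C c t := by
  unfold idealProbability
  congr 1
  funext g
  congr 1
  funext r
  have hin : adversaryInput σ C (secrets γ₁ g r) = adversaryInput σ C (secrets γ₀ g r) := by
    unfold adversaryInput secrets
    congr 4
    funext k
    split_ifs with hk
    · rw [h k hk]
    · rfl
  rw [hin]
  exact mean_idealSteps_congr _ _ C (fun s => if s.mem 1 0 = 1 then 1 else 0) t _ _ _ fun _ => rfl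

theorem badProbability_ne_top (γ : Membership n m) (C : Finset (Fin n)) (c : Cmd) (t : ℕ) :
    badProbability P σ γ C c t ≠ ⊤ := by
  refine ne_top_of_le_ne_top ENNReal.one_ne_top ?_
  unfold badProbability
  calc _ ≤ mean (PMF.uniformOfFintype (Fin m → P.Gen)) fun _ => 1 := by
        refine mean_mono _ fun g => ?_
        calc _ ≤ mean (PMF.uniformOfFintype (Fin n → P.Gen)) fun _ => 1 := by
              refine mean_mono _ fun r => ?_
              calc _ ≤ mean _ fun _ => 1 := mean_mono _ fun st => by split_ifs <;> simp
                _ = 1 := mean_const _ _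
          _ = 1 := mean_const _ _
    _ = 1 := mean_const _ _

/-- Each real experiment differs from its ideal one by at most the probability of its bad event, and
the two ideal experiments coincide. -/
theorem advantage_le {γ₁ γ₀ : Membership n m} {C : Finset (Fin n)}
    (h : ∀ k ∈ C, γ₁ k = γ₀ k) (c : Cmd) (t : ℕ) :
    advantage P σ γ₁ γ₀ C c t ≤
      (badProbability P σ γ₁ C c t).toReal + (badProbability P σ γ₀ C c t).toReal := by
  have b1 := badProbability_ne_top (P := P) (σ := σ) γ₁ C c t
  have b0 := badProbability_ne_top (P := P) (σ := σ) γ₀ C c t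
  have e1 := (eavesdropExperiment P σ γ₁ C c t).apply_ne_top 1
  have e0 := (eavesdropExperiment P σ γ₀ C c t).apply_ne_top 1
  have hle : ∀ {x y a b : ℝ≥0∞} {i : ℝ≥0∞}, y ≠ ⊤ → a ≠ ⊤ → b ≠ ⊤ → x ≤ i + a → i ≤ y + b →
      x.toReal ≤ y.toReal + b.toReal + a.toReal := by
    intro x y a b i hy ha hb h1 h2
    rw [← ENNReal.toReal_add hy hb, ← ENNReal.toReal_add (by finiteness) ha]
    exact ENNReal.toReal_mono (by finiteness) (h1.trans (add_le_add_left h2 a))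
  have h1 := hle e0 b1 b0 (eavesdropExperiment_le γ₁ C c t)
    ((idealProbability_congr h c t).le.trans (idealProbability_le γ₀ C c t))
  have h0 := hle e1 b0 b1 (eavesdropExperiment_le γ₀ C c t)
    ((idealProbability_congr h c t).ge.trans (idealProbability_le γ₁ C c t))
  unfold advantage
  rw [abs_le]
  constructor <;> linarith

/-! ### Polynomial bounds -/

/-- The factor `(φ(q) / q) ^ (m + n)` moves to the other side, since `q / φ(q) ≤ B + 1`. -/
theorem badProbability_toReal_le (γ : Membership n m) (C : Finset (Fin n)) (c : Cmd)
    {B : ℕ} (hB : P.p ≤ 2 ^ B) (k t T : ℕ) [NeZero n] (hσ : σ ≠ 0) (ht : t ≤ σ ^ (k + 1))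
    (hlt : σ ^ (k + 1) < 2 ^ σ) (hT : 100 * t + (prepare γ C k).time + 4 * σ + 5 ≤ T) :
    (badProbability P σ γ C c t).toReal ≤
      (B + 1) ^ (m + n) * (3 * n * (σ ^ (k + 1)) ^ 2) *
        (dhExperiment P σ (reduction γ C k c) T true).toReal := by
  have h := badProbability_le_dhExperiment (P := P) γ C c k t T hσ ht hlt hT
  set Q := (Fintype.card P.Gen : ℝ≥0∞) / P.q
  have h1 : 1 ≤ ((B + 1 : ℕ) : ℝ≥0∞) ^ (m + n) * Q ^ (m + n) := by
    rw [← mul_pow]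
    exact one_le_pow₀ (P.one_le_mul_card_gen_div hB)
  have h2 : badProbability P σ γ C c t ≤ ((B + 1 : ℕ) : ℝ≥0∞) ^ (m + n) *
      (3 * n * (σ ^ (k + 1)) ^ 2 * dhExperiment P σ (reduction γ C k c) T true) := by
    calc badProbability P σ γ C c t ≤
          ((B + 1 : ℕ) : ℝ≥0∞) ^ (m + n) * Q ^ (m + n) * badProbability P σ γ C c t :=
          le_mul_of_one_le_left' h1
      _ = ((B + 1 : ℕ) : ℝ≥0∞) ^ (m + n) * (Q ^ (m + n) * badProbability P σ γ C c t) :=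
          mul_assoc _ _ _
      _ ≤ _ := by gcongr
  have hfin := (dhExperiment P σ (reduction γ C k c) T).apply_ne_top true
  have h3 := ENNReal.toReal_mono (by finiteness) h2
  refine h3.trans (le_of_eq ?_)
  have hB1 : ((B : ℝ≥0∞) + 1).toReal = B + 1 := by exact_mod_cast ENNReal.toReal_natCast (B + 1)
  simp [mul_assoc, hB1]

/-- The probability of a bad event is negligible. -/
theorem negligible_badProbability (τ : ℕ → ℝ) (par : ℕ → Params) {e : ℕ}
    (hsize : ∀ σ : ℕ, (par σ).p ≤ 2 ^ (σ ^ e + e)) (hDH : DiffieHellman τ par)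
    (γ : Membership n m) (C : Finset (Fin n)) (c : Cmd) (k : ℕ) [NeZero n] (d : ℕ) :
    ∀ᶠ σ : ℕ in Filter.atTop,
      2 * ((σ : ℝ) ^ d * (badProbability (par σ) σ γ C c (σ ^ k + k)).toReal) < τ σ := by
  -- The exponent `k + 2` covers the running time of the reduction. Of the powers of `σ`, `(e + 1) *
  -- (m + n)` pay for the generators, `2 * (k + 1)` for the two guessed calls, and one for the
  -- factor `6 * n`, which includes the `2` in the claim.
  have hd := hDH (reduction γ C k c) (k + 2) (d + (e + 1) * (m + n) + 1 + (k + 1) * 2)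
  have hexp : ∀ᶠ σ : ℕ in Filter.atTop, σ ^ (k + 1) < 2 ^ σ := by
    filter_upwards [(tendsto_pow_const_div_const_pow_of_one_lt (k + 1) (one_lt_two (α := ℝ))).eventually
      (gt_mem_nhds one_pos)] with σ h
    rw [div_lt_one (by positivity)] at h
    exact_mod_cast h
  filter_upwards [hd, hexp, Filter.eventually_ge_atTop
    (200 + 200 * k + (prepare γ C k).time + e + 6 * n)] with σ h1 h2 h3
  refine lt_of_le_of_lt ?_ h1
  have hpow : ∀ j, 1 ≤ σ ^ j := fun j => Nat.one_le_pow _ _ (by omega)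
  have ht : σ ^ k + k ≤ σ ^ (k + 1) := by
    have := hpow k
    rw [pow_succ]
    nlinarith
  have hT : 100 * (σ ^ k + k) + (prepare γ C k).time + 4 * σ + 5 ≤ σ ^ (k + 2) + (k + 2) := by
    have h4 := hpow k
    calc 100 * (σ ^ k + k) + (prepare γ C k).time + 4 * σ + 5 ≤ 100 * σ ^ k + 5 * σ := by omega
      _ ≤ σ * σ ^ k + 5 * (σ ^ k * σ) := by
          refine Nat.add_le_add (Nat.mul_le_mul_right _ (by omega)) ?_
          exact Nat.mul_le_mul_left _ (Nat.le_mul_of_pos_left _ h4)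
      _ = 6 * (σ ^ k * σ) := by ring
      _ ≤ σ * (σ ^ k * σ) := by
          gcongr
          omega
      _ = σ ^ (k + 2) := by ring
      _ ≤ _ := Nat.le_add_right _ _
  have hB : σ ^ e + e + 1 ≤ σ ^ (e + 1) := by
    have := hpow e
    rw [pow_succ]
    nlinarith
  have hb := badProbability_toReal_le (P := par σ) γ C c (hsize σ) k _ _ (by omega) ht h2 hT
  set D := (dhExperiment (par σ) σ (reduction γ C k c) (σ ^ (k + 2) + (k + 2)) true).toReal with hD
  have hD0 : 0 ≤ D := ENNReal.toReal_nonneg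
  have hB' : (((σ ^ e + e : ℕ) : ℝ) + 1) ≤ (σ : ℝ) ^ (e + 1) := by exact_mod_cast hB
  have hn' : 6 * (n : ℝ) ≤ σ := by
    have : 6 * n ≤ σ := by omega
    exact_mod_cast this
  calc 2 * ((σ : ℝ) ^ d * (badProbability (par σ) σ γ C c (σ ^ k + k)).toReal) ≤
        2 * ((σ : ℝ) ^ d * ((((σ ^ e + e : ℕ) : ℝ) + 1) ^ (m + n) *
          (3 * n * (σ ^ (k + 1)) ^ 2) * D)) := by gcongr
    _ = (σ : ℝ) ^ d * (((σ ^ e + e : ℕ) : ℝ) + 1) ^ (m + n) * (6 * n) * (σ ^ (k + 1)) ^ 2 * D := by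
        ring
    _ ≤ (σ : ℝ) ^ d * (σ ^ (e + 1)) ^ (m + n) * σ * (σ ^ (k + 1)) ^ 2 * D := by gcongr
    _ = _ := by
        rw [← pow_mul, ← pow_mul]
        ring

end Handshake

/-! ### Indistinguishability to eavesdroppers -/

theorem mainTheorem3 (τ : ℕ → ℝ) (par : ℕ → Handshake.Params)
    (hsize : ∃ k : ℕ, ∀ σ : ℕ, (par σ).p ≤ 2 ^ (σ ^ k + k))
    (hDH : Handshake.DiffieHellman τ par)
    (n m : ℕ) (γ₁ γ₀ : Handshake.Membership n m) (i : Fin n) (G : Fin m)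
    (hother : ∀ k : Fin n, k ≠ i → γ₁ k = γ₀ k)
    (hmem : γ₁ i = some G) (hnot : γ₀ i ≠ some G)
    (C : Finset (Fin n)) (hi : i ∉ C)
    (c : Handshake.Cmd) (k : ℕ) :
    Handshake.Negligible τ fun σ =>
      Handshake.advantage (par σ) σ γ₁ γ₀ C c (σ ^ k + k) := by
  obtain ⟨e, he⟩ := hsize
  have : NeZero n := ⟨fun h => (h ▸ i).elim0⟩
  intro d
  filter_upwards [Handshake.negligible_badProbability τ par he hDH γ₁ C c k d,
    Handshake.negligible_badProbability τ par he hDH γ₀ C c k d] with σ h1 h0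
  have h := mul_le_mul_of_nonneg_left (Handshake.advantage_le (P := par σ) (σ := σ)
    (fun k hk => hother k fun hki => hi (hki ▸ hk)) c (σ ^ k + k))
    (pow_nonneg (Nat.cast_nonneg (α := ℝ) σ) d)
  -- Each of the two bad probabilities, multiplied by `σ ^ d`, is less than half the threshold.
  linarith
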